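/- **Setting.** Let $n\ge 1$, let $E_{i,j}$ be the $n\times n$ matrix units, and let $h_k=E_{k,k}-E_{k+1,k+1}$ for $1\le k\le n-1$. Let $\lambda=(\lambda_1,\dots,\lambda_{n-1})\in\mathbb C^{n-1}$, viewed as the weight of $sl(n)=sl(n,\mathbb C)$ with $\lambda(h_k)=\lambda_k$. Let $M_\lambda$ be the Verma module of $sl(n)$ with highest weight $\lambda$, i.e. $U(sl(n))$ modulo the left ideal generated by all $E_{i,j}$ with $i<j$ and all $h_k-\lambda_k$; let $v_\lambda$ be the class of $1$. A *singular vector* is a nonzero weight vector $u\in M_\lambda$ with $E_{k,k+1}u=0$ for $k=1,\dots,n-1$. Singular vectors are counted up to nonzero scalar multiples. **The map $\tau^{-1}$.** Let $\tau^{-1}:\mathbb C[x_{i,j}\mid 1\le j<i\le n]\to M_\lambda$ be the linear map $x^\alpha\mapsto E^\alpha v_\lambda$, where $$E^\alpha=E_{2,1}^{\alpha_{2,1}}E_{3,1}^{\alpha_{3,1}}E_{3,2}^{\alpha_{3,2}}E_{4,1}^{\alpha_{4,1}}\cdots E_{n,1}^{\alpha_{n,1}}\cdots E_{n,n-1}^{\alpha_{n,n-1}}.$$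 **The operators $\eta_k^\mu$.** On formal sums of monomials in the $x_{i,j}$ in which the exponents of the $x_{k+1,k}$ are complex and the exponents of all other variables are natural numbers, put, for $1\le k\le n-1$ and $\mu\in\mathbb C$, $$\eta_k^{\mu}=\sum_{p=0}^\infty\frac{\mu(\mu-1)\cdots(\mu-p+1)}{p!}\,x_{k+1,k}^{\mu-p}\Big(\sum_{j=1}^{k-1}x_{k+1,j}\,\partial_{x_{k,j}}\Big)^{p};$$ only finitely many terms contribute to each coefficient. **The series $\theta_{\vec i}$.** Let $\vec i=(i_1,\dots,i_{n-1})$ be integers with $0\le i_p\le p$. Put $\lambda^{(n-1)}_j=\lambda_j$ for $1\le j\le n-1$ and, for $p=n-1,n-2,\dots,2$ and $1\le j\le p-1$, $$\lambda^{(p-1)}_j=\begin{cases}\lambda^{(p)}_j&\text{if } i_p=0\text{ or } j<i_p-1,\\ \lambda^{(p)}_{i_p}+\lambda^{(p)}_{i_p-1}+1&\text{if } i_p\ne 0\text{ and } j=i_p-1,\\ \lambda^{(p)}_{j+1}&\text{if } i_p\neq 0\text{ and } j\ge i_p.\end{cases}$$ Let $B_p$ be the identity if $i_p=0$, and otherwise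 $$B_p=\eta_p^{e_{p,p}}\,\eta_{p-1}^{e_{p,p-1}}\cdots\eta_{i_p}^{e_{p,i_p}},\qquad e_{p,k}=\sum_{q=i_p}^{k}\big(\lambda^{(p)}_q+1\big).$$ Set $\theta_{\vec i}=B_1B_2\cdots B_{n-1}(1)$. **Corollary 3.4.** The map $\tau^{-1}$ is a linear isomorphism, and: 1. $M_\lambda$ has at most $n!$ singular vectors up to scalar multiples. 2. The singular vectors of $M_\lambda$ are exactly the nonzero scalar multiples of the vectors $\tau^{-1}(\theta_{\vec i})$, where $\vec i$ is such that $\theta_{\vec i}$ is a polynomial. 3. $M_\lambda$ has exactly $n!$ singular vectors up to scalar multiples if and only if $\lambda$ is dominant integral, i.e. $\lambda_k\in\mathbb N=\{0,1,2,\dots\}$ for $k=1,\dots,n-1$. 4. In that case every $\theta_{\vec i}$ is a polynomial, the $n!$ vectors $\tau^{-1}(\theta_{\vec i})$ are pairwise non-proportional, and they are all the singular vectors up to scalar multiples. -/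

import Mathlib

noncomputable section

namespace SlVerma

open LieAlgebra.SpecialLinear

/-! Throughout, `n = r + 1`.  Matrix positions `1, …, n` of the usual notation are the elements
`0, …, r` of `Fin (r + 1)`, and simple roots `1, …, n - 1` are the elements `0, …, r - 1` of
`Fin r`: the simple root `k : Fin r` belongs to the positions `k.castSucc` and `k.succ`. -/

/-- The complex Lie algebra `sl(n)`, `n = r + 1`. -/
abbrev Sl (r : ℕ) : Type := sl (Fin (r + 1)) ℂ

/-- The universal enveloping algebra `U(sl(n))`. -/
abbrev USl (r : ℕ) : Type := UniversalEnvelopingAlgebra ℂ (Sl r)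

/-- The matrix unit `E_{a,b}`, `a ≠ b`, as an element of `U(sl(n))`. -/
def E {r : ℕ} (a b : Fin (r + 1)) (h : a ≠ b) : USl r :=
  UniversalEnvelopingAlgebra.ι ℂ (single a b h (1 : ℂ))

/-- The element `h_k = E_{k,k} - E_{k+1,k+1}` of the Cartan subalgebra, in `U(sl(n))`. -/
def H {r : ℕ} (k : Fin r) : USl r :=
  UniversalEnvelopingAlgebra.ι ℂ (singleSubSingle k.castSucc k.succ (1 : ℂ))

/-! ### The Verma module -/

/-- The left ideal of `U(sl(n))` generated by the positive root vectors `E_{a,b}`, `a < b`, and by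
the elements `h_k - λ_k`.  (A left ideal is what `Ideal` means in a noncommutative ring.) -/
def vermaIdeal {r : ℕ} (lam : Fin r → ℂ) : Ideal (USl r) :=
  Ideal.span ({x | ∃ (a b : Fin (r + 1)) (h : a < b), x = E a b h.ne} ∪
    {x | ∃ k : Fin r, x = H k - algebraMap ℂ (USl r) (lam k)})

/-- The Verma module `M_λ` of highest weight `λ`, where `λ(h_k) = lam k`, as a left
`U(sl(n))`-module. -/
abbrev Verma {r : ℕ} (lam : Fin r → ℂ) : Type := USl r ⧸ vermaIdeal lam

/-- The highest weight vector `v_λ`. -/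
def hwVec {r : ℕ} (lam : Fin r → ℂ) : Verma lam := Submodule.Quotient.mk 1

/-- A singular vector: a nonzero weight vector annihilated by all `E_{k,k+1}`. -/
def IsSingular {r : ℕ} (lam : Fin r → ℂ) (u : Verma lam) : Prop :=
  u ≠ 0 ∧ (∃ mu : Fin r → ℂ, ∀ k, H k • u = mu k • u) ∧
    ∀ k : Fin r, E k.castSucc k.succ (Fin.castSucc_lt_succ (i := k)).ne • u = 0

/-- The singular vectors up to scalar multiples: the set of lines spanned by singular vectors. -/
def singularLines {r : ℕ} (lam : Fin r → ℂ) : Set (Submodule ℂ (Verma lam)) :=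
  {L | ∃ u, IsSingular lam u ∧ L = Submodule.span ℂ {u}}

/-! ### Polynomials and the map `τ⁻¹` -/

/-- The pairs `(i, j)` with `j < i`; they index the negative root vectors `E_{i,j}` and the
variables `x_{i,j}`. -/
abbrev NegRoot (r : ℕ) : Type := {p : Fin (r + 1) × Fin (r + 1) // p.2 < p.1}

/-- The pair `(i, j)`. -/
abbrev nr {r : ℕ} {i j : Fin (r + 1)} (h : j < i) : NegRoot r := ⟨(i, j), h⟩

/-- The polynomial algebra `ℂ[x_{i,j} | j < i]`. -/
abbrev Poly (r : ℕ) : Type := MvPolynomial (NegRoot r) ℂ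

/-- The ordered monomial
`E^α = E_{2,1}^{α_{2,1}} E_{3,1}^{α_{3,1}} E_{3,2}^{α_{3,2}} E_{4,1}^{α_{4,1}} ⋯
E_{n,n-1}^{α_{n,n-1}}` of `U(sl(n))`. -/
def pbw {r : ℕ} (α : NegRoot r →₀ ℕ) : USl r :=
  ((List.finRange (r + 1)).map fun i =>
    ((List.finRange (r + 1)).map fun j =>
      if h : j < i then E i j h.ne' ^ α (nr h) else 1).prod).prod

/-- The linear map `τ⁻¹ : ℂ[x_{i,j} | j < i] → M_λ`, `x^α ↦ E^α v_λ`. -/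
def tauInv {r : ℕ} (lam : Fin r → ℂ) : Poly r →ₗ[ℂ] Verma lam :=
  (MvPolynomial.basisMonomials (NegRoot r) ℂ).constr ℂ fun α => pbw α • hwVec lam

/-! ### Formal series with complex exponents -/

/-- Formal sums of monomials `∏ x_{i,j}^{β_{i,j}}` with complex exponents, given by their
coefficients: `f β` is the coefficient of `x^β`. -/
abbrev Series (r : ℕ) : Type := (NegRoot r → ℂ) → ℂ

/-- A polynomial as a formal sum. -/
def toSeries {r : ℕ} (g : Poly r) : Series r := fun β =>
  ∑ m ∈ g.support, if β = (fun v => (m v : ℂ)) then g.coeff m else 0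

/-- Multiplication by the power `x_v^c`. -/
def xPow {r : ℕ} (v : NegRoot r) (c : ℂ) : Module.End ℂ (Series r) where
  toFun f := fun β => f (β - Pi.single v c)
  map_add' _ _ := rfl
  map_smul' _ _ := rfl

/-- The partial derivative `∂_v`, with `∂_v (x_v^c) = c x_v^{c-1}`. -/
def pd {r : ℕ} (v : NegRoot r) : Module.End ℂ (Series r) where
  toFun f := fun β => (β v + 1) * f (β + Pi.single v 1)
  map_add' f g := by funext β; simp [mul_add]
  map_smul' c f := by funext β; simp [mul_left_comm]

/-- The operator `∑_{j<k} x_{k+1,j} ∂_{k,j}`. -/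
def dOp {r : ℕ} (k : Fin r) : Module.End ℂ (Series r) :=
  ∑ j : {j : Fin (r + 1) // j < k.castSucc},
    xPow (nr (j.2.trans Fin.castSucc_lt_succ)) 1 * pd (nr j.2)

/-- The simple negative root `(k + 1, k)`. -/
def simpleRoot {r : ℕ} (k : Fin r) : NegRoot r := nr (Fin.castSucc_lt_succ (i := k))

/-- The falling factorial `⟨μ⟩_p = μ (μ - 1) ⋯ (μ - p + 1)`. -/
def fallFact (mu : ℂ) (p : ℕ) : ℂ := ∏ q ∈ Finset.range p, (mu - q)

/-- The power
`η_k^μ = (x_{k+1,k} + ∑_{j<k} x_{k+1,j} ∂_{k,j})^μ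
  = ∑_p ⟨μ⟩_p / p! x_{k+1,k}^{μ-p} (∑_{j<k} x_{k+1,j} ∂_{k,j})^p`.
On the series in which the exponents of the non-simple variables are natural numbers, only
finitely many terms contribute to each coefficient, and the property is inherited by the result:
see `etaPow_finite` and `IsFormal.etaPow`. -/
def etaPow {r : ℕ} (k : Fin r) (mu : ℂ) (f : Series r) : Series r := fun β =>
  ∑ᶠ p : ℕ, fallFact mu p / (p.factorial : ℂ) *
    xPow (simpleRoot k) (mu - p) ((dOp k ^ p) f) β

/-- The exponents of all the variables `x_{i,j}`, `j ≤ i - 2`, are natural numbers. -/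
def IsFormal {r : ℕ} (f : Series r) : Prop :=
  ∀ β, f β ≠ 0 → ∀ v : NegRoot r, (∀ k, v ≠ simpleRoot k) → ∃ m : ℕ, β v = m

/-! ### The series `θ_i` -/

/-- The index vectors `(i_1, …, i_{n-1})` with `0 ≤ i_p ≤ p`; `i_{p+1}` is the value at
`p : Fin r`. -/
abbrev Idx (r : ℕ) : Type := (p : Fin r) → Fin (p.val + 2)

/-- `i_{p+1}` as a natural number. -/
def Idx.get {r : ℕ} (i : Idx r) (p : ℕ) : ℕ := if h : p < r then (i ⟨p, h⟩).val else 0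

/-- The sequence `λ_1, …, λ_{n-1}` with its usual numbering from `1`. -/
def lamSeq {r : ℕ} (lam : Fin r → ℂ) (j : ℕ) : ℂ :=
  if h : 1 ≤ j ∧ j ≤ r then lam ⟨j - 1, by omega⟩ else 0

/-- The step from `λ^{(p)}` to `λ^{(p-1)}`, for `i = i_p` (numbering from `1`). -/
def stepSeq (nu : ℕ → ℂ) (i : ℕ) (j : ℕ) : ℂ :=
  if i = 0 ∨ j + 1 < i then nu j
  else if j + 1 = i then nu (j + 1) + nu j + 1
  else nu (j + 1)

/-- The operator `η_p^{e_p} η_{p-1}^{e_{p-1}} ⋯ η_i^{e_i}` (the rightmost factor acts first) with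
`e_k = ∑_{q=i}^k (ν_q + 1)`, numbering from `1`; the identity if `i = 0`. -/
def block {r : ℕ} (p : ℕ) (nu : ℕ → ℂ) (i : ℕ) (f : Series r) : Series r :=
  if i = 0 then f else
    ((List.finRange r).filter fun k => i ≤ k.val + 1 ∧ k.val + 1 ≤ p).foldl
      (fun g k => etaPow k (∑ q ∈ Finset.Icc i (k.val + 1), (nu q + 1)) g) f

/-- Apply the blocks with numbers `p, p - 1, …, 1`, in this order, where `nu = λ^{(p)}`. -/
def thetaAux {r : ℕ} (i : Idx r) : ℕ → (ℕ → ℂ) → Series r → Series r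
  | 0, _, f => f
  | p + 1, nu, f => thetaAux i p (stepSeq nu (i.get p)) (block (p + 1) nu (i.get p) f)

/-- The series `θ_i`: the blocks with numbers `n - 1, …, 1` applied to the constant `1`. -/
def theta {r : ℕ} (lam : Fin r → ℂ) (i : Idx r) : Series r :=
  thetaAux i r (lamSeq lam) (toSeries 1)

/-! ### The powers `η_k^μ` are well defined -/

theorem IsFormal.xPow_simple {r : ℕ} {f : Series r} (hf : IsFormal f) (k : Fin r) (c : ℂ) :
    IsFormal (xPow (simpleRoot k) c f) := by
  intro β h v hv
  obtain ⟨m, hm⟩ := hf _ h v hv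
  exact ⟨m, by simpa [Pi.single_apply, hv k] using hm⟩

theorem IsFormal.xPow_one {r : ℕ} {f : Series r} (hf : IsFormal f) (w : NegRoot r) :
    IsFormal (xPow w 1 f) := by
  intro β h v hv
  obtain ⟨m, hm⟩ := hf _ h v hv
  by_cases hw : v = w
  · subst hw
    refine ⟨m + 1, ?_⟩
    have : β v - 1 = m := by simpa using hm
    push_cast
    rw [← this]; ring
  · exact ⟨m, by simpa [Pi.single_apply, hw] using hm⟩

theorem IsFormal.pd {r : ℕ} {f : Series r} (hf : IsFormal f) (w : NegRoot r) :
    IsFormal (pd w f) := by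
  intro β h v hv
  have h1 : β w + 1 ≠ 0 := left_ne_zero_of_mul h
  obtain ⟨m, hm⟩ := hf _ (right_ne_zero_of_mul h) v hv
  by_cases hw : v = w
  · subst hw
    have h2 : β v + 1 = m := by simpa using hm
    rcases m with _ | m
    · exact absurd (by simpa using h2) h1
    · exact ⟨m, by push_cast at h2; exact add_right_cancel h2⟩
  · exact ⟨m, by simpa [Pi.single_apply, hw] using hm⟩

theorem dOp_ne_zero {r : ℕ} {k : Fin r} {f : Series r} {β : NegRoot r → ℂ} (h : dOp k f β ≠ 0) :
    ∃ j : {j : Fin (r + 1) // j < k.castSucc},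
      xPow (nr (j.2.trans Fin.castSucc_lt_succ)) 1 (pd (nr j.2) f) β ≠ 0 := by
  by_contra hc
  push Not at hc
  apply h
  simp only [dOp, LinearMap.sum_apply, Finset.sum_apply, Module.End.mul_apply]
  exact Finset.sum_eq_zero fun j _ => hc j

theorem IsFormal.dOp {r : ℕ} {f : Series r} (hf : IsFormal f) (k : Fin r) :
    IsFormal (dOp k f) := by
  intro β h v hv
  obtain ⟨j, hj⟩ := dOp_ne_zero h
  exact (hf.pd _).xPow_one _ β hj v hv

theorem IsFormal.dOp_pow {r : ℕ} {f : Series r} (hf : IsFormal f) (k : Fin r) (p : ℕ) :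
    IsFormal ((SlVerma.dOp k ^ p) f) := by
  induction p with
  | zero => simpa using hf
  | succ p ih => rw [pow_succ', Module.End.mul_apply]; exact ih.dOp k

theorem IsFormal.etaPow {r : ℕ} {f : Series r} (hf : IsFormal f) (k : Fin r) (mu : ℂ) :
    IsFormal (etaPow k mu f) := by
  intro β h v hv
  obtain ⟨p, hp⟩ : ∃ p : ℕ, fallFact mu p / (p.factorial : ℂ) *
      xPow (simpleRoot k) (mu - p) ((SlVerma.dOp k ^ p) f) β ≠ 0 := by
    by_contra hc
    push Not at hc
    exact h (finsum_eq_zero_of_forall_eq_zero hc)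
  exact (hf.dOp_pow k p).xPow_simple k _ β (right_ne_zero_of_mul hp) v hv

/-- The total exponent of the variables `x_{k+1,j}`, `j < k`. -/
def rowExp {r : ℕ} (k : Fin r) (β : NegRoot r → ℂ) : ℂ :=
  ∑ j : {j : Fin (r + 1) // j < k.castSucc}, β (nr (j.2.trans Fin.castSucc_lt_succ))

theorem nr_ne_simple {r : ℕ} (k l : Fin r) {j : Fin (r + 1)} (h : j < k.castSucc) :
    nr (h.trans Fin.castSucc_lt_succ) ≠ simpleRoot l := by
  intro hc
  have h1 := congrArg (fun p : NegRoot r => p.1) hc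
  simp only [simpleRoot, nr, Prod.mk.injEq] at h1
  obtain ⟨h2, h3⟩ := h1
  have := Fin.succ_injective _ h2
  subst this
  exact absurd h (by simp [h3])

theorem rowExp_sub_simple {r : ℕ} (k : Fin r) (β : NegRoot r → ℂ) (c : ℂ) :
    rowExp k (β - Pi.single (simpleRoot k) c) = rowExp k β := by
  refine Finset.sum_congr rfl fun j _ => ?_
  rw [Pi.sub_apply, Pi.single_eq_of_ne (nr_ne_simple k k j.2), sub_zero]

theorem dOp_pow_rowExp {r : ℕ} {f : Series r} (hf : IsFormal f) (k : Fin r) (p : ℕ) :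
    ∀ β, (dOp k ^ p) f β ≠ 0 → ∃ m : ℕ, rowExp k β = p + m := by
  induction p with
  | zero =>
    intro β h
    have h' : ∀ j : {j : Fin (r + 1) // j < k.castSucc}, ∃ m : ℕ,
        β (nr (j.2.trans Fin.castSucc_lt_succ)) = m := fun j =>
      hf β (by simpa using h) _ fun l => nr_ne_simple k l j.2
    choose m hm using h'
    exact ⟨∑ j, m j, by simp [rowExp, hm]⟩
  | succ p ih =>
    intro β h
    rw [pow_succ', Module.End.mul_apply] at h
    obtain ⟨j, hj⟩ := dOp_ne_zero h
    obtain ⟨m, hm⟩ := ih _ (right_ne_zero_of_mul hj)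
    refine ⟨m, ?_⟩
    have key : rowExp k (β - Pi.single (nr (j.2.trans Fin.castSucc_lt_succ)) 1
        + Pi.single (nr j.2) 1) = rowExp k β - 1 := by
      have e1 : ∀ l : {j : Fin (r + 1) // j < k.castSucc},
          (β - Pi.single (nr (j.2.trans Fin.castSucc_lt_succ)) 1 + Pi.single (nr j.2) 1 :
            NegRoot r → ℂ) (nr (l.2.trans Fin.castSucc_lt_succ))
            = β (nr (l.2.trans Fin.castSucc_lt_succ)) - if l = j then 1 else 0 := by
        intro l
        have n1 : nr (l.2.trans (Fin.castSucc_lt_succ (i := k))) ≠ nr j.2 := by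
          intro hc
          have h1 := congrArg (fun p : NegRoot r => p.1.1) hc
          exact (Fin.castSucc_lt_succ (i := k)).ne' h1
        have n2 : (nr (l.2.trans (Fin.castSucc_lt_succ (i := k)))
            = nr (j.2.trans (Fin.castSucc_lt_succ (i := k)))) ↔ l = j := by
          constructor
          · intro hc
            exact Subtype.ext (congrArg (fun p : NegRoot r => p.1.2) hc)
          · rintro rfl; rfl
        simp only [Pi.add_apply, Pi.sub_apply, Pi.single_apply, n1, n2, if_false, add_zero]
      simp only [rowExp, e1, Finset.sum_sub_distrib, Finset.sum_ite_eq', Finset.mem_univ, if_true]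
    have h3 : rowExp k β - 1 = p + m := key ▸ hm
    push_cast
    rw [sub_eq_iff_eq_add.mp h3]; ring

/-- Only finitely many terms contribute to a coefficient of `η_k^μ f`. -/
theorem etaPow_finite {r : ℕ} {f : Series r} (hf : IsFormal f) (k : Fin r) (mu : ℂ)
    (β : NegRoot r → ℂ) :
    (Function.support fun p : ℕ => fallFact mu p / (p.factorial : ℂ) *
      xPow (simpleRoot k) (mu - p) ((dOp k ^ p) f) β).Finite := by
  by_cases hN : ∃ N : ℕ, rowExp k β = N
  · obtain ⟨N, hN⟩ := hN
    refine (Set.finite_Iic N).subset fun p hp => ?_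
    obtain ⟨m, hm⟩ := dOp_pow_rowExp hf k p _ (right_ne_zero_of_mul hp)
    rw [rowExp_sub_simple, hN] at hm
    have : N = p + m := by exact_mod_cast hm
    simp only [Set.mem_Iic]; omega
  · convert Set.finite_empty
    ext p
    simp only [Function.mem_support, Set.mem_empty_iff_false, iff_false, not_not]
    by_contra hp
    obtain ⟨m, hm⟩ := dOp_pow_rowExp hf k p _ (right_ne_zero_of_mul hp)
    refine hN ⟨p + m, ?_⟩
    rw [← rowExp_sub_simple k β (mu - p), hm]; push_cast; ring

theorem isFormal_toSeries {r : ℕ} (g : Poly r) : IsFormal (toSeries g) := by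
  intro β h v _
  obtain ⟨m, _, hm⟩ := Finset.exists_ne_zero_of_sum_ne_zero h
  by_cases hb : β = fun v => (m v : ℂ)
  · exact ⟨m v, by rw [hb]⟩
  · simp [hb] at hm

theorem IsFormal.block {r : ℕ} {f : Series r} (hf : IsFormal f) (p : ℕ) (nu : ℕ → ℂ) (i : ℕ) :
    IsFormal (block p nu i f) := by
  unfold SlVerma.block
  split_ifs
  · exact hf
  · generalize List.filter _ _ = l
    induction l generalizing f with
    | nil => exact hf
    | cons k l ih => exact ih (hf.etaPow k _)

theorem isFormal_theta {r : ℕ} (lam : Fin r → ℂ) (i : Idx r) : IsFormal (theta lam i) := by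
  have key : ∀ (p : ℕ) (nu : ℕ → ℂ) (f : Series r), IsFormal f → IsFormal (thetaAux i p nu f) := by
    intro p
    induction p with
    | zero => exact fun _ _ hf => hf
    | succ p ih => exact fun nu f hf => ih _ _ (hf.block _ _ _)
  exact key _ _ _ (isFormal_toSeries 1)

end SlVerma

end

open SlVerma

/-! The Lie algebra `gl(n)` acts on all formal series by differential operators. This action is
built one column at a time by parabolic induction, and since it uses only the Weyl algebra relations
it makes sense for complex exponents (`lie_gl`). The constant `1` is a highest weight vector, so the
Verma module maps to the series, and under this map `E^α v_λ` goes to `x^α` (`act_pbw`). This gives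
injectivity of `τ⁻¹`; surjectivity is the spanning half of the PBW theorem (`tauInv_surjective`).
Singular vectors thus become polynomial singular series, and three facts about these prove the
corollary.

Existence. Write weights as `m_a + a` with `a = 0, …, r`, so that `m` is the weight shifted by `ρ`.
If `f` is singular with shifted weight `m` and `μ = m_k - m_{k+1}`, then `η_k^μ f` is singular and
its shifted weight is `m` with these two entries exchanged (`IsSingSeries.etaPow`). This is the
`sl(2)` computation behind `e f^{λ+1} v = 0`, carried out for a complex power by a telescoping sum.
The exponents in `θ_i` are exactly such differences, and the blocks run once through coset
representatives of the symmetric group, so every permutation of the shifted highest weight occurs,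
for exactly one index vector (`exists_finalPerm`, `finalPerm_injective`).

Uniqueness. Two singular series of the same weight are proportional if one of them has a nonzero
coefficient at a monomial in the simple variables (`IsSingSeries.eq_smul`). Each `θ_i` has one,
because `η_k^μ` only shifts these coefficients (`etaPow_pure`).

Linkage. The traces of the powers of the matrix of generators are central, and their values on a
singular vector determine the multiset of the `m_a` (`multiset_eq_of_sum_diagVal`). The shifted
weight of a singular vector is therefore a permutation of that of `v_λ`.

So each singular vector is a multiple of some `θ_i`, which must then be a polynomial. There are `n!`
index vectors. If `λ` is dominant integral, all exponents are natural numbers, all `θ_i` are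
polynomials, and their weights are distinct because the shifted weight is regular. Conversely, `n!`
lines require all `θ_i` to be polynomials spanning distinct lines; among them is
`x_{k+1,k}^{λ_k+1}`, which forces `λ_k + 1` to be a positive integer. -/

noncomputable section

namespace SlVerma

attribute [local instance 100] LieRing.ofAssociativeRing

/-! ### Parabolic induction of a `gl`-action along an abelian nilradical -/

section Ring

variable {A : Type*} [Ring A]

theorem ring_lie_mul (a b c : A) : ⁅a, b * c⁆ = ⁅a, b⁆ * c + b * ⁅a, c⁆ := by
  simp only [Ring.lie_def]; noncomm_ring

theorem ring_mul_lie (a b c : A) : ⁅a * b, c⁆ = a * ⁅b, c⁆ + ⁅a, c⁆ * b := by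
  simp only [Ring.lie_def]; noncomm_ring

theorem lie_eq_zero_symm {a b : A} (h : ⁅a, b⁆ = 0) : ⁅b, a⁆ = 0 := by
  rw [← lie_skew, h, neg_zero]

/-- The relations of the matrix units with indices satisfying `J`. -/
def GlRel {ι : Type*} [DecidableEq ι] (J : ι → Prop) (g : ι → ι → A) : Prop :=
  ∀ i j k l, J i → J j → J k → J l →
    ⁅g i j, g k l⁆ = (if j = k then g i l else 0) - (if l = i then g k j else 0)

end Ring

/-- Weyl algebra generators `x i`, `d i` for the indices `i` with `J i`, commuting with the matrix
units `g i j`, and a central element `z`; the index `c` is to be adjoined to `J`. -/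
structure InductionDatum (A ι : Type*) [Ring A] [Fintype ι] [DecidableEq ι] where
  J : ι → Prop
  [decJ : DecidablePred J]
  c : ι
  x : ι → A
  d : ι → A
  g : ι → ι → A
  z : A
  not_J : ¬ J c
  x_eq_zero : ∀ i, ¬ J i → x i = 0
  d_eq_zero : ∀ i, ¬ J i → d i = 0
  lie_x_x : ∀ i j, ⁅x i, x j⁆ = 0
  lie_d_d : ∀ i j, ⁅d i, d j⁆ = 0
  lie_d_x : ∀ i j, ⁅d i, x j⁆ = if i = j ∧ J i then 1 else 0
  glRel : GlRel J g
  lie_g_x : ∀ i j k, J i → J j → ⁅g i j, x k⁆ = 0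
  lie_g_d : ∀ i j k, J i → J j → ⁅g i j, d k⁆ = 0
  lie_z_x : ∀ i, ⁅z, x i⁆ = 0
  lie_z_d : ∀ i, ⁅z, d i⁆ = 0
  lie_z_g : ∀ i j, J i → J j → ⁅z, g i j⁆ = 0

namespace InductionDatum

variable {A ι : Type*} [Ring A] [Fintype ι] [DecidableEq ι] (P : InductionDatum A ι)

/-- The Euler operator. -/
def N : A := ∑ k, P.x k * P.d k

/-- The matrix `g` applied to the vector `d`. -/
def S (j : ι) : A := ∑ k, P.g k j * P.d k

/-- The action of the matrix units with indices `c` or in `J`. -/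
def ext (i j : ι) : A :=
  if i = P.c then
    if j = P.c then P.z - P.N else P.z * P.d j - P.S j - P.N * P.d j
  else if j = P.c then P.x i else P.g i j + P.x i * P.d j

theorem lie_N_x (j : ι) : ⁅P.N, P.x j⁆ = P.x j := by
  have : ∀ k, ⁅P.x k * P.d k, P.x j⁆ = if k = j then P.x j else 0 := by
    intro k
    rw [ring_mul_lie, P.lie_d_x, P.lie_x_x, zero_mul, add_zero]
    by_cases h : k = j
    · subst h
      by_cases hJ : P.J k
      · simp [hJ]
      · simp [hJ, P.x_eq_zero k hJ]
    · simp [h]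
  rw [N, sum_lie]
  simp [this]

theorem lie_N_d (j : ι) : ⁅P.N, P.d j⁆ = - P.d j := by
  have : ∀ k, ⁅P.x k * P.d k, P.d j⁆ = if k = j then - P.d j else 0 := by
    intro k
    rw [ring_mul_lie, P.lie_d_d, ← lie_skew, P.lie_d_x, mul_zero, zero_add]
    by_cases h : k = j
    · subst h
      by_cases hJ : P.J k
      · simp [hJ]
      · simp [hJ, P.d_eq_zero k hJ]
    · simp [h, Ne.symm h]
  rw [N, sum_lie]
  simp [this]

theorem lie_g_N {i j : ι} (hi : P.J i) (hj : P.J j) : ⁅P.g i j, P.N⁆ = 0 := by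
  rw [N, lie_sum]
  exact Finset.sum_eq_zero fun k _ => by
    rw [ring_lie_mul, P.lie_g_x i j k hi hj, P.lie_g_d i j k hi hj, zero_mul, mul_zero, add_zero]

theorem lie_z_N : ⁅P.z, P.N⁆ = 0 := by
  rw [N, lie_sum]
  exact Finset.sum_eq_zero fun k _ => by
    rw [ring_lie_mul, P.lie_z_x, P.lie_z_d, zero_mul, mul_zero, add_zero]

theorem lie_z_S {j : ι} (hj : P.J j) : ⁅P.z, P.S j⁆ = 0 := by
  rw [S, lie_sum]
  refine Finset.sum_eq_zero fun k _ => ?_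
  by_cases hk : P.J k
  · rw [ring_lie_mul, P.lie_z_g k j hk hj, P.lie_z_d, zero_mul, mul_zero, add_zero]
  · rw [P.d_eq_zero k hk, mul_zero, lie_zero]

theorem lie_g_S {i l j : ι} (hi : P.J i) (hl : P.J l) (hj : P.J j) :
    ⁅P.g i l, P.S j⁆ = P.g i j * P.d l - if j = i then P.S l else 0 := by
  have : ∀ k, ⁅P.g i l, P.g k j * P.d k⁆
      = (if l = k then P.g i j * P.d k else 0) - if j = i then P.g k l * P.d k else 0 := by
    intro k
    by_cases hk : P.J k
    · rw [ring_lie_mul, P.lie_g_d i l k hi hl, P.glRel i l k j hi hl hk hj, mul_zero, add_zero,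
        sub_mul]
      split_ifs <;> first | contradiction | simp
    · simp [P.d_eq_zero k hk]
  rw [S, lie_sum, Finset.sum_congr rfl fun k _ => this k, Finset.sum_sub_distrib,
    Finset.sum_ite_eq, if_pos (Finset.mem_univ _)]
  split_ifs <;> simp [S]

theorem lie_x_S {i j : ι} (hi : P.J i) (hj : P.J j) : ⁅P.x i, P.S j⁆ = - P.g i j := by
  have : ∀ k, ⁅P.x i, P.g k j * P.d k⁆ = if k = i then - P.g i j else 0 := by
    intro k
    by_cases hk : P.J k
    · rw [ring_lie_mul, lie_eq_zero_symm (P.lie_g_x k j i hk hj), ← lie_skew, P.lie_d_x, zero_mul,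
        zero_add]
      by_cases h : k = i
      · subst h; simp [hk]
      · simp [h]
    · have : k ≠ i := by rintro rfl; exact hk hi
      simp [P.d_eq_zero k hk, this]
  rw [S, lie_sum]
  simp [this]

theorem lie_d_S (i : ι) {j : ι} (hj : P.J j) : ⁅P.d i, P.S j⁆ = 0 := by
  rw [S, lie_sum]
  refine Finset.sum_eq_zero fun k _ => ?_
  by_cases hk : P.J k
  · rw [ring_lie_mul, lie_eq_zero_symm (P.lie_g_d k j i hk hj), P.lie_d_d, zero_mul, mul_zero,
      add_zero]
  · rw [P.d_eq_zero k hk, mul_zero, lie_zero]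

theorem lie_N_S {j : ι} (hj : P.J j) : ⁅P.N, P.S j⁆ = - P.S j := by
  rw [S, lie_sum, ← Finset.sum_neg_distrib]
  refine Finset.sum_congr rfl fun k _ => ?_
  by_cases hk : P.J k
  · rw [ring_lie_mul, lie_eq_zero_symm (P.lie_g_N hk hj), P.lie_N_d, zero_mul, zero_add, mul_neg]
  · simp [P.d_eq_zero k hk]

theorem d_mul_d (i j : ι) : P.d i * P.d j = P.d j * P.d i :=
  sub_eq_zero.mp ((Ring.lie_def _ _).symm.trans (P.lie_d_d i j))

theorem lie_S_S {j l : ι} (hj : P.J j) (hl : P.J l) :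
    ⁅P.S j, P.S l⁆ = P.S l * P.d j - P.S j * P.d l := by
  have : ∀ k, ⁅P.g k j * P.d k, P.S l⁆
      = P.g k l * P.d k * P.d j - if l = k then P.S j * P.d k else 0 := by
    intro k
    by_cases hk : P.J k
    · rw [ring_mul_lie, P.lie_d_S k hl, P.lie_g_S hk hj hl, mul_zero, zero_add, sub_mul, mul_assoc,
        mul_assoc, P.d_mul_d j k]
      split_ifs <;> first | contradiction | simp
    · simp [P.d_eq_zero k hk]
  conv_lhs => rw [S, sum_lie]
  rw [Finset.sum_congr rfl fun k _ => this k, Finset.sum_sub_distrib,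
    Finset.sum_ite_eq, if_pos (Finset.mem_univ _), ← Finset.sum_mul]
  rfl

/-- The positive root vector `(c, j)`. -/
theorem ext_c_j {j : ι} (hj : P.J j) :
    P.ext P.c j = P.z * P.d j - P.S j - P.N * P.d j := by
  have : j ≠ P.c := by rintro rfl; exact P.not_J hj
  simp [ext, this]

theorem ext_c_c : P.ext P.c P.c = P.z - P.N := by simp [ext]

theorem ext_i_c {i : ι} (hi : P.J i) : P.ext i P.c = P.x i := by
  have : i ≠ P.c := by rintro rfl; exact P.not_J hi
  simp [ext, this]

theorem ext_i_j {i j : ι} (hi : P.J i) (hj : P.J j) :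
    P.ext i j = P.g i j + P.x i * P.d j := by
  have h1 : i ≠ P.c := by rintro rfl; exact P.not_J hi
  have h2 : j ≠ P.c := by rintro rfl; exact P.not_J hj
  simp [ext, h1, h2]

theorem lie_cc_ic {k : ι} : ⁅P.z - P.N, P.x k⁆ = - P.x k := by
  rw [sub_lie, P.lie_z_x, P.lie_N_x, zero_sub]

theorem lie_cc_cj {l : ι} (hl : P.J l) :
    ⁅P.z - P.N, P.z * P.d l - P.S l - P.N * P.d l⁆ = P.z * P.d l - P.S l - P.N * P.d l := by
  simp only [sub_lie, lie_sub, ring_lie_mul, P.lie_z_d, P.lie_z_S hl, P.lie_z_N, P.lie_N_d,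
    P.lie_N_S hl, lie_self, lie_eq_zero_symm P.lie_z_N]
  noncomm_ring

theorem lie_cc_ij {k l : ι} (hk : P.J k) (hl : P.J l) :
    ⁅P.z - P.N, P.g k l + P.x k * P.d l⁆ = 0 := by
  simp only [sub_lie, lie_add, ring_lie_mul, P.lie_z_d, P.lie_z_x, P.lie_z_g k l hk hl, P.lie_N_d,
    P.lie_N_x, lie_eq_zero_symm (P.lie_g_N hk hl)]
  noncomm_ring

theorem lie_cj_ic {k l : ι} (hk : P.J k) (hl : P.J l) :
    ⁅P.z * P.d l - P.S l - P.N * P.d l, P.x k⁆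
      = (if l = k then P.z - P.N else 0) - (P.g k l + P.x k * P.d l) := by
  have h := P.lie_x_S hk hl
  rw [← lie_skew, neg_inj] at h
  simp only [sub_lie, ring_mul_lie, P.lie_d_x, P.lie_z_x, P.lie_N_x, h, hl, and_true]
  split_ifs <;> noncomm_ring

theorem lie_cj_cj {j l : ι} (hj : P.J j) (hl : P.J l) :
    ⁅P.z * P.d j - P.S j - P.N * P.d j, P.z * P.d l - P.S l - P.N * P.d l⁆ = 0 := by
  have h1 : ⁅P.S j, P.N⁆ = P.S j := by rw [← lie_skew, P.lie_N_S hj, neg_neg]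
  have h2 : ⁅P.d j, P.N⁆ = P.d j := by rw [← lie_skew, P.lie_N_d, neg_neg]
  simp only [sub_lie, lie_sub, ring_mul_lie, ring_lie_mul, P.lie_d_d, P.lie_z_N, P.lie_z_d,
    P.lie_z_S hl, P.lie_S_S hj hl, P.lie_N_S hl, P.lie_d_S j hl,
    lie_eq_zero_symm (P.lie_d_S l hj), P.lie_N_d, h1, h2, lie_self,
    lie_eq_zero_symm P.lie_z_N, lie_eq_zero_symm (P.lie_z_d j),
    lie_eq_zero_symm (P.lie_z_S hj)]
  have h3 := P.d_mul_d j l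
  noncomm_ring
  rw [h3]
  abel

theorem lie_cj_kl {j k l : ι} (hj : P.J j) (hk : P.J k) (hl : P.J l) :
    ⁅P.z * P.d j - P.S j - P.N * P.d j, P.g k l + P.x k * P.d l⁆
      = if j = k then P.z * P.d l - P.S l - P.N * P.d l else 0 := by
  have h1 := P.lie_g_S hk hl hj
  rw [← lie_skew, neg_eq_iff_eq_neg] at h1
  have h2 := P.lie_x_S hk hj
  rw [← lie_skew, neg_inj] at h2
  simp only [sub_lie, lie_add, ring_mul_lie, ring_lie_mul, P.lie_d_d, P.lie_z_d, P.lie_z_x,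
    P.lie_z_g k l hk hl, lie_eq_zero_symm (P.lie_g_d k l j hk hl), h1, h2, P.lie_d_x,
    lie_eq_zero_symm (P.lie_d_S l hj), P.lie_N_d, P.lie_N_x,
    lie_eq_zero_symm (P.lie_g_N hk hl), hj, and_true]
  have h3 := P.d_mul_d j l
  split_ifs with h <;> noncomm_ring <;> rw [h3] <;> abel

theorem lie_ij_kl {i j k l : ι} (hi : P.J i) (hj : P.J j) (hk : P.J k) (hl : P.J l) :
    ⁅P.g i j + P.x i * P.d j, P.g k l + P.x k * P.d l⁆
      = (if j = k then P.g i l + P.x i * P.d l else 0)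
        - if l = i then P.g k j + P.x k * P.d j else 0 := by
  have h := P.lie_d_x l i
  rw [← lie_skew, neg_eq_iff_eq_neg] at h
  simp only [lie_add, add_lie, ring_mul_lie, ring_lie_mul, P.lie_d_d, P.lie_x_x,
    P.glRel i j k l hi hj hk hl, P.lie_d_x, P.lie_g_x i j k hi hj, P.lie_g_d i j l hi hj,
    lie_eq_zero_symm (P.lie_g_x k l i hk hl), lie_eq_zero_symm (P.lie_g_d k l j hk hl), h, hj, hl,
    and_true]
  split_ifs <;> noncomm_ring

/-- The formulas of `ext` describe the module induced from `gl(1) × gl(J)` along the abelian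
nilradical spanned by the `E_{i,c}`. The relations follow from the Weyl relations alone, so nothing
is assumed about the exponents. `skew` passes to the bracket with its arguments exchanged. -/
theorem glRel_ext : GlRel (fun i => i = P.c ∨ P.J i) P.ext := by
  have ne : ∀ {i}, P.J i → i ≠ P.c := by rintro i hi rfl; exact P.not_J hi
  have ne' : ∀ {i}, P.J i → P.c ≠ i := by rintro i hi rfl; exact P.not_J hi
  have skew : ∀ i j k l, ⁅P.ext k l, P.ext i j⁆
        = (if l = i then P.ext k j else 0) - (if j = k then P.ext i l else 0) →
      ⁅P.ext i j, P.ext k l⁆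
        = (if j = k then P.ext i l else 0) - (if l = i then P.ext k j else 0) := by
    intro i j k l h
    rw [← lie_skew, h, neg_sub]
  rintro i j k l (rfl | hi) (rfl | hj) (rfl | hk) (rfl | hl)
  · simp
  · simp [ext_c_c, P.ext_c_j hl, P.lie_cc_cj hl, ne hl]
  · simp [ext_c_c, P.ext_i_c hk, P.lie_cc_ic, ne' hk]
  · simp [ext_c_c, P.ext_i_j hk hl, P.lie_cc_ij hk hl, ne hl, ne' hk]
  · apply skew
    simp [ext_c_c, P.ext_c_j hj, P.lie_cc_cj hj, ne hj]
  · simp [P.ext_c_j hj, P.ext_c_j hl, P.lie_cj_cj hj hl, ne hj, ne hl]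
  · simp [P.ext_c_j hj, P.ext_i_c hk, P.lie_cj_ic hk hj, ext_c_c, P.ext_i_j hk hj]
  · simp [P.ext_c_j hj, P.ext_c_j hl, P.ext_i_j hk hl, P.lie_cj_kl hj hk hl, ne hl]
  · apply skew
    simp [ext_c_c, P.ext_i_c hi, P.lie_cc_ic, ne' hi]
  · apply skew
    simp [P.ext_c_j hl, P.ext_i_c hi, P.lie_cj_ic hi hl, ext_c_c, P.ext_i_j hi hl]
  · simp [P.ext_i_c hi, P.ext_i_c hk, P.lie_x_x, ne' hi, ne' hk]
  · apply skew
    have h1 := P.lie_d_x l i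
    simp only [P.ext_i_c hi, P.ext_i_j hk hl, add_lie, ring_mul_lie, P.lie_g_x k l i hk hl,
      P.lie_x_x, h1, hl, and_true, ne' hk, P.ext_i_c hk]
    split_ifs <;> first | contradiction | simp
  · apply skew
    simp [P.ext_i_j hi hj, ext_c_c, P.lie_cc_ij hi hj, ne hj, ne' hi]
  · apply skew
    simp [P.ext_i_j hi hj, P.ext_c_j hl, P.ext_c_j hj, P.lie_cj_kl hl hi hj, ne hj]
  · have h1 := P.lie_d_x j k
    simp only [P.ext_i_c hk, P.ext_i_j hi hj, add_lie, ring_mul_lie, P.lie_g_x i j k hi hj,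
      P.lie_x_x, h1, hj, and_true, ne' hi, P.ext_i_c hi]
    split_ifs <;> first | contradiction | simp
  · simp only [P.ext_i_j hi hj, P.ext_i_j hk hl, P.ext_i_j hi hl, P.ext_i_j hk hj,
      P.lie_ij_kl hi hj hk hl]

end InductionDatum

/-! ### The Weyl algebra acting on formal series -/

section Weyl

variable {r : ℕ}

theorem xPow_apply (v : NegRoot r) (c : ℂ) (f : Series r) (β : NegRoot r → ℂ) :
    xPow v c f β = f (β - Pi.single v c) := rfl

theorem pd_apply (v : NegRoot r) (f : Series r) (β : NegRoot r → ℂ) :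
    pd v f β = (β v + 1) * f (β + Pi.single v 1) := rfl

theorem xPow_mul_xPow (v : NegRoot r) (c d : ℂ) : xPow v c * xPow v d = xPow v (c + d) := by
  ext f β
  simp only [Module.End.mul_apply, xPow_apply, Pi.single_add, sub_sub]

theorem xPow_zero (v : NegRoot r) : xPow v 0 = 1 := by
  ext f β
  simp [xPow_apply]

theorem lie_xPow_xPow (v w : NegRoot r) (c d : ℂ) : ⁅xPow v c, xPow w d⁆ = 0 := by
  ext f β
  simp only [Ring.lie_def, LinearMap.sub_apply, Module.End.mul_apply, Pi.sub_apply, xPow_apply,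
    LinearMap.zero_apply, Pi.zero_apply, sub_right_comm β, sub_self]

theorem lie_pd_pd (v w : NegRoot r) : ⁅pd v, pd w⁆ = 0 := by
  rcases eq_or_ne v w with rfl | h
  · exact lie_self _
  ext f β
  simp only [Ring.lie_def, LinearMap.sub_apply, Module.End.mul_apply, Pi.sub_apply, pd_apply,
    LinearMap.zero_apply, Pi.zero_apply, Pi.add_apply, Pi.single_apply, h, h.symm, if_false,
    add_zero, add_right_comm _ (Pi.single v 1)]
  ring

theorem lie_pd_xPow (v w : NegRoot r) (c : ℂ) :
    ⁅pd v, xPow w c⁆ = if v = w then c • xPow w (c - 1) else 0 := by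
  ext f β
  split_ifs with h
  · subst h
    have : β - Pi.single v (c - 1) = β - Pi.single v c + Pi.single v 1 := by
      rw [Pi.single_sub]; abel
    simp only [Ring.lie_def, LinearMap.sub_apply, Module.End.mul_apply, Pi.sub_apply, pd_apply,
      xPow_apply, LinearMap.smul_apply, Pi.smul_apply, Pi.single_eq_same, smul_eq_mul, this,
      add_sub_right_comm β]
    ring
  · simp only [Ring.lie_def, LinearMap.sub_apply, Module.End.mul_apply, Pi.sub_apply, pd_apply,
      xPow_apply, Pi.single_apply, h, if_false, sub_zero, LinearMap.zero_apply, Pi.zero_apply,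
      add_sub_right_comm β, sub_self]

/-- Multiplication by `x_{i,j}`, zero unless `j < i`. -/
def xOp (i j : Fin (r + 1)) : Module.End ℂ (Series r) := if h : j < i then xPow (nr h) 1 else 0

/-- The derivative `∂_{i,j}`, zero unless `j < i`. -/
def pdOp (i j : Fin (r + 1)) : Module.End ℂ (Series r) := if h : j < i then pd (nr h) else 0

theorem xOp_of_lt {i j : Fin (r + 1)} (h : j < i) : xOp i j = xPow (nr h) 1 := dif_pos h

theorem pdOp_of_lt {i j : Fin (r + 1)} (h : j < i) : pdOp i j = pd (nr h) := dif_pos h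

theorem xOp_of_le {i j : Fin (r + 1)} (h : i ≤ j) : xOp i j = 0 := dif_neg h.not_gt

theorem pdOp_of_le {i j : Fin (r + 1)} (h : i ≤ j) : pdOp i j = 0 := dif_neg h.not_gt

theorem lie_xOp_xPow (i j : Fin (r + 1)) (w : NegRoot r) (c : ℂ) : ⁅xOp i j, xPow w c⁆ = 0 := by
  rw [xOp]
  split_ifs
  · exact lie_xPow_xPow _ _ _ _
  · exact zero_lie _

theorem lie_xOp_xOp (i j k l : Fin (r + 1)) : ⁅xOp i j, xOp k l⁆ = 0 := by
  rw [xOp, xOp]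
  split_ifs <;> simp [lie_xPow_xPow]

theorem lie_pdOp_pdOp (i j k l : Fin (r + 1)) : ⁅pdOp i j, pdOp k l⁆ = 0 := by
  rw [pdOp, pdOp]
  split_ifs <;> simp [lie_pd_pd]

theorem nr_inj {i j k l : Fin (r + 1)} (h : j < i) (h' : l < k) :
    nr h = nr h' ↔ i = k ∧ j = l := by
  simp [nr]

theorem lie_pdOp_xPow (i j : Fin (r + 1)) (w : NegRoot r) (c : ℂ) :
    ⁅pdOp i j, xPow w c⁆ = if i = w.1.1 ∧ j = w.1.2 then c • xPow w (c - 1) else 0 := by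
  rw [pdOp]
  split_ifs with h h1 h1
  · rw [lie_pd_xPow, if_pos (by ext <;> simp [h1])]
  · rw [lie_pd_xPow, if_neg (by rintro rfl; simp at h1)]
  · exact absurd w.2 (h1.1 ▸ h1.2 ▸ h)
  · exact zero_lie _

theorem lie_pdOp_xOp (i j k l : Fin (r + 1)) :
    ⁅pdOp i j, xOp k l⁆ = if i = k ∧ j = l ∧ j < i then 1 else 0 := by
  rw [xOp]
  split_ifs with h h1 h1
  · rw [lie_pdOp_xPow, if_pos ⟨h1.1, h1.2.1⟩, sub_self, xPow_zero, one_smul]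
  · rw [lie_pdOp_xPow, if_neg]
    rintro ⟨rfl, rfl⟩
    exact h1 ⟨rfl, rfl, h⟩
  · obtain ⟨rfl, rfl, h2⟩ := h1
    exact absurd h2 h
  · exact lie_zero _

end Weyl

/-! ### The action of `gl(n)` -/

section Gl

variable {r : ℕ} (L : Fin (r + 1) → ℂ)

/-- The action of the matrix units whose indices are among the last `m` ones, on the series in the
variables with these indices, with highest weight `L`. -/
def glAux : ℕ → Fin (r + 1) → Fin (r + 1) → Module.End ℂ (Series r)
  | 0, _, _ => 0
  | m + 1, i, j =>
    let c : Fin (r + 1) := ⟨r - m, by omega⟩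
    if i = c then
      if j = c then algebraMap ℂ _ (L c) - ∑ k, xOp k c * pdOp k c
      else algebraMap ℂ _ (L c) * pdOp j c - ∑ k, glAux m k j * pdOp k c
        - (∑ k, xOp k c * pdOp k c) * pdOp j c
    else if j = c then xOp i c else glAux m i j + xOp i c * pdOp j c

theorem lie_algebraMap (c : ℂ) (T : Module.End ℂ (Series r)) :
    ⁅algebraMap ℂ (Module.End ℂ (Series r)) c, T⁆ = 0 := by
  rw [Ring.lie_def, Algebra.commutes, sub_self]

/-- Stage `m` is built from the variables and derivatives of the last `m` columns only. This makes
it commute with the column adjoined next, as `InductionDatum` requires. -/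
theorem lie_glAux (m : ℕ) (i j : Fin (r + 1)) (T : Module.End ℂ (Series r))
    (hx : ∀ k c : Fin (r + 1), r < c.val + m → ⁅T, xOp k c⁆ = 0)
    (hd : ∀ k c : Fin (r + 1), r < c.val + m → ⁅T, pdOp k c⁆ = 0) : ⁅T, glAux L m i j⁆ = 0 := by
  induction m generalizing i j with
  | zero => exact lie_zero _
  | succ m ih =>
    have ih' := fun i j => ih i j (fun k c h => hx k c (by omega)) (fun k c h => hd k c (by omega))
    have hc : r < (⟨r - m, by omega⟩ : Fin (r + 1)).val + (m + 1) := by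
      change r < r - m + (m + 1)
      omega
    have hx' := fun k => hx k _ hc
    have hd' := fun k => hd k _ hc
    have ha := fun c => lie_eq_zero_symm (lie_algebraMap c T)
    rw [glAux]
    split_ifs <;> simp [lie_sum, ring_lie_mul, ih', hx', hd', ha]

theorem glRel_glAux (m : ℕ) (hm : m ≤ r + 1) :
    GlRel (fun i : Fin (r + 1) => r < i.val + m) (glAux L m) := by
  induction m with
  | zero => exact fun i _ _ _ h => absurd h (by simpa using by omega)
  | succ m ih =>
    have hc : ∀ i : Fin (r + 1), i = ⟨r - m, by omega⟩ ↔ i.val + m = r := fun i => by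
      rw [Fin.ext_iff]; simp only; omega
    let P : InductionDatum (Module.End ℂ (Series r)) (Fin (r + 1)) :=
      { J := fun i => r < i.val + m
        c := ⟨r - m, by omega⟩
        x := fun i => xOp i ⟨r - m, by omega⟩
        d := fun i => pdOp i ⟨r - m, by omega⟩
        g := glAux L m
        z := algebraMap ℂ _ (L ⟨r - m, by omega⟩)
        not_J := by simp only; omega
        -- `x_{i,c}` and `∂_{i,c}` are zero by convention unless `c < i`, which for the new index `c
        -- = r - m` is exactly membership in `J`. Sums over all indices may therefore be used.
        x_eq_zero := fun i hi => xOp_of_le (by rw [Fin.le_def]; simp only; omega)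
        d_eq_zero := fun i hi => pdOp_of_le (by rw [Fin.le_def]; simp only; omega)
        lie_x_x := fun _ _ => lie_xOp_xOp _ _ _ _
        lie_d_d := fun _ _ => lie_pdOp_pdOp _ _ _ _
        lie_d_x := fun i j => by
          rw [lie_pdOp_xOp]
          congr 1
          simp only [Fin.lt_def, true_and, eq_iff_iff]
          refine and_congr_right fun _ => ?_
          omega
        glRel := ih (by omega)
        lie_g_x := fun i j k _ _ => lie_eq_zero_symm <| lie_glAux L m i j _
          (fun _ _ _ => lie_xOp_xOp _ _ _ _) (fun l c h => lie_eq_zero_symm <| by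
            rw [lie_pdOp_xOp, if_neg]
            rintro ⟨-, rfl, -⟩
            simp only at h
            omega)
        lie_g_d := fun i j k _ _ => lie_eq_zero_symm <| lie_glAux L m i j _
          (fun l c h => by
            rw [lie_pdOp_xOp, if_neg]
            rintro ⟨-, rfl, -⟩
            simp only at h
            omega) (fun _ _ _ => lie_pdOp_pdOp _ _ _ _)
        lie_z_x := fun _ => lie_algebraMap _ _
        lie_z_d := fun _ => lie_algebraMap _ _
        lie_z_g := fun _ _ _ _ => lie_algebraMap _ _ }
    have h := P.glRel_ext
    have e : P.ext = glAux L (m + 1) := by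
      funext i j
      rw [glAux]
      rfl
    rw [e] at h
    intro i j k l hi hj hk hl
    refine h i j k l ?_ ?_ ?_ ?_ <;> simp only [P, hc] <;> omega

/-- The action of the matrix units on formal series, with highest weight `L`. -/
def gl (i j : Fin (r + 1)) : Module.End ℂ (Series r) := glAux L (r + 1) i j

theorem lie_gl (i j k l : Fin (r + 1)) :
    ⁅gl L i j, gl L k l⁆ = (if j = k then gl L i l else 0) - (if l = i then gl L k j else 0) :=
  glRel_glAux L (r + 1) le_rfl i j k l (by simp only; omega) (by simp only; omega)
    (by simp only; omega) (by simp only; omega)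

/-- Adjoining a smaller index `c` changes an operator already present only by the summand `x_{i,c}
∂_{j,c}`. -/
theorem glAux_eq_add_sum (m n : ℕ) (hmn : m ≤ n) (hn : n ≤ r + 1) (i j : Fin (r + 1))
    (hi : r < i.val + m) (hj : r < j.val + m) :
    glAux L n i j = glAux L m i j +
      ∑ c : Fin (r + 1) with c.val + m ≤ r ∧ r < c.val + n, xOp i c * pdOp j c := by
  induction n, hmn using Nat.le_induction with
  | base =>
    rw [Finset.filter_false_of_mem (fun c _ => by omega), Finset.sum_empty, add_zero]
  | succ n hmn ih =>
    have h1 : i ≠ ⟨r - n, by omega⟩ := by rw [Ne, Fin.ext_iff]; simp only; omega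
    have h2 : j ≠ ⟨r - n, by omega⟩ := by rw [Ne, Fin.ext_iff]; simp only; omega
    have h3 : (Finset.univ.filter fun c : Fin (r + 1) => c.val + m ≤ r ∧ r < c.val + (n + 1))
        = insert ⟨r - n, by omega⟩
          (Finset.univ.filter fun c : Fin (r + 1) => c.val + m ≤ r ∧ r < c.val + n) := by
      ext c
      simp only [Finset.mem_filter, Finset.mem_univ, true_and, Finset.mem_insert, Fin.ext_iff]
      omega
    rw [glAux]
    simp only [h1, h2, if_false]
    rw [ih (by omega), h3, Finset.sum_insert, add_assoc, add_comm (Finset.sum _ _)]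
    simp only [Finset.mem_filter, not_and]
    intro _ _
    omega

/-- For `c = min(i, j)` the stage on the right is the one that adjoins `c`, so a single unfolding of
`glAux` yields the explicit formulas below. -/
theorem gl_eq (c i j : Fin (r + 1)) (hi : c ≤ i) (hj : c ≤ j) :
    gl L i j = glAux L (r - c.val + 1) i j + ∑ k with k < c, xOp i k * pdOp j k := by
  rw [gl, glAux_eq_add_sum L (r - c.val + 1) (r + 1) (by omega) le_rfl i j (by omega) (by omega)]
  congr 2
  ext k
  simp only [Finset.mem_filter, Finset.mem_univ, true_and]
  omega

theorem sum_xOp_mul (T : Fin (r + 1) → Module.End ℂ (Series r)) (c i : Fin (r + 1)) (h : i ≤ c) :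
    ∑ k with k < c, xOp i k * T k = ∑ k, xOp i k * T k := by
  refine Finset.sum_subset (Finset.subset_univ _) fun k _ hk => ?_
  rw [xOp_of_le, zero_mul]
  simp only [Finset.mem_filter, Finset.mem_univ, true_and] at hk
  omega

theorem sum_mul_pdOp (T : Fin (r + 1) → Module.End ℂ (Series r)) (c i : Fin (r + 1)) (h : i ≤ c) :
    ∑ k with k < c, T k * pdOp i k = ∑ k, T k * pdOp i k := by
  refine Finset.sum_subset (Finset.subset_univ _) fun k _ hk => ?_
  rw [pdOp_of_le, mul_zero]
  simp only [Finset.mem_filter, Finset.mem_univ, true_and] at hk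
  omega

theorem gl_lower {i j : Fin (r + 1)} (h : j < i) :
    gl L i j = xOp i j + ∑ k, xOp i k * pdOp j k := by
  have hj : (⟨r - (r - j.val), by omega⟩ : Fin (r + 1)) = j := by ext; simp only; omega
  rw [gl_eq L j i j h.le le_rfl, sum_mul_pdOp _ _ _ le_rfl, glAux]
  simp [hj, h.ne']

theorem gl_diag (i : Fin (r + 1)) :
    gl L i i = algebraMap ℂ _ (L i) - ∑ k, xOp k i * pdOp k i + ∑ k, xOp i k * pdOp i k := by
  have hi : (⟨r - (r - i.val), by omega⟩ : Fin (r + 1)) = i := by ext; simp only; omega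
  rw [gl_eq L i i i le_rfl le_rfl, sum_mul_pdOp _ _ _ le_rfl, glAux]
  simp [hi]

theorem gl_simple {i j : Fin (r + 1)} (h : j.val = i.val + 1) :
    gl L i j = algebraMap ℂ _ (L i - L j) * pdOp j i - (∑ k, xOp k i * pdOp k i) * pdOp j i
      + (∑ k, xOp k j * pdOp k j) * pdOp j i - ∑ k, xOp k j * pdOp k i
      + ∑ k, xOp i k * pdOp j k := by
  have hi : (⟨r - (r - i.val), by omega⟩ : Fin (r + 1)) = i := by ext; simp only; omega
  have hj : (⟨r - (r - i.val - 1), by omega⟩ : Fin (r + 1)) = j := by ext; simp only; omega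
  have hij : i < j := by omega
  -- In this stage `j = i + 1` is the smallest index, so its column consists of the variables
  -- `x_{k,j}` below the diagonal entry. For `k < j` the derivative `∂_{k,i}` is zero.
  have key : ∀ k, glAux L (r - i.val) k j * pdOp k i =
      (if k = j then (algebraMap ℂ _ (L j) - ∑ l, xOp l j * pdOp l j) * pdOp j i else 0)
        + xOp k j * pdOp k i := by
    intro k
    rcases lt_trichotomy k j with hk | rfl | hk
    · rw [pdOp_of_le (by omega : k ≤ i), if_neg hk.ne, mul_zero, mul_zero, add_zero]
    · have e : r - i.val = (r - i.val - 1) + 1 := by omega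
      rw [if_pos rfl, xOp_of_le le_rfl, zero_mul, add_zero, e, glAux]
      simp [hj]
    · have e : r - i.val = (r - i.val - 1) + 1 := by omega
      rw [if_neg hk.ne', zero_add, e, glAux]
      simp [hj, hk.ne']
  rw [gl_eq L i i j le_rfl hij.le, sum_xOp_mul _ _ _ le_rfl, glAux]
  simp only [hi, if_true, if_neg hij.ne', key, Finset.sum_add_distrib, Finset.sum_ite_eq',
    Finset.mem_univ, map_sub, sub_mul]
  abel

end Gl

/-! ### Polynomials as formal series -/

section ToSeries

variable {r : ℕ}

/-- The exponents of a monomial as complex numbers. -/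
def castExp (m : NegRoot r →₀ ℕ) : NegRoot r → ℂ := fun v => (m v : ℂ)

theorem castExp_injective : Function.Injective (castExp (r := r)) := fun m n h => by
  ext v
  exact Nat.cast_injective (congrFun h v)

theorem toSeries_castExp (g : Poly r) (m : NegRoot r →₀ ℕ) :
    toSeries g (castExp m) = g.coeff m := by
  have : ∀ n : NegRoot r →₀ ℕ, castExp m = (fun v => (n v : ℂ)) ↔ m = n := fun n =>
    ⟨fun h => castExp_injective h, fun h => by rw [h]; rfl⟩
  rw [toSeries]
  simp only [this]
  rw [Finset.sum_ite_eq]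
  simpa using Eq.symm

theorem toSeries_eq_zero (g : Poly r) {β : NegRoot r → ℂ} (h : ∀ m, β ≠ castExp m) :
    toSeries g β = 0 :=
  Finset.sum_eq_zero fun m _ => if_neg (h m)

theorem toSeries_ext {f : Series r} {g : Poly r} (h : ∀ m, f (castExp m) = g.coeff m)
    (h' : ∀ β, (∀ m, β ≠ castExp m) → f β = 0) : f = toSeries g := by
  funext β
  by_cases hb : ∃ m, β = castExp m
  · obtain ⟨m, rfl⟩ := hb
    rw [h, toSeries_castExp]
  · push Not at hb
    rw [h' β hb, toSeries_eq_zero g hb]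

theorem toSeries_injective : Function.Injective (toSeries (r := r)) := fun f g h => by
  ext m
  rw [← toSeries_castExp, h, toSeries_castExp]

theorem toSeries_add (f g : Poly r) : toSeries (f + g) = toSeries f + toSeries g :=
  (toSeries_ext (fun m => by simp [toSeries_castExp])
    fun β h => by simp [toSeries_eq_zero _ h]).symm

theorem toSeries_smul (c : ℂ) (g : Poly r) : toSeries (c • g) = c • toSeries g :=
  (toSeries_ext (fun m => by simp [toSeries_castExp])
    fun β h => by simp [toSeries_eq_zero _ h]).symm

theorem castExp_sub_single {m : NegRoot r →₀ ℕ} {v : NegRoot r} (h : m v ≠ 0) :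
    castExp m - Pi.single v 1 = castExp (m - Finsupp.single v 1) := by
  funext w
  rcases eq_or_ne v w with rfl | hw
  · simp [castExp, Nat.cast_sub (Nat.one_le_iff_ne_zero.mpr h)]
  · simp [castExp, hw.symm]

theorem castExp_add_single (m : NegRoot r →₀ ℕ) (v : NegRoot r) :
    castExp m + Pi.single v 1 = castExp (m + Finsupp.single v 1) := by
  funext w
  rcases eq_or_ne v w with rfl | hw
  · simp [castExp]
  · simp [castExp, hw.symm]

theorem xPow_toSeries (v : NegRoot r) (g : Poly r) :
    xPow v 1 (toSeries g) = toSeries (MvPolynomial.X v * g) := by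
  refine toSeries_ext (fun m => ?_) fun β h => ?_
  · rw [xPow_apply, MvPolynomial.coeff_X_mul']
    split_ifs with hm
    · rw [castExp_sub_single (Finsupp.mem_support_iff.mp hm), toSeries_castExp]
    · refine toSeries_eq_zero _ fun n hn => ?_
      have h1 := congrFun hn v
      simp only [castExp, Finsupp.notMem_support_iff.mp hm, Pi.sub_apply, Pi.single_eq_same] at h1
      have h2 : ((n v + 1 : ℕ) : ℂ) = 0 := by push_cast; rw [← h1]; simp
      exact absurd h2 (Nat.cast_ne_zero.mpr (Nat.succ_ne_zero _))
  · rw [xPow_apply]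
    refine toSeries_eq_zero _ fun n hn => h (n + Finsupp.single v 1) ?_
    rw [← castExp_add_single, ← hn, sub_add_cancel]

/-- The series of the constant polynomial `1`. -/
abbrev vac (r : ℕ) : Series r := toSeries 1

theorem pd_vac (v : NegRoot r) : pd v (vac r) = 0 := by
  funext β
  rw [pd_apply, Pi.zero_apply]
  by_cases h : ∃ m, β + Pi.single v 1 = castExp m
  · obtain ⟨m, hm⟩ := h
    rw [hm, vac, toSeries_castExp, MvPolynomial.coeff_one]
    split_ifs with h0
    -- Only the exponent `-1` of `x_v` could contribute, and there the factor `β v + 1` of the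
    -- derivative vanishes.
    · have h1 := congrFun hm v
      simp only [← h0, castExp, Pi.add_apply, Pi.single_eq_same, Finsupp.coe_zero, Pi.zero_apply,
        Nat.cast_zero] at h1
      rw [h1, zero_mul]
    · rw [mul_zero]
  · push Not at h
    rw [vac, toSeries_eq_zero _ h, mul_zero]

theorem pdOp_vac (i j : Fin (r + 1)) : pdOp i j (vac r) = 0 := by
  rw [pdOp]
  split_ifs
  · exact pd_vac _
  · rfl

end ToSeries

/-! ### The `U(sl(n))`-module of formal series -/

section Action

variable {r : ℕ} (L : Fin (r + 1) → ℂ)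

/-- The linear action of matrices on formal series. -/
def glLin : Matrix (Fin (r + 1)) (Fin (r + 1)) ℂ →ₗ[ℂ] Module.End ℂ (Series r) where
  toFun A := ∑ i, ∑ j, A i j • gl L i j
  map_add' A B := by simp [add_smul, Finset.sum_add_distrib]
  map_smul' c A := by simp [mul_smul, Finset.smul_sum]

theorem glLin_apply (A : Matrix (Fin (r + 1)) (Fin (r + 1)) ℂ) :
    glLin L A = ∑ i, ∑ j, A i j • gl L i j := rfl

theorem end_smul_lie (c : ℂ) (S T : Module.End ℂ (Series r)) : ⁅c • S, T⁆ = c • ⁅S, T⁆ := by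
  rw [Ring.lie_def, Ring.lie_def, smul_mul_assoc, mul_smul_comm, smul_sub]

theorem end_lie_smul (c : ℂ) (S T : Module.End ℂ (Series r)) : ⁅S, c • T⁆ = c • ⁅S, T⁆ := by
  rw [Ring.lie_def, Ring.lie_def, smul_mul_assoc, mul_smul_comm, smul_sub]

theorem lie_sum_gl (a b : Fin (r + 1) → Fin (r + 1) → ℂ) :
    ⁅∑ i, ∑ j, a i j • gl L i j, ∑ i, ∑ j, b i j • gl L i j⁆
      = ∑ i, ∑ l, (∑ j, a i j * b j l - ∑ j, b i j * a j l) • gl L i l := by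
  simp_rw [sum_lie, lie_sum, end_smul_lie, end_lie_smul, lie_gl, smul_sub, smul_smul, smul_ite,
    smul_zero]
  have h : ∀ i l, (∑ j, a i j * b j l - ∑ j, b i j * a j l) • gl L i l
      = ∑ j, (a i j * b j l) • gl L i l - ∑ j, (b i j * a j l) • gl L i l := fun i l => by
    refine (sub_smul (∑ j, a i j * b j l) (∑ j, b i j * a j l) (gl L i l)).trans ?_
    rw [Finset.sum_smul, Finset.sum_smul]
  simp_rw [h, Finset.sum_sub_distrib, Finset.sum_ite_eq', Finset.mem_univ, if_true]
  congr 1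
  · refine Finset.sum_congr rfl fun i _ => ?_
    rw [Finset.sum_comm]
    refine Eq.trans ?_ Finset.sum_comm
    simp
  · rw [Finset.sum_comm_cycle]
    refine Finset.sum_congr rfl fun i _ => ?_
    rw [Finset.sum_comm]
    refine Finset.sum_congr rfl fun j _ => ?_
    refine Finset.sum_congr rfl fun k _ => ?_
    rw [mul_comm]

theorem glLin_lie (A B : Matrix (Fin (r + 1)) (Fin (r + 1)) ℂ) :
    glLin L (A * B - B * A) = ⁅glLin L A, glLin L B⁆ := by
  refine Eq.trans ?_ (lie_sum_gl L (fun i j => A i j) fun i j => B i j).symm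
  rw [glLin_apply]
  refine Finset.sum_congr rfl fun i _ => Finset.sum_congr rfl fun l _ => ?_
  rw [Matrix.sub_apply, Matrix.mul_apply, Matrix.mul_apply]

theorem glLin_single (a b : Fin (r + 1)) : glLin L (Matrix.single a b 1) = gl L a b := by
  simp [glLin_apply, Matrix.single_apply, ite_and]

/-- The action of `sl(n)` on formal series. -/
def glHom : Sl r →ₗ⁅ℂ⁆ Module.End ℂ (Series r) where
  toFun A := glLin L A.val
  map_add' A B := map_add (glLin L) A.val B.val
  map_smul' c A := map_smul (glLin L) c A.val
  map_lie' {A B} := glLin_lie L A.val B.val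

theorem glHom_apply (A : Sl r) : glHom L A = glLin L A.val := rfl

theorem glHom_single {a b : Fin (r + 1)} (h : a ≠ b) :
    glHom L (LieAlgebra.SpecialLinear.single a b h (1 : ℂ)) = gl L a b := by
  rw [glHom_apply, LieAlgebra.SpecialLinear.val_single, glLin_single]

theorem glHom_singleSubSingle (a b : Fin (r + 1)) :
    glHom L (LieAlgebra.SpecialLinear.singleSubSingle a b (1 : ℂ)) = gl L a a - gl L b b := by
  rw [glHom_apply, LieAlgebra.SpecialLinear.val_singleSubSingle, map_sub, glLin_single,
    glLin_single]

/-- The action of `U(sl(n))` on formal series. -/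
def act : USl r →ₐ[ℂ] Module.End ℂ (Series r) := UniversalEnvelopingAlgebra.lift ℂ (glHom L)

theorem act_E {a b : Fin (r + 1)} (h : a ≠ b) : act L (E a b h) = gl L a b := by
  rw [act, E, UniversalEnvelopingAlgebra.lift_ι_apply, glHom_single]

theorem act_H (k : Fin r) : act L (H k) = gl L k.castSucc k.castSucc - gl L k.succ k.succ := by
  rw [act, H, UniversalEnvelopingAlgebra.lift_ι_apply, glHom_singleSubSingle]

theorem gl_diag_vac (i : Fin (r + 1)) : gl L i i (vac r) = L i • vac r := by
  rw [gl_diag]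
  simp [LinearMap.sum_apply, pdOp_vac]

/-- Commutators of the simple positive root vectors. -/
theorem gl_upper_apply_eq_zero {f : Series r}
    (hf : ∀ k : Fin r, gl L k.castSucc k.succ f = 0) {a b : Fin (r + 1)} (h : a < b) :
    gl L a b f = 0 := by
  obtain ⟨d, hd⟩ : ∃ d, b.val = a.val + 1 + d := ⟨b.val - a.val - 1, by omega⟩
  clear h
  induction d generalizing b with
  | zero =>
    have := hf ⟨a.val, by omega⟩
    have e : (Fin.succ ⟨a.val, by omega⟩ : Fin (r + 1)) = b := by ext; simp [hd]
    rwa [e] at this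
  | succ d ih =>
    have h1 := ih (b := ⟨a.val + 1 + d, by omega⟩) rfl
    have h2 := hf ⟨a.val + 1 + d, by omega⟩
    have e : (Fin.succ ⟨a.val + 1 + d, by omega⟩ : Fin (r + 1)) = b := by ext; simp [hd]; omega
    rw [e] at h2
    have h3 := lie_gl L a ⟨a.val + 1 + d, by omega⟩ ⟨a.val + 1 + d, by omega⟩ b
    rw [if_pos rfl, if_neg (by rw [Fin.ext_iff]; omega), sub_zero] at h3
    rw [← h3, Ring.lie_def, LinearMap.sub_apply, Module.End.mul_apply, Module.End.mul_apply, h1]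
    change gl L _ _ (gl L _ _ f) - _ = _
    rw [show gl L ⟨a.val + 1 + d, by omega⟩ b f = 0 from h2, map_zero, map_zero, sub_zero]

theorem gl_upper_vac {a b : Fin (r + 1)} (h : a < b) : gl L a b (vac r) = 0 := by
  refine gl_upper_apply_eq_zero L (fun k => ?_) h
  rw [gl_simple L (by simp)]
  simp [LinearMap.sum_apply, pdOp_vac]

/-- The formal series as a module over `U(sl(n))`. -/
def SeriesMod (_ : Fin (r + 1) → ℂ) : Type := Series r

instance : AddCommGroup (SeriesMod L) := inferInstanceAs (AddCommGroup (Series r))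

instance : Module (USl r) (SeriesMod L) := Module.compHom (Series r) (act L).toRingHom

/-- The `gl(n)`-weight, normalized by `L_n = 0`, with `L_k - L_{k+1} = λ_k`. -/
def glWt (lam : Fin r → ℂ) (a : Fin (r + 1)) : ℂ := ∑ q with a.val ≤ q.val, lam q

theorem glWt_sub (lam : Fin r → ℂ) (k : Fin r) :
    glWt lam k.castSucc - glWt lam k.succ = lam k := by
  have : (Finset.univ.filter fun q : Fin r => k.castSucc.val ≤ q.val)
      = insert k (Finset.univ.filter fun q : Fin r => k.succ.val ≤ q.val) := by
    ext q
    simp only [Finset.mem_filter, Finset.mem_univ, true_and, Finset.mem_insert, Fin.ext_iff,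
      Fin.val_castSucc, Fin.val_succ]
    omega
  rw [glWt, glWt, this, Finset.sum_insert (by simp), add_sub_cancel_right]

variable (lam : Fin r → ℂ)

theorem vermaIdeal_le : vermaIdeal lam ≤
    LinearMap.ker (LinearMap.toSpanSingleton (USl r) (SeriesMod (glWt lam)) (vac r)) := by
  refine Ideal.span_le.mpr ?_
  rintro x (⟨a, b, h, rfl⟩ | ⟨k, rfl⟩)
  · change act (glWt lam) (E a b h.ne) (vac r) = 0
    rw [act_E, gl_upper_vac _ h]
  · change act (glWt lam) (H k - algebraMap ℂ (USl r) (lam k)) (vac r) = 0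
    rw [map_sub, act_H, AlgHom.commutes, LinearMap.sub_apply, LinearMap.sub_apply, gl_diag_vac,
      gl_diag_vac, ← sub_smul, glWt_sub]
    simp

/-- The realization of the Verma module by formal series. -/
def realize : Verma lam →ₗ[ℂ] Series r where
  toFun := (vermaIdeal lam).liftQ _ (vermaIdeal_le lam)
  map_add' := map_add _
  map_smul' c u := by
    rw [← algebraMap_smul (USl r) c u, map_smul]
    change act (glWt lam) (algebraMap ℂ (USl r) c) _ = _
    rw [AlgHom.commutes]
    rfl

theorem realize_smul (a : USl r) (u : Verma lam) :
    realize lam (a • u) = act (glWt lam) a (realize lam u) :=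
  map_smul ((vermaIdeal lam).liftQ _ (vermaIdeal_le lam)) a u

theorem realize_hwVec : realize lam (hwVec lam) = vac r := by
  change (vermaIdeal lam).liftQ _ (vermaIdeal_le lam) (Submodule.Quotient.mk 1) = _
  rw [← Submodule.mkQ_apply, ← LinearMap.comp_apply, Submodule.liftQ_mkQ]
  exact LinearMap.toSpanSingleton_apply_one (USl r) (SeriesMod (glWt lam)) (vac r)

end Action

/-! ### The realization of the basis vectors -/

section Pbw

variable {r : ℕ} (L : Fin (r + 1) → ℂ)

/-- The series is independent of the variables in the rows above the row `i`. -/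
def FreeAbove (i : ℕ) (f : Series r) : Prop := ∀ j k : Fin (r + 1), j.val < i → pdOp j k f = 0

theorem FreeAbove.xOp {i : Fin (r + 1)} {f : Series r} (hf : FreeAbove i.val f) (k : Fin (r + 1)) :
    FreeAbove i.val (xOp i k f) := by
  intro j l hj
  have h := lie_pdOp_xOp j l i k
  rw [if_neg (by rintro ⟨rfl, -⟩; exact lt_irrefl _ hj), Ring.lie_def, sub_eq_zero] at h
  rw [← Module.End.mul_apply, h, Module.End.mul_apply, hf j l hj, map_zero]

/-- The correction terms in `gl_lower` differentiate in row `j`, which lies above row `i`. -/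
theorem FreeAbove.gl_eq {i : Fin (r + 1)} {f : Series r} (hf : FreeAbove i.val f)
    {j : Fin (r + 1)} (h : j < i) : gl L i j f = SlVerma.xOp i j f := by
  rw [gl_lower L h, LinearMap.add_apply, LinearMap.sum_apply,
    Finset.sum_eq_zero fun k _ => by rw [Module.End.mul_apply, hf j k h, map_zero], add_zero]

/-- The part of an ordered monomial that belongs to the row `i`. -/
def rowProd (α : NegRoot r →₀ ℕ) (i : Fin (r + 1)) : USl r :=
  ((List.finRange (r + 1)).map fun j => if h : j < i then E i j h.ne' ^ α (nr h) else 1).prod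

/-- The part of a monomial that belongs to the row `i`. -/
def rowMonomial (α : NegRoot r →₀ ℕ) (i : Fin (r + 1)) : Poly r :=
  ((List.finRange (r + 1)).map fun j =>
    if h : j < i then (MvPolynomial.X (nr h) : Poly r) ^ α (nr h) else 1).prod

theorem prod_rowMonomial (α : NegRoot r →₀ ℕ) :
    ((List.finRange (r + 1)).map (rowMonomial α)).prod = MvPolynomial.monomial α 1 := by
  simp only [rowMonomial, ← Fin.prod_univ_def]
  rw [MvPolynomial.monomial_eq, map_one, one_mul, Finsupp.prod_fintype _ _ (by simp)]
  rw [← Fintype.prod_prod_type' (f := fun i j =>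
    if h : j < i then (MvPolynomial.X (nr h) : Poly r) ^ α (nr h) else 1)]
  have h1 : ∀ v : NegRoot r, (MvPolynomial.X v : Poly r) ^ α v =
      (fun p : Fin (r + 1) × Fin (r + 1) => if h : p.2 < p.1 then
        (MvPolynomial.X (⟨p, h⟩ : NegRoot r) : Poly r) ^ α ⟨p, h⟩ else 1) v.1 := by
    rintro ⟨p, hp⟩
    simp [hp]
  have h2 := Finset.prod_subtype (F := inferInstanceAs (Fintype (NegRoot r)))
    (Finset.univ.filter fun p : Fin (r + 1) × Fin (r + 1) => p.2 < p.1)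
    (p := fun p => p.2 < p.1) (by simp)
    (fun p : Fin (r + 1) × Fin (r + 1) => if h : p.2 < p.1 then
        (MvPolynomial.X (⟨p, h⟩ : NegRoot r) : Poly r) ^ α ⟨p, h⟩ else 1)
  rw [Finset.prod_congr rfl fun v _ => h1 v, ← h2, Finset.prod_filter]
  refine Finset.prod_congr rfl fun p _ => ?_
  split_ifs <;> rfl

theorem act_E_pow {i j : Fin (r + 1)} (h : j < i) (n : ℕ) (g : Poly r)
    (hg : FreeAbove i.val (toSeries g)) :
    act L (E i j h.ne' ^ n) (toSeries g) = toSeries (MvPolynomial.X (nr h) ^ n * g) ∧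
      FreeAbove i.val (toSeries (MvPolynomial.X (nr h) ^ n * g)) := by
  induction n with
  | zero => simpa using hg
  | succ n ih =>
    rw [pow_succ', pow_succ', map_mul, Module.End.mul_apply, ih.1, act_E, ih.2.gl_eq L h, mul_assoc,
      ← xPow_toSeries, xOp_of_lt h]
    refine ⟨rfl, ?_⟩
    rw [← xOp_of_lt h]
    exact ih.2.xOp j

theorem act_rowProd (α : NegRoot r →₀ ℕ) (i : Fin (r + 1)) (g : Poly r)
    (hg : FreeAbove i.val (toSeries g)) :
    act L (rowProd α i) (toSeries g) = toSeries (rowMonomial α i * g) ∧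
      FreeAbove i.val (toSeries (rowMonomial α i * g)) := by
  rw [rowProd, rowMonomial]
  induction List.finRange (r + 1) with
  | nil => simpa using hg
  | cons j l ih =>
    simp only [List.map_cons, List.prod_cons, map_mul, Module.End.mul_apply, ih.1, mul_assoc]
    by_cases h : j < i
    · simp only [h, dif_pos]
      exact act_E_pow L h _ _ ih.2
    · simpa [h] using ih.2

/-- The rightmost factors act first, so rows act in decreasing order. When row `i` acts, only
variables of rows `≥ i` are present, and each `E_{i,j}` is plain multiplication by `x_{i,j}`. -/
theorem act_pbw (α : NegRoot r →₀ ℕ) :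
    act L (pbw α) (vac r) = toSeries (MvPolynomial.monomial α 1) := by
  rw [← prod_rowMonomial]
  change act L ((List.finRange (r + 1)).map (rowProd α)).prod (toSeries 1) = _
  have hs : (List.finRange (r + 1)).Pairwise (· < ·) := List.pairwise_lt_finRange _
  have key : ∀ l : List (Fin (r + 1)), l.Pairwise (· < ·) →
      act L (l.map (rowProd α)).prod (toSeries 1) = toSeries (l.map (rowMonomial α)).prod ∧
        ∀ i : Fin (r + 1), (∀ j ∈ l, i ≤ j) →
          FreeAbove i.val (toSeries (l.map (rowMonomial α)).prod) := by
    intro l hl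
    induction l with
    | nil => exact ⟨by simp, fun i _ j k _ => pdOp_vac j k⟩
    | cons i l ih =>
      rw [List.pairwise_cons] at hl
      obtain ⟨h1, h2⟩ := ih hl.2
      simp only [List.map_cons, List.prod_cons, map_mul, Module.End.mul_apply, h1]
      obtain ⟨h3, h4⟩ := act_rowProd L α i _ (h2 i fun j hj => (hl.1 j hj).le)
      refine ⟨h3, fun k hk j c hj => h4 j c (hj.trans_le (hk i List.mem_cons_self))⟩
  exact (key _ hs).1

/-- This takes the place of the linear independence half of the PBW theorem: distinct monomials are
distinct as series. -/
theorem realize_tauInv (lam : Fin r → ℂ) (g : Poly r) :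
    realize lam (tauInv lam g) = toSeries g := by
  let T : Poly r →ₗ[ℂ] Series r :=
    { toFun := toSeries, map_add' := toSeries_add, map_smul' := toSeries_smul }
  have : (realize lam).comp (tauInv lam) = T := by
    refine (MvPolynomial.basisMonomials (NegRoot r) ℂ).ext fun α => ?_
    rw [LinearMap.comp_apply, tauInv, Module.Basis.constr_basis, realize_smul, realize_hwVec,
      act_pbw, MvPolynomial.coe_basisMonomials]
    rfl
  exact LinearMap.congr_fun this g

theorem tauInv_injective (lam : Fin r → ℂ) : Function.Injective (tauInv lam) := fun f g h =>
  toSeries_injective (by rw [← realize_tauInv lam, h, realize_tauInv])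

end Pbw

/-! ### Ordered monomials span the Verma module -/

section Span

variable {r : ℕ}

theorem ι_mul_ι (x y : Sl r) : UniversalEnvelopingAlgebra.ι ℂ x * UniversalEnvelopingAlgebra.ι ℂ y
    = UniversalEnvelopingAlgebra.ι ℂ y * UniversalEnvelopingAlgebra.ι ℂ x
      + UniversalEnvelopingAlgebra.ι ℂ ⁅x, y⁆ := by
  rw [LieHom.map_lie, Ring.lie_def]
  abel

theorem E_mul_E_comm {a b c d : Fin (r + 1)} (h : a ≠ b) (h' : c ≠ d) (hbc : b ≠ c) (had : a ≠ d) :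
    E a b h * E c d h' = E c d h' * E a b h := by
  rw [E, E, ι_mul_ι, add_eq_left]
  have : ⁅LieAlgebra.SpecialLinear.single a b h (1 : ℂ),
      LieAlgebra.SpecialLinear.single c d h' (1 : ℂ)⁆ = 0 := by
    apply Subtype.ext
    rw [LieAlgebra.SpecialLinear.sl_bracket, LieAlgebra.SpecialLinear.val_single,
      LieAlgebra.SpecialLinear.val_single, Matrix.single_mul_single_of_ne _ _ _ _ hbc,
      Matrix.single_mul_single_of_ne _ _ _ _ had.symm, sub_self]
    rfl
  rw [this, map_zero]

theorem E_mul_E {a b d : Fin (r + 1)} (h : a ≠ b) (h' : b ≠ d) (had : a ≠ d) :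
    E a b h * E b d h' = E b d h' * E a b h + E a d had := by
  rw [E, E, ι_mul_ι, E]
  congr 2
  apply Subtype.ext
  rw [LieAlgebra.SpecialLinear.sl_bracket, LieAlgebra.SpecialLinear.val_single,
    LieAlgebra.SpecialLinear.val_single, LieAlgebra.SpecialLinear.val_single,
    Matrix.single_mul_single_same, Matrix.single_mul_single_of_ne _ _ _ _ had.symm, sub_zero,
    mul_one]

theorem mul_prod_map_of_commute {M ι : Type*} [Monoid M] (x : M) (f g : ι → M) (j : ι)
    (hfg : ∀ k, k ≠ j → g k = f k) (hj : g j = x * f j) (hx : ∀ k, Commute x (f k)) (l : List ι)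
    (hl : l.Nodup) (hjl : j ∈ l) : x * (l.map f).prod = (l.map g).prod := by
  induction l with
  | nil => simp at hjl
  | cons k l ih =>
    rw [List.nodup_cons] at hl
    rw [List.map_cons, List.map_cons, List.prod_cons, List.prod_cons]
    by_cases hk : k = j
    · subst hk
      rw [hj, mul_assoc, List.map_congr_left fun m hm => hfg m fun h => hl.1 (h ▸ hm)]
    · rw [← mul_assoc, (hx k).eq, mul_assoc, ih hl.2 ((List.mem_cons.mp hjl).resolve_left
        (Ne.symm hk)), hfg k hk]

theorem rowProd_congr {α β : NegRoot r →₀ ℕ} {i : Fin (r + 1)}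
    (h : ∀ j (hj : j < i), α (nr hj) = β (nr hj)) : rowProd α i = rowProd β i := by
  rw [rowProd, rowProd]
  congr 1
  refine List.map_congr_left fun j _ => ?_
  split_ifs with hj
  · rw [h j hj]
  · rfl

/-- Root vectors of one row commute with each other, so a new factor can be carried to its place. -/
theorem E_mul_rowProd (α : NegRoot r →₀ ℕ) {i j : Fin (r + 1)} (h : j < i) :
    E i j h.ne' * rowProd α i = rowProd (α + Finsupp.single (nr h) 1) i := by
  refine mul_prod_map_of_commute _ _ _ j (fun k hk => ?_) ?_ (fun k => ?_) _
    (List.nodup_finRange _) (List.mem_finRange _)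
  · split_ifs with hki
    · rw [Finsupp.add_apply, Finsupp.single_eq_of_ne, add_zero]
      rw [Ne, nr_inj]
      exact fun h' => hk h'.2
    · rfl
  · simp [h, pow_succ']
  · split_ifs with hki
    · exact (show Commute _ _ from E_mul_E_comm _ _ h.ne hki.ne').pow_right _
    · exact Commute.one_right _

variable (lam : Fin r → ℂ)

/-- The span of the ordered monomials in the rows of the list `l`. -/
def rowSpan (l : List (Fin (r + 1))) : Submodule ℂ (Verma lam) :=
  Submodule.span ℂ (Set.range fun α : NegRoot r →₀ ℕ => (l.map (rowProd α)).prod • hwVec lam)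

/-- Left multiplication in the Verma module. -/
def lmul (a : USl r) : Verma lam →ₗ[ℂ] Verma lam where
  toFun u := a • u
  map_add' := smul_add a
  map_smul' c u := smul_comm a c u

theorem lmul_apply (a : USl r) (u : Verma lam) : lmul lam a u = a • u := rfl

theorem E_smul_rowSpan {i j : Fin (r + 1)} (h : j < i) {l : List (Fin (r + 1))} (hi : i ∉ l)
    {m : Verma lam} (hm : m ∈ rowSpan lam (i :: l)) : E i j h.ne' • m ∈ rowSpan lam (i :: l) := by
  suffices rowSpan lam (i :: l) ≤ (rowSpan lam (i :: l)).comap (lmul lam (E i j h.ne')) from this hm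
  refine Submodule.span_le.mpr ?_
  rintro _ ⟨α, rfl⟩
  refine Submodule.subset_span ⟨α + Finsupp.single (nr h) 1, ?_⟩
  simp only [List.map_cons, List.prod_cons, lmul_apply]
  rw [← E_mul_rowProd, ← smul_assoc, smul_eq_mul, mul_assoc,
    List.map_congr_left fun k hk => rowProd_congr fun j' hj' => ?_]
  rw [Finsupp.add_apply, Finsupp.single_eq_of_ne, add_zero]
  rw [Ne, nr_inj]
  rintro ⟨rfl, -⟩
  exact hi hk

theorem rowSpan_le_cons {i : Fin (r + 1)} {l : List (Fin (r + 1))} (hi : i ∉ l) :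
    rowSpan lam l ≤ rowSpan lam (i :: l) := by
  refine Submodule.span_le.mpr ?_
  rintro _ ⟨α, rfl⟩
  refine Submodule.subset_span ⟨α.filter fun v => v.1.1 ≠ i, ?_⟩
  have h1 : rowProd (α.filter fun v => v.1.1 ≠ i) i = 1 := by
    rw [rowProd]
    refine List.prod_eq_one fun x hx => ?_
    obtain ⟨j, -, rfl⟩ := List.mem_map.mp hx
    split_ifs with h
    · rw [Finsupp.filter_apply_neg _ _ (by simp), pow_zero]
    · rfl
  simp only [List.map_cons, List.prod_cons, h1, one_mul]
  rw [List.map_congr_left fun k hk => rowProd_congr fun j hj =>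
    Finsupp.filter_apply_pos _ _ (by rintro rfl; exact hi hk)]

theorem rowProd_smul_mem {Q : Submodule ℂ (Verma lam)} {i : Fin (r + 1)}
    (hQ : ∀ j (h : j < i), ∀ m ∈ Q, E i j h.ne' • m ∈ Q) (α : NegRoot r →₀ ℕ) {m : Verma lam}
    (hm : m ∈ Q) : rowProd α i • m ∈ Q := by
  rw [rowProd]
  induction List.finRange (r + 1) with
  | nil => simpa using hm
  | cons j l ih =>
    rw [List.map_cons, List.prod_cons, mul_smul]
    split_ifs with h
    · induction α (nr h) with
      | zero => rwa [pow_zero, one_smul]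
      | succ n ihn =>
        rw [pow_succ', mul_smul]
        exact hQ j h _ ihn
    · rwa [one_smul]

theorem rowSpan_cons_le {Q : Submodule ℂ (Verma lam)} {i : Fin (r + 1)} {l : List (Fin (r + 1))}
    (hl : rowSpan lam l ≤ Q) (hQ : ∀ j (h : j < i), ∀ m ∈ Q, E i j h.ne' • m ∈ Q) :
    rowSpan lam (i :: l) ≤ Q := by
  refine Submodule.span_le.mpr ?_
  rintro _ ⟨α, rfl⟩
  simp only [List.map_cons, List.prod_cons, mul_smul]
  exact rowProd_smul_mem lam hQ α (hl (Submodule.subset_span ⟨α, rfl⟩))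

/-- Moving `E_{a,b}` past a factor `E_{i,j}` of a row `i < a` produces at most `E_{a,j}`, again from
row `a`. Hence stability has to be proved for all `b` at once; `Q` collects the vectors for which it
holds. -/
theorem E_lower_smul_rowSpan (l : List (Fin (r + 1))) (hl : l.Pairwise (· < ·)) (a : Fin (r + 1))
    (ha : a ∈ l) (b : Fin (r + 1)) (hb : b < a) (m : Verma lam) (hm : m ∈ rowSpan lam l) :
    E a b hb.ne' • m ∈ rowSpan lam l := by
  induction l generalizing m a b with
  | nil => simp at ha
  | cons i l ih =>
    rw [List.pairwise_cons] at hl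
    have hi : i ∉ l := fun h => lt_irrefl _ (hl.1 i h)
    rcases List.mem_cons.mp ha with rfl | ha
    · exact E_smul_rowSpan lam hb hi hm
    have hia := hl.1 a ha
    let Q : Submodule ℂ (Verma lam) := rowSpan lam (i :: l) ⊓
      ⨅ (b : Fin (r + 1)) (hb : b < a), (rowSpan lam (i :: l)).comap (lmul lam (E a b hb.ne'))
    have hQ : ∀ m, m ∈ Q ↔ m ∈ rowSpan lam (i :: l) ∧
        ∀ b (hb : b < a), E a b hb.ne' • m ∈ rowSpan lam (i :: l) := by
      intro m
      simp [Q, lmul_apply]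
    refine ((hQ m).mp (rowSpan_cons_le lam ?_ ?_ hm)).2 b hb
    · intro m hm
      exact (hQ m).mpr ⟨rowSpan_le_cons lam hi hm, fun b hb =>
        rowSpan_le_cons lam hi (ih hl.2 a ha b hb m hm)⟩
    · intro j h m hm
      obtain ⟨h1, h2⟩ := (hQ m).mp hm
      refine (hQ _).mpr ⟨E_smul_rowSpan lam h hi h1, fun b hb => ?_⟩
      rw [← mul_smul]
      have hja : a ≠ j := (h.trans hia).ne'
      by_cases hbi : b = i
      · subst hbi
        rw [E_mul_E _ _ hja, add_smul, mul_smul]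
        exact add_mem (E_smul_rowSpan lam h hi (h2 _ hb)) (h2 j (h.trans hb))
      · rw [E_mul_E_comm _ _ hbi hja, mul_smul]
        exact E_smul_rowSpan lam h hi (h2 b hb)

theorem range_tauInv : LinearMap.range (tauInv lam) = rowSpan lam (List.finRange (r + 1)) := by
  rw [tauInv, Module.Basis.constr_range]
  rfl

theorem E_lower_smul_range {a b : Fin (r + 1)} (hb : b < a) (m : Verma lam)
    (hm : m ∈ LinearMap.range (tauInv lam)) : E a b hb.ne' • m ∈ LinearMap.range (tauInv lam) := by
  rw [range_tauInv] at hm ⊢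
  exact E_lower_smul_rowSpan lam _ (List.pairwise_lt_finRange _) a (List.mem_finRange _) b hb m hm

theorem hwVec_mem_range : hwVec lam ∈ LinearMap.range (tauInv lam) := by
  rw [range_tauInv]
  refine Submodule.subset_span ⟨0, ?_⟩
  have : ∀ i, rowProd (0 : NegRoot r →₀ ℕ) i = 1 := fun i => by
    rw [rowProd]
    refine List.prod_eq_one fun x hx => ?_
    obtain ⟨j, -, rfl⟩ := List.mem_map.mp hx
    simp
  have h2 : ((List.finRange (r + 1)).map (rowProd (0 : NegRoot r →₀ ℕ))).prod = 1 :=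
    List.prod_eq_one fun x hx => by
      obtain ⟨j, -, rfl⟩ := List.mem_map.mp hx
      exact this j
  simp only [h2, one_smul]

/-! ### Stability of the span under all of `U(sl(n))`. -/

theorem singleSubSingle_mem {P : Submodule ℂ (Sl r)}
    (h2 : ∀ k : Fin r, LieAlgebra.SpecialLinear.singleSubSingle k.castSucc k.succ (1 : ℂ) ∈ P)
    (a : Fin (r + 1)) : LieAlgebra.SpecialLinear.singleSubSingle 0 a (1 : ℂ) ∈ P := by
  induction a using Fin.induction with
  | zero =>
    have : LieAlgebra.SpecialLinear.singleSubSingle (0 : Fin (r + 1)) 0 (1 : ℂ) = 0 :=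
      Subtype.ext (by simp)
    rw [this]
    exact zero_mem P
  | succ k ih =>
    rw [← LieAlgebra.SpecialLinear.singleSubSingle_add_singleSubSingle 0 k.castSucc k.succ]
    exact add_mem ih (h2 k)

theorem sl_submodule_eq_top {P : Submodule ℂ (Sl r)}
    (h1 : ∀ a b (h : a ≠ b), LieAlgebra.SpecialLinear.single a b h (1 : ℂ) ∈ P)
    (h2 : ∀ k : Fin r, LieAlgebra.SpecialLinear.singleSubSingle k.castSucc k.succ (1 : ℂ) ∈ P)
    (z : Sl r) : z ∈ P := by
  -- Since the trace is zero, the diagonal part `∑ z_{aa} E_{aa}` equals `-∑ z_{aa} (E_{00} -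
  -- E_{aa})`.
  have h : z = ∑ a, ∑ b, if h : a = b then
      - z.val a a • LieAlgebra.SpecialLinear.singleSubSingle 0 a (1 : ℂ)
      else z.val a b • LieAlgebra.SpecialLinear.single a b h (1 : ℂ) := by
    apply Subtype.ext
    have hs : ∀ w : Fin (r + 1) → Fin (r + 1) → Sl r,
        (∑ a, ∑ b, w a b).val = ∑ a, ∑ b, (w a b).val := fun w => by
      simp only [AddSubmonoidClass.coe_finsetSum]
    have ht : ∑ a, z.val a a = 0 := z.2
    have hd : ∀ a b, (if h : a = b then
        - z.val a a • LieAlgebra.SpecialLinear.singleSubSingle 0 a (1 : ℂ)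
        else z.val a b • LieAlgebra.SpecialLinear.single a b h (1 : ℂ) : Sl r).val
        = Matrix.single a b (z.val a b) - if a = b then Matrix.single 0 0 (z.val a a) else 0 := by
      intro a b
      split_ifs with hab
      · subst hab
        change - z.val a a • (LieAlgebra.SpecialLinear.singleSubSingle 0 a (1 : ℂ)).val = _
        rw [LieAlgebra.SpecialLinear.val_singleSubSingle, smul_sub, Matrix.smul_single,
          Matrix.smul_single, smul_eq_mul, mul_one, ← Matrix.single_neg, ← Matrix.single_neg, neg_sub_neg]
      · change z.val a b • (LieAlgebra.SpecialLinear.single a b hab (1 : ℂ)).val = _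
        rw [LieAlgebra.SpecialLinear.val_single, Matrix.smul_single, smul_eq_mul, mul_one, sub_zero]
    rw [hs]
    simp_rw [hd, Finset.sum_sub_distrib, Finset.sum_ite_eq, Finset.mem_univ, if_true]
    rw [← Matrix.matrix_eq_sum_single, eq_comm, sub_eq_self]
    refine (map_sum (Matrix.singleAddMonoidHom 0 0) (fun a => z.val a a) Finset.univ).symm.trans ?_
    rw [ht, map_zero]
  rw [h]
  refine sum_mem fun a _ => sum_mem fun b _ => ?_
  split_ifs with hab
  · exact P.smul_mem _ (singleSubSingle_mem h2 a)
  · exact P.smul_mem _ (h1 a b hab)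

theorem ι_smul_hwVec_mem (z : Sl r) :
    UniversalEnvelopingAlgebra.ι ℂ z • hwVec lam ∈ LinearMap.range (tauInv lam) := by
  let F : Sl r →ₗ[ℂ] Verma lam :=
    { toFun := fun z => UniversalEnvelopingAlgebra.ι ℂ z • hwVec lam
      map_add' := fun x y => by rw [map_add, add_smul]
      map_smul' := fun c x => by rw [map_smul, smul_assoc]; rfl }
  have hmk : ∀ x : USl r, x • hwVec lam = Submodule.Quotient.mk x := fun x => by
    rw [hwVec, ← Submodule.Quotient.mk_smul, smul_eq_mul, mul_one]
  refine sl_submodule_eq_top (P := (LinearMap.range (tauInv lam)).comap F) (fun a b h => ?_)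
    (fun k => ?_) z
  · rcases lt_or_gt_of_ne h with h' | h'
    · have : E a b h • hwVec lam = 0 := by
        rw [hmk, Submodule.Quotient.mk_eq_zero]
        exact Submodule.subset_span (Or.inl ⟨a, b, h', rfl⟩)
      change E a b h • hwVec lam ∈ LinearMap.range (tauInv lam)
      rw [this]
      exact zero_mem _
    · exact E_lower_smul_range lam h' _ (hwVec_mem_range lam)
  · have : H k • hwVec lam = lam k • hwVec lam := by
      rw [← sub_eq_zero, ← algebraMap_smul (USl r) (lam k), ← sub_smul, hmk,
        Submodule.Quotient.mk_eq_zero]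
      exact Submodule.subset_span (Or.inr ⟨k, rfl⟩)
    change H k • hwVec lam ∈ LinearMap.range (tauInv lam)
    rw [this]
    exact Submodule.smul_mem _ _ (hwVec_mem_range lam)

/-- The commutator of `z` with `E_{i,j}` lies again in `sl(n)`. Requiring stability for all `z`
simultaneously thus gives a subspace `Q` closed under the lower root vectors, and it contains `v_λ`.
-/
theorem ι_smul_range (z : Sl r) (m : Verma lam) (hm : m ∈ LinearMap.range (tauInv lam)) :
    UniversalEnvelopingAlgebra.ι ℂ z • m ∈ LinearMap.range (tauInv lam) := by
  let Q : Submodule ℂ (Verma lam) := LinearMap.range (tauInv lam) ⊓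
    ⨅ z : Sl r, (LinearMap.range (tauInv lam)).comap (lmul lam (UniversalEnvelopingAlgebra.ι ℂ z))
  have hQ : ∀ m, m ∈ Q ↔ m ∈ LinearMap.range (tauInv lam) ∧
      ∀ z : Sl r, UniversalEnvelopingAlgebra.ι ℂ z • m ∈ LinearMap.range (tauInv lam) := by
    intro m
    simp only [Q, Submodule.mem_inf, Submodule.mem_iInf, Submodule.mem_comap, lmul_apply]
  have hE : ∀ (i j : Fin (r + 1)) (h : j < i), ∀ m ∈ Q, E i j h.ne' • m ∈ Q := by
    intro i j h m hm
    obtain ⟨h1, h2⟩ := (hQ m).mp hm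
    refine (hQ _).mpr ⟨E_lower_smul_range lam h m h1, fun z => ?_⟩
    rw [← mul_smul, E, ι_mul_ι, add_smul, mul_smul]
    exact add_mem (E_lower_smul_range lam h _ (h2 z)) (h2 _)
  have hl : ∀ l : List (Fin (r + 1)), rowSpan lam l ≤ Q := by
    intro l
    induction l with
    | nil =>
      refine Submodule.span_le.mpr ?_
      rintro _ ⟨α, rfl⟩
      simp only [List.map_nil, List.prod_nil, one_smul]
      exact (hQ _).mpr ⟨hwVec_mem_range lam, ι_smul_hwVec_mem lam⟩
    | cons i l ih => exact rowSpan_cons_le lam ih (hE i)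
  exact ((hQ m).mp (hl _ (range_tauInv lam ▸ hm))).2 z

/-- By the universal property the map of `sl(n)` into `S` extends to the enveloping algebra;
followed by the inclusion of `S` it is the identity on generators. -/
theorem subalgebra_eq_top (S : Subalgebra ℂ (USl r))
    (hS : ∀ z : Sl r, UniversalEnvelopingAlgebra.ι ℂ z ∈ S) (a : USl r) : a ∈ S := by
  let f : Sl r →ₗ⁅ℂ⁆ S :=
    { toFun := fun z => ⟨UniversalEnvelopingAlgebra.ι ℂ z, hS z⟩
      map_add' := fun x y => Subtype.ext (map_add (UniversalEnvelopingAlgebra.ι ℂ) x y)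
      map_smul' := fun c x => Subtype.ext (map_smul (UniversalEnvelopingAlgebra.ι ℂ) c x)
      map_lie' := fun {x y} => Subtype.ext (LieHom.map_lie _ x y) }
  have h : S.val.comp (UniversalEnvelopingAlgebra.lift ℂ f) = AlgHom.id ℂ (USl r) := by
    apply UniversalEnvelopingAlgebra.hom_ext
    ext z
    change ((UniversalEnvelopingAlgebra.lift ℂ f (UniversalEnvelopingAlgebra.ι ℂ z) : S) : USl r) = _
    rw [UniversalEnvelopingAlgebra.lift_ι_apply]
    rfl
  have h1 := DFunLike.congr_fun h a
  rw [AlgHom.id_apply] at h1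
  rw [← h1]
  exact (UniversalEnvelopingAlgebra.lift ℂ f a).2

theorem tauInv_surjective : Function.Surjective (tauInv lam) := by
  let S : Subalgebra ℂ (USl r) :=
    { carrier := {a | ∀ m ∈ LinearMap.range (tauInv lam), a • m ∈ LinearMap.range (tauInv lam)}
      mul_mem' := fun {a b} ha hb m hm => by rw [mul_smul]; exact ha _ (hb _ hm)
      add_mem' := fun {a b} ha hb m hm => by rw [add_smul]; exact add_mem (ha _ hm) (hb _ hm)
      algebraMap_mem' := fun c m hm => by
        rw [algebraMap_smul]; exact Submodule.smul_mem _ _ hm }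
  intro u
  obtain ⟨a, rfl⟩ := Submodule.Quotient.mk_surjective _ u
  have := subalgebra_eq_top S (fun z => ι_smul_range lam z) a _ (hwVec_mem_range lam)
  rwa [hwVec, ← Submodule.Quotient.mk_smul, smul_eq_mul, mul_one] at this

theorem tauInv_bijective : Function.Bijective (tauInv lam) :=
  ⟨tauInv_injective lam, tauInv_surjective lam⟩

theorem realize_injective : Function.Injective (realize lam) := fun u v h => by
  obtain ⟨f, rfl⟩ := tauInv_surjective lam u
  obtain ⟨g, rfl⟩ := tauInv_surjective lam v
  rw [realize_tauInv, realize_tauInv] at h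
  rw [toSeries_injective h]

end Span

/-! ### Coefficientwise convergence -/

section Admissible

variable {r : ℕ}

/-- Each coefficient is eventually constant along the sequence. -/
def Conv (F : ℕ → Series r) (f : Series r) : Prop := ∀ β, ∀ᶠ N in Filter.atTop, F N β = f β

theorem Conv.unique {F : ℕ → Series r} {f g : Series r} (hf : Conv F f) (hg : Conv F g) : f = g :=
  funext fun β => by
    obtain ⟨N, h1, h2⟩ := ((hf β).and (hg β)).exists
    exact h1.symm.trans h2

theorem IsFormal.add {f g : Series r} (hf : IsFormal f) (hg : IsFormal g) : IsFormal (f + g) := by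
  intro β h v hv
  by_cases hf0 : f β = 0
  · exact hg β (fun h0 => h (by rw [Pi.add_apply, hf0, h0, add_zero])) v hv
  · exact hf β hf0 v hv

theorem IsFormal.smul {f : Series r} (hf : IsFormal f) (c : ℂ) : IsFormal (c • f) :=
  fun β h v hv => hf β (fun h0 => h (by rw [Pi.smul_apply, h0, smul_zero])) v hv

/-- The operators that preserve formal series and coefficientwise convergence. -/
def admissible (r : ℕ) : Subalgebra ℂ (Module.End ℂ (Series r)) where
  carrier := {T | (∀ f, IsFormal f → IsFormal (T f)) ∧
    ∀ F f, Conv F f → Conv (fun N => T (F N)) (T f)}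
  mul_mem' := fun {S T} hS hT => ⟨fun f hf => hS.1 _ (hT.1 f hf), fun F f hF => hS.2 _ _ (hT.2 F f hF)⟩
  add_mem' := fun {S T} hS hT => ⟨fun f hf => (hS.1 _ hf).add (hT.1 f hf), fun F f hF β => by
    filter_upwards [hS.2 F f hF β, hT.2 F f hF β] with N h1 h2
    rw [LinearMap.add_apply, LinearMap.add_apply, Pi.add_apply, Pi.add_apply, h1, h2]⟩
  algebraMap_mem' := fun c => ⟨fun f hf => hf.smul c, fun F f hF b => by
    filter_upwards [hF b] with N h
    rw [Module.algebraMap_end_apply, Module.algebraMap_end_apply, Pi.smul_apply, Pi.smul_apply, h]⟩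

theorem xPow_conv (v : NegRoot r) (c : ℂ) (F : ℕ → Series r) (f : Series r) (h : Conv F f) :
    Conv (fun N => xPow v c (F N)) (xPow v c f) := fun _ => h _

theorem xOp_mem (i j : Fin (r + 1)) : xOp i j ∈ admissible r := by
  rw [xOp]
  split_ifs with h
  · exact ⟨fun f hf => hf.xPow_one _, xPow_conv _ _⟩
  · exact zero_mem _

theorem pdOp_mem (i j : Fin (r + 1)) : pdOp i j ∈ admissible r := by
  rw [pdOp]
  split_ifs with h
  · exact ⟨fun f hf => hf.pd _, fun F f hF β => by
      filter_upwards [hF (β + Pi.single (nr h) 1)] with N hN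
      rw [pd_apply, pd_apply, hN]⟩
  · exact zero_mem _

theorem glAux_mem (L : Fin (r + 1) → ℂ) (m : ℕ) (i j : Fin (r + 1)) :
    glAux L m i j ∈ admissible r := by
  induction m generalizing i j with
  | zero => exact zero_mem _
  | succ m ih =>
    have h1 : ∀ c, ∑ k, xOp k c * pdOp k c ∈ admissible r := fun c =>
      sum_mem fun k _ => mul_mem (xOp_mem _ _) (pdOp_mem _ _)
    rw [glAux]
    split_ifs
    · exact sub_mem (Subalgebra.algebraMap_mem _ _) (h1 _)
    · exact sub_mem (sub_mem (mul_mem (Subalgebra.algebraMap_mem _ _) (pdOp_mem _ _))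
        (sum_mem fun k _ => mul_mem (ih _ _) (pdOp_mem _ _))) (mul_mem (h1 _) (pdOp_mem _ _))
    · exact xOp_mem _ _
    · exact add_mem (ih _ _) (mul_mem (xOp_mem _ _) (pdOp_mem _ _))

theorem gl_mem (L : Fin (r + 1) → ℂ) (i j : Fin (r + 1)) : gl L i j ∈ admissible r :=
  glAux_mem _ _ _ _

theorem dOp_eq (k : Fin r) : dOp k = ∑ c, xOp k.succ c * pdOp k.castSucc c := by
  rw [dOp]
  have h := Finset.sum_subtype
    (F := inferInstanceAs (Fintype {j : Fin (r + 1) // j < k.castSucc}))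
    (Finset.univ.filter fun j : Fin (r + 1) => j < k.castSucc) (p := fun j => j < k.castSucc)
    (by simp) (fun c => xOp k.succ c * pdOp k.castSucc c)
  rw [← sum_mul_pdOp _ _ _ le_rfl, h]
  refine Finset.sum_congr rfl fun c _ => ?_
  rw [xOp_of_lt (c.2.trans Fin.castSucc_lt_succ), pdOp_of_lt c.2]

theorem dOp_mem (k : Fin r) : dOp k ∈ admissible r := by
  rw [dOp_eq]
  exact sum_mem fun k _ => mul_mem (xOp_mem _ _) (pdOp_mem _ _)

theorem lie_mem {S T : Module.End ℂ (Series r)} (hS : S ∈ admissible r) (hT : T ∈ admissible r) :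
    ⁅S, T⁆ ∈ admissible r := sub_mem (mul_mem hS hT) (mul_mem hT hS)

end Admissible

/-! ### Complex powers of the simple negative root vectors -/

section EtaPow

variable {r : ℕ}

/-- The terms of the series `η_k^μ u`. -/
def etaTerm (k : Fin r) (mu : ℂ) (u : Series r) (p : ℕ) : Series r :=
  (fallFact mu p / (p.factorial : ℂ)) • xPow (simpleRoot k) (mu - p) ((dOp k ^ p) u)

theorem conv_etaPow {u : Series r} (hu : IsFormal u) (k : Fin r) (mu : ℂ) :
    Conv (fun N => ∑ p ∈ Finset.range N, etaTerm k mu u p) (etaPow k mu u) := by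
  intro β
  have hfin := etaPow_finite hu k mu β
  obtain ⟨N, hN⟩ := hfin.bddAbove
  filter_upwards [Filter.eventually_gt_atTop N] with M hM
  rw [Finset.sum_apply, etaPow]
  symm
  refine finsum_eq_sum_of_support_subset _ fun p hp => ?_
  rw [Finset.coe_range, Set.mem_Iio]
  exact (hN hp).trans_lt hM

theorem fallFact_succ (mu : ℂ) (p : ℕ) :
    fallFact mu (p + 1) / ((p + 1).factorial : ℂ) * (p + 1 : ℂ)
      = fallFact mu p / (p.factorial : ℂ) * (mu - p) := by
  have h1 : (p.factorial : ℂ) ≠ 0 := Nat.cast_ne_zero.mpr p.factorial_ne_zero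
  have h2 : (p + 1 : ℂ) ≠ 0 := by exact_mod_cast p.succ_ne_zero
  rw [fallFact, Finset.prod_range_succ, ← fallFact, Nat.factorial_succ]
  push_cast
  field_simp

/-- This is the `sl(2)` formula for `[e, f^{p+1}]`, with `Z` as `h`. The scalar `a` is `1` in the
`sl(2)` case and `0` when `Z` commutes with `D`. -/
theorem lie_pow_of_lie {A : Type*} [Ring A] [Algebra ℂ A] {T D Z : A} {a : ℂ} (hD : ⁅T, D⁆ = Z)
    (hZ : ⁅Z, D⁆ = -(2 * a) • D) (p : ℕ) :
    ⁅T, D ^ (p + 1)⁆ = (p + 1 : ℂ) • (D ^ p * (Z - algebraMap ℂ A (a * p))) := by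
  have hZp : ∀ p : ℕ, Z * D ^ p = D ^ p * (Z - algebraMap ℂ A (2 * a * p)) := by
    intro p
    induction p with
    | zero => simp
    | succ p ih =>
      have h : Z * D = D * (Z - algebraMap ℂ A (2 * a)) := by
        rw [Ring.lie_def, sub_eq_iff_eq_add] at hZ
        rw [hZ, mul_sub, ← Algebra.commutes, ← Algebra.smul_def, neg_smul]
        abel
      rw [pow_succ, ← mul_assoc, ih, mul_assoc, sub_mul, h, Algebra.commutes, ← mul_sub, ← mul_assoc]
      congr 1
      rw [Nat.cast_succ, mul_add, mul_one, map_add]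
      abel
  induction p with
  | zero => simp [hD]
  | succ p ih =>
    rw [pow_succ', ring_lie_mul, ih, hD, hZp, mul_smul_comm, ← mul_assoc, ← pow_succ']
    simp only [mul_sub, ← Algebra.commutes (_ : ℂ) (D ^ (p + 1)), ← Algebra.smul_def, smul_sub,
      smul_smul]
    push_cast
    module

/-- If `T` kills `u` and acts on the factors of `η_k^μ` as stated, then `T` kills `η_k^μ u`. -/
theorem apply_etaPow_eq_zero {k : Fin r} {mu a : ℂ} {T P Z : Module.End ℂ (Series r)} {u : Series r}
    (hu : IsFormal u) (hT : T ∈ admissible r)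
    (hx : ∀ nu, ⁅T, xPow (simpleRoot k) nu⁆
      = nu • (xPow (simpleRoot k) (nu - 1) * (P - algebraMap ℂ _ (a * (nu - 1)))))
    (hD : ⁅T, dOp k⁆ = Z) (hZ : ⁅Z, dOp k⁆ = -(2 * a) • dOp k) (hP : ⁅P, dOp k⁆ = 0)
    (hTu : T u = 0) (hPZ : P u + Z u = (a * (mu - 1)) • u) : T (etaPow k mu u) = 0 := by
  -- `T (D^p u) = p D^{p-1} w_{p-1}`, and `s_p` is the resulting contribution of the `p`-th term.
  -- The truncated `p - 1` at `p = 0` is harmless because of the factor `p`.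
  let w : ℕ → Series r := fun p => Z u - (a * p) • u
  let s : ℕ → Series r := fun p =>
    (fallFact mu p / (p.factorial : ℂ) * p) • xPow (simpleRoot k) (mu - p) ((dOp k ^ (p - 1)) (w (p - 1)))
  have hDp : ∀ p : ℕ, T ((dOp k ^ p) u) = (p : ℂ) • (dOp k ^ (p - 1)) (w (p - 1)) := by
    intro p
    rcases p with _ | p
    · simpa using hTu
    · have h := LinearMap.congr_fun (lie_pow_of_lie hD hZ p) u
      rw [Ring.lie_def, LinearMap.sub_apply, Module.End.mul_apply, Module.End.mul_apply, hTu,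
        map_zero, sub_zero] at h
      rw [h, LinearMap.smul_apply, Module.End.mul_apply, LinearMap.sub_apply,
        Module.algebraMap_end_apply, Nat.cast_succ, Nat.add_sub_cancel]
  have hPp : ∀ p : ℕ, P ((dOp k ^ p) u) = (dOp k ^ p) (P u) := by
    intro p
    have h : Commute P (dOp k) := sub_eq_zero.mp hP
    exact LinearMap.congr_fun (h.pow_right p).eq u
  -- `T` meets either the power of `x` or the power of `D`. The second contribution is `s_p`. By
  -- `hPZ` the first is `-⟨μ⟩_p/p! (μ - p) x^{μ-p-1} D^p w_p`, which is `-s_{p+1}` by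
  -- `fallFact_succ`.
  have key : ∀ p, T (etaTerm k mu u p) = s p - s (p + 1) := by
    intro p
    have h := LinearMap.congr_fun (hx (mu - p)) ((dOp k ^ p) u)
    rw [Ring.lie_def, LinearMap.sub_apply, Module.End.mul_apply, Module.End.mul_apply,
      sub_eq_iff_eq_add, hDp] at h
    have h2 : (P - algebraMap ℂ (Module.End ℂ (Series r)) (a * (mu - p - 1))) ((dOp k ^ p) u)
        = - (dOp k ^ p) (w p) := by
      rw [LinearMap.sub_apply, hPp, Module.algebraMap_end_apply, eq_sub_of_add_eq hPZ, ← map_smul,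
        ← map_sub, ← map_neg]
      congr 1
      simp only [w]
      module
    rw [LinearMap.smul_apply, Module.End.mul_apply, h2] at h
    simp only [etaTerm, map_smul, h, s, Nat.add_sub_cancel]
    have h3 := fallFact_succ mu p
    push_cast
    rw [h3, map_neg, sub_sub]
    module
  have hsum : ∀ N, T (∑ p ∈ Finset.range N, etaTerm k mu u p) = - s N := by
    intro N
    rw [map_sum, Finset.sum_congr rfl fun p _ => key p, Finset.sum_range_sub']
    simp [s]
  have hwf : ∀ p, IsFormal (w p) := fun p => by
    have h1 : IsFormal (Z u) := (hD ▸ lie_mem hT (dOp_mem k)).1 u hu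
    have h2 := h1.add (hu.smul (-(a * p)))
    rwa [neg_smul, ← sub_eq_add_neg] at h2
  -- `s_{N+1}` contains `D^N`, hence only monomials of total exponent at least `N` in the row
  -- variables. A fixed monomial therefore occurs in no late `s_N`.
  have hs : Conv (fun N => - s N) 0 := by
    intro β
    have hne : ∀ N : ℕ, s (N + 1) β ≠ 0 → ∃ m : ℕ, rowExp k β = N + m := by
      intro N h
      have h1 : (dOp k ^ N) (w N) (β - Pi.single (simpleRoot k) (mu - (N + 1 : ℕ))) ≠ 0 := by
        intro h0
        apply h
        simp only [s, Pi.smul_apply, xPow_apply, Nat.add_sub_cancel, h0, smul_zero]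
      obtain ⟨m, hm⟩ := dOp_pow_rowExp (hwf N) k N _ h1
      exact ⟨m, by rw [← hm, rowExp_sub_simple]⟩
    by_cases hN : ∃ N : ℕ, s (N + 1) β ≠ 0
    · obtain ⟨N, hN⟩ := hN
      obtain ⟨m, hm⟩ := hne N hN
      filter_upwards [Filter.eventually_gt_atTop (N + m + 1)] with M hM
      obtain ⟨M, rfl⟩ : ∃ M', M = M' + 1 := ⟨M - 1, by omega⟩
      rw [Pi.neg_apply, Pi.zero_apply, neg_eq_zero]
      by_contra h
      obtain ⟨m', hm'⟩ := hne M h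
      rw [hm] at hm'
      have : N + m = M + m' := by exact_mod_cast hm'
      omega
    · push Not at hN
      filter_upwards [Filter.eventually_gt_atTop 0] with M hM
      obtain ⟨M, rfl⟩ : ∃ M', M = M' + 1 := ⟨M - 1, by omega⟩
      rw [Pi.neg_apply, Pi.zero_apply, hN, neg_zero]
  have h1 := hT.2 _ _ (conv_etaPow hu k mu)
  simp only [hsum] at h1
  exact h1.unique hs

end EtaPow

/-! ### Singular series -/

section Singular

variable {r : ℕ} (L : Fin (r + 1) → ℂ)

theorem lie_pdOp_simple (a b : Fin (r + 1)) (k : Fin r) (nu : ℂ) :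
    ⁅pdOp a b, xPow (simpleRoot k) nu⁆
      = if a = k.succ ∧ b = k.castSucc then nu • xPow (simpleRoot k) (nu - 1) else 0 :=
  lie_pdOp_xPow _ _ _ _

theorem xOp_simple (k : Fin r) : xOp k.succ k.castSucc = xPow (simpleRoot k) 1 :=
  xOp_of_lt Fin.castSucc_lt_succ

theorem castSucc_ne_succ_self (k : Fin r) : k.castSucc ≠ k.succ := Fin.castSucc_lt_succ.ne

/-- The commutator of `∑ x_{m,b} ∂_{m,c}` with a power of a simple variable. -/
theorem lie_sum_col_simple (b c : Fin (r + 1)) (k : Fin r) (nu : ℂ) :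
    ⁅∑ m, xOp m b * pdOp m c, xPow (simpleRoot k) nu⁆
      = if c = k.castSucc then nu • (xOp k.succ b * xPow (simpleRoot k) (nu - 1)) else 0 := by
  simp only [sum_lie, ring_mul_lie, lie_xOp_xPow, zero_mul, add_zero, lie_pdOp_simple]
  rw [Finset.sum_eq_single k.succ (fun m _ hm => by simp [hm]) (by simp)]
  split_ifs <;> simp_all

theorem lie_sum_row_simple (a b : Fin (r + 1)) (k : Fin r) (nu : ℂ) :
    ⁅∑ m, xOp a m * pdOp b m, xPow (simpleRoot k) nu⁆
      = if b = k.succ then nu • (xOp a k.castSucc * xPow (simpleRoot k) (nu - 1)) else 0 := by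
  simp only [sum_lie, ring_mul_lie, lie_xOp_xPow, zero_mul, add_zero, lie_pdOp_simple]
  rw [Finset.sum_eq_single k.castSucc (fun m _ hm => by simp [hm]) (by simp)]
  split_ifs <;> simp_all

theorem xOp_mul_xPow_simple (k : Fin r) (nu : ℂ) :
    xOp k.succ k.castSucc * xPow (simpleRoot k) (nu - 1) = xPow (simpleRoot k) nu := by
  rw [xOp_simple, xPow_mul_xPow]
  congr 1
  ring

theorem lie_diag_simple (a : Fin (r + 1)) (k : Fin r) (nu : ℂ) :
    ⁅gl L a a, xPow (simpleRoot k) nu⁆ = (nu * ((if a = k.succ then 1 else 0)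
      - (if a = k.castSucc then 1 else 0))) • xPow (simpleRoot k) nu := by
  rw [gl_diag, add_lie, sub_lie, lie_algebraMap, lie_sum_col_simple, lie_sum_row_simple, zero_sub]
  split_ifs with h1 h2 h2
  · exact absurd (h1.symm.trans h2) (castSucc_ne_succ_self k)
  · subst h1
    rw [xOp_mul_xPow_simple]
    module
  · subst h2
    rw [xOp_mul_xPow_simple]
    simp
  · simp

theorem gl_simple_lower (k : Fin r) :
    gl L k.succ k.castSucc = xPow (simpleRoot k) 1 + dOp k := by
  rw [gl_lower L Fin.castSucc_lt_succ, dOp_eq, xOp_simple]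

theorem lie_diag_dOp (a : Fin (r + 1)) (k : Fin r) :
    ⁅gl L a a, dOp k⁆ = ((if a = k.succ then 1 else 0)
      - (if a = k.castSucc then 1 else 0) : ℂ) • dOp k := by
  have h := lie_gl L a a k.succ k.castSucc
  rw [gl_simple_lower, lie_add, lie_diag_simple, one_mul] at h
  rw [← add_right_inj, h]
  have n := castSucc_ne_succ_self k
  by_cases h1 : a = k.succ
  · subst h1
    simp [n, n.symm, gl_simple_lower]
  by_cases h2 : a = k.castSucc
  · subst h2
    simp only [n, if_false, if_true, gl_simple_lower]
    module
  · simp [h1, h2, Ne.symm h2]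

theorem lie_xOp_dOp {m b : Fin (r + 1)} {k : Fin r} (h : k.castSucc ≤ b) :
    ⁅xOp m b, dOp k⁆ = 0 := by
  rw [dOp_eq, lie_sum]
  refine Finset.sum_eq_zero fun c _ => ?_
  rw [ring_lie_mul, lie_xOp_xOp, zero_mul, zero_add, ← lie_skew, lie_pdOp_xOp, if_neg, neg_zero,
    mul_zero]
  rintro ⟨-, rfl, h'⟩
  exact absurd h h'.not_ge

theorem lie_pdOp_dOp {m b : Fin (r + 1)} {k : Fin r} (h : k.castSucc ≤ b ∨ m ≠ k.succ) :
    ⁅pdOp m b, dOp k⁆ = 0 := by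
  rw [dOp_eq, lie_sum]
  refine Finset.sum_eq_zero fun c _ => ?_
  rw [ring_lie_mul, lie_pdOp_pdOp, mul_zero, add_zero, lie_pdOp_xOp]
  split_ifs with h'
  · obtain ⟨h1, rfl, h3⟩ := h'
    rw [pdOp_of_le (h.resolve_right (not_not.mpr h1)), mul_zero]
  · rw [zero_mul]

/-- The `r + 1` numbers `m_a` are the exponents of the `gl(n)`-weight of `f`, shifted by `ρ`. -/
structure IsSingSeries (m : Fin (r + 1) → ℂ) (f : Series r) : Prop where
  formal : IsFormal f
  upper : ∀ k : Fin r, gl L k.castSucc k.succ f = 0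
  weight : ∀ a, gl L a a f = (m a + a.val) • f

/-- The Euler operator of a column. -/
def colEuler (i : Fin (r + 1)) : Module.End ℂ (Series r) := ∑ k, xOp k i * pdOp k i

theorem lie_colEuler_simple (i : Fin (r + 1)) (k : Fin r) (nu : ℂ) :
    ⁅colEuler i, xPow (simpleRoot k) nu⁆
      = if i = k.castSucc then nu • xPow (simpleRoot k) nu else 0 := by
  rw [colEuler, lie_sum_col_simple]
  split_ifs with h
  · rw [h, xOp_mul_xPow_simple]
  · rfl

theorem lie_colEuler_dOp {i : Fin (r + 1)} {k : Fin r} (h : k.castSucc ≤ i) :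
    ⁅colEuler i, dOp k⁆ = 0 := by
  rw [colEuler, sum_lie]
  refine Finset.sum_eq_zero fun m _ => ?_
  rw [ring_mul_lie, lie_xOp_dOp h, lie_pdOp_dOp (Or.inl h), mul_zero, zero_mul, add_zero]

/-- The commutator of `e_k` with a power of `x_{k+1,k}`. -/
theorem lie_upper_simple_same (k : Fin r) (nu : ℂ) :
    ⁅gl L k.castSucc k.succ, xPow (simpleRoot k) nu⁆ = nu • (xPow (simpleRoot k) (nu - 1) *
      (algebraMap ℂ _ (L k.castSucc - L k.succ) - colEuler k.castSucc + colEuler k.succ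
        - xOp k.succ k.castSucc * pdOp k.succ k.castSucc - algebraMap ℂ _ (1 * (nu - 1)))) := by
  have h1 := lie_colEuler_simple k.castSucc k (nu - 1)
  have h2 := lie_colEuler_simple k.succ k (nu - 1)
  rw [if_pos rfl, Ring.lie_def, sub_eq_iff_eq_add] at h1
  rw [if_neg (castSucc_ne_succ_self k).symm, Ring.lie_def, sub_eq_zero] at h2
  have h3 : xPow (simpleRoot k) (nu - 1) * xOp k.succ k.castSucc = xPow (simpleRoot k) nu := by
    rw [xOp_simple, xPow_mul_xPow, sub_add_cancel]
  rw [gl_simple L (by simp), ← colEuler, ← colEuler]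
  simp only [add_lie, sub_lie, ring_mul_lie, lie_algebraMap, lie_colEuler_simple, lie_pdOp_simple,
    lie_sum_col_simple, lie_sum_row_simple, if_true, and_self, xOp_of_le le_rfl, zero_mul, smul_zero,
    add_zero, sub_zero, (castSucc_ne_succ_self k).symm, if_false, mul_smul_comm, h1, h2]
  rw [mul_sub, mul_sub, mul_add, mul_sub, ← mul_assoc, h3, Algebra.commutes, one_mul,
    ← Algebra.commutes (nu - 1), ← Algebra.smul_def, smul_mul_assoc]
  module

/-- Of the terms of `e_l`, only the Euler operator of column `l + 1` fails to commute with this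
variable. The result has the form required by `apply_etaPow_eq_zero`, with `a = 0`. -/
theorem lie_upper_simple_pred {l k : Fin r} (h : k.val = l.val + 1) (nu : ℂ) :
    ⁅gl L l.castSucc l.succ, xPow (simpleRoot k) nu⁆ = nu • (xPow (simpleRoot k) (nu - 1) *
      (xOp k.succ k.castSucc * pdOp k.castSucc l.castSucc - algebraMap ℂ _ (0 * (nu - 1)))) := by
  have e : l.succ = k.castSucc := by ext; simp [h]
  have n1 : l.castSucc ≠ k.castSucc := by rw [Ne, Fin.ext_iff]; simp; omega
  have h3 : xPow (simpleRoot k) (nu - 1) * xOp k.succ k.castSucc = xPow (simpleRoot k) nu := by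
    rw [xOp_simple, xPow_mul_xPow, sub_add_cancel]
  rw [gl_simple L (by simp), ← colEuler, ← colEuler]
  simp only [add_lie, sub_lie, ring_mul_lie, lie_algebraMap, lie_colEuler_simple, lie_pdOp_simple,
    lie_sum_col_simple, lie_sum_row_simple, n1, e, castSucc_ne_succ_self, and_false, if_false, if_true,
    mul_zero, zero_mul, add_zero, sub_zero, zero_add, map_zero, ← mul_assoc, h3, smul_mul_assoc]

theorem lie_upper_simple_of_ne {l k : Fin r} (h : k.val ≠ l.val + 1) (h' : k ≠ l) (nu : ℂ) :
    ⁅gl L l.castSucc l.succ, xPow (simpleRoot k) nu⁆ = 0 := by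
  have n0 : l.succ ≠ k.castSucc := by rw [Ne, Fin.ext_iff]; simp; omega
  have n1 : l.castSucc ≠ k.castSucc := by rw [Ne, Fin.ext_iff]; simp; omega
  have n2 : l.succ ≠ k.succ := by rw [Ne, Fin.ext_iff]; simp; omega
  rw [gl_simple L (by simp), ← colEuler, ← colEuler]
  simp only [add_lie, sub_lie, ring_mul_lie, lie_algebraMap, lie_colEuler_simple, lie_pdOp_simple,
    lie_sum_col_simple, lie_sum_row_simple, n0, n1, n2, and_false, if_false,
    mul_zero, zero_mul, add_zero, sub_zero]

/-- With `f_k = x_{k+1,k} + dOp k`, this gives the commutator of `e_l` with `dOp k` from `[e_l, f_k]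
= δ_{kl} h_k`, without computing it directly. -/
theorem lie_upper_lower (l k : Fin r) : ⁅gl L l.castSucc l.succ, xPow (simpleRoot k) 1⁆
    + ⁅gl L l.castSucc l.succ, dOp k⁆ = if l = k then gl L k.castSucc k.castSucc - gl L k.succ k.succ
      else 0 := by
  rw [← lie_add, ← gl_simple_lower L, lie_gl]
  by_cases h : l = k
  · subst h; simp
  · rw [if_neg (by simpa using h), if_neg (by simpa using Ne.symm h), if_neg h, sub_zero]

variable {L}

/-- There are three cases for `apply_etaPow_eq_zero`: `l = k` is the `sl(2)` case with `P + Z =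
h_k`, while for `k = l + 1` and for the remaining `k` one has `P + Z = 0` and `a = 0`. -/
theorem IsSingSeries.etaPow_upper {m : Fin (r + 1) → ℂ} {f : Series r} (hf : IsSingSeries L m f)
    (k : Fin r) {mu : ℂ} (hmu : mu = m k.castSucc - m k.succ) (l : Fin r) :
    gl L l.castSucc l.succ (etaPow k mu f) = 0 := by
  have hul := lie_upper_lower L l k
  by_cases h : l = k
  · subst h
    have hx := lie_upper_simple_same L l
    set P := algebraMap ℂ (Module.End ℂ (Series r)) (L l.castSucc - L l.succ) - colEuler l.castSucc
      + colEuler l.succ - xOp l.succ l.castSucc * pdOp l.succ l.castSucc with hP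
    have hPD : ⁅P, dOp l⁆ = 0 := by
      rw [hP, sub_lie, add_lie, sub_lie, lie_algebraMap, lie_colEuler_dOp le_rfl,
        lie_colEuler_dOp Fin.castSucc_lt_succ.le, ring_mul_lie, lie_pdOp_dOp (Or.inl le_rfl),
        lie_xOp_dOp le_rfl]
      simp
    have hx1 : ⁅gl L l.castSucc l.succ, xPow (simpleRoot l) 1⁆ = P := by
      rw [hx, sub_self, xPow_zero, mul_zero, map_zero, one_mul, sub_zero, one_smul]
    rw [hx1, if_pos rfl] at hul
    refine apply_etaPow_eq_zero (a := 1) hf.formal (gl_mem _ _ _) hx (eq_sub_of_add_eq' hul) ?_ hPD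
      (hf.upper l) ?_
    · rw [sub_lie, sub_lie, hPD, lie_diag_dOp, lie_diag_dOp]
      simp only [castSucc_ne_succ_self, (castSucc_ne_succ_self _).symm, if_true, if_false]
      module
    -- The shift by `a` in the weights makes `h_k` act on `f` by `m_k - m_{k+1} - 1 = μ - 1`.
    · rw [LinearMap.sub_apply _ P, LinearMap.sub_apply (gl L _ _), add_sub_cancel, hf.weight, hf.weight, hmu,
        ← sub_smul]
      simp only [Fin.val_castSucc, Fin.val_succ]
      push_cast
      congr 1
      ring
  · rw [if_neg h] at hul
    by_cases h1 : k.val = l.val + 1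
    · have hx := lie_upper_simple_pred L h1
      set P : Module.End ℂ (Series r) := xOp k.succ k.castSucc * pdOp k.castSucc l.castSucc with hP
      have hPD : ⁅P, dOp k⁆ = 0 := by
        rw [hP, ring_mul_lie, lie_pdOp_dOp (Or.inr (castSucc_ne_succ_self k)),
          lie_xOp_dOp le_rfl]
        simp
      have hx1 : ⁅gl L l.castSucc l.succ, xPow (simpleRoot k) 1⁆ = P := by
        rw [hx, sub_self, xPow_zero, mul_zero, map_zero, one_mul, sub_zero, one_smul]
      rw [hx1] at hul
      refine apply_etaPow_eq_zero (a := 0) hf.formal (gl_mem _ _ _) hx (eq_sub_of_add_eq' hul) ?_ hPD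
        (hf.upper l) ?_
      · rw [sub_lie, hPD]
        simp
      · simp
    · have hx := lie_upper_simple_of_ne L h1 (Ne.symm h)
      rw [hx, zero_add] at hul
      refine apply_etaPow_eq_zero (a := 0) (P := 0) hf.formal (gl_mem _ _ _)
        (fun nu => by rw [hx]; simp) hul ?_ (by simp) (hf.upper l) ?_ <;> simp

/-- On weights this is the dot action of the simple reflection `s_k`. -/
theorem IsSingSeries.etaPow {m : Fin (r + 1) → ℂ} {f : Series r} (hf : IsSingSeries L m f)
    (k : Fin r) {mu : ℂ} (hmu : mu = m k.castSucc - m k.succ) :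
    IsSingSeries L (m ∘ Equiv.swap k.castSucc k.succ) (SlVerma.etaPow k mu f) := by
  refine ⟨hf.formal.etaPow k mu, hf.etaPow_upper k hmu, fun a => ?_⟩
  set d : ℂ := (if a = k.succ then 1 else 0) - (if a = k.castSucc then 1 else 0) with hd
  have hm : (m ∘ Equiv.swap k.castSucc k.succ) a = m a + mu * d := by
    rw [Function.comp_apply, Equiv.swap_apply_def, hd, hmu]
    split_ifs with h1 h2 h2
    · exact absurd (h1.symm.trans h2) (castSucc_ne_succ_self k)
    · rw [h1]; ring
    · rw [h2]; ring
    · ring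
  have hD : ∀ p : ℕ, gl L a a ((dOp k ^ p) f) = (m a + a.val + p * d) • (dOp k ^ p) f := by
    intro p
    induction p with
    | zero => simp [hf.weight]
    | succ p ih =>
      have h := LinearMap.congr_fun (lie_diag_dOp L a k) ((dOp k ^ p) f)
      rw [Ring.lie_def, LinearMap.sub_apply, Module.End.mul_apply, Module.End.mul_apply, ih,
        sub_eq_iff_eq_add, LinearMap.smul_apply, ← hd, map_smul] at h
      rw [pow_succ', Module.End.mul_apply, h]
      push_cast
      module
  -- Both `x_{k+1,k}` and `dOp k` have the weight of `E_{k+1,k}`, so all terms of the series have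
  -- the same weight.
  have ht : ∀ p, gl L a a (etaTerm k mu f p) = (m a + a.val + mu * d) • etaTerm k mu f p := by
    intro p
    have h := LinearMap.congr_fun (lie_diag_simple L a k (mu - p)) ((dOp k ^ p) f)
    rw [Ring.lie_def, LinearMap.sub_apply, Module.End.mul_apply, Module.End.mul_apply, hD,
      sub_eq_iff_eq_add, LinearMap.smul_apply, ← hd, map_smul] at h
    rw [etaTerm, map_smul, h]
    module
  have hc := conv_etaPow hf.formal k mu
  have h1 := (gl_mem L a a).2 _ _ hc
  simp only [map_sum, ht, ← Finset.smul_sum] at h1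
  have h2 : Conv (fun N => (m a + a.val + mu * d) • ∑ p ∈ Finset.range N, etaTerm k mu f p)
      ((m a + a.val + mu * d) • SlVerma.etaPow k mu f) := fun β => by
    filter_upwards [hc β] with N hN
    rw [Pi.smul_apply, hN, Pi.smul_apply]
  rw [h1.unique h2, hm]
  congr 1
  ring

end Singular

/-! ### Uniqueness of singular series of a given weight -/

section Degree

variable {r : ℕ}

/-- The degree in which a variable counts with the height of its root minus one. -/
def deg (β : NegRoot r → ℂ) : ℂ := ∑ v : NegRoot r, ((v.1.1.val : ℂ) - v.1.2.val - 1) * β v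

theorem deg_sub_single (β : NegRoot r → ℂ) (v : NegRoot r) (c : ℂ) :
    deg (β - Pi.single v c) = deg β - ((v.1.1.val : ℂ) - v.1.2.val - 1) * c := by
  simp [deg, mul_sub, Finset.sum_sub_distrib, Pi.single_apply]

theorem deg_add_single (β : NegRoot r → ℂ) (v : NegRoot r) (c : ℂ) :
    deg (β + Pi.single v c) = deg β + ((v.1.1.val : ℂ) - v.1.2.val - 1) * c := by
  simp [deg, mul_add, Finset.sum_add_distrib, Pi.single_apply]

open Classical in
/-- The homogeneous component of degree `d`. -/
def comp (d : ℂ) : Module.End ℂ (Series r) where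
  toFun f := fun β => if deg β = d then f β else 0
  map_add' f g := by funext β; simp only [Pi.add_apply]; split_ifs <;> simp
  map_smul' c f := by funext β; simp

theorem comp_apply (d : ℂ) (f : Series r) (β : NegRoot r → ℂ) (h : deg β = d) :
    comp d f β = f β := if_pos h

theorem comp_apply_of_ne (d : ℂ) (f : Series r) (β : NegRoot r → ℂ) (h : deg β ≠ d) :
    comp d f β = 0 := if_neg h

theorem comp_mul_xOp (d : ℂ) (i j : Fin (r + 1)) :
    comp d * xOp i j = xOp i j * comp (d - (i.val - j.val - 1)) := by
  rw [xOp]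
  split_ifs with h
  · ext f β
    simp only [Module.End.mul_apply, xPow_apply]
    by_cases hd : deg β = d
    · rw [comp_apply _ _ _ hd, comp_apply, xPow_apply]
      rw [deg_sub_single, hd, mul_one]
    · rw [comp_apply_of_ne _ _ _ hd, comp_apply_of_ne]
      rw [deg_sub_single, mul_one]
      exact fun h' => hd (sub_left_injective h')
  · rw [mul_zero, zero_mul]

theorem comp_mul_pdOp (d : ℂ) (i j : Fin (r + 1)) :
    comp d * pdOp i j = pdOp i j * comp (d + (i.val - j.val - 1)) := by
  rw [pdOp]
  split_ifs with h
  · ext f β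
    simp only [Module.End.mul_apply, pd_apply]
    by_cases hd : deg β = d
    · rw [comp_apply _ _ _ hd, comp_apply, pd_apply]
      rw [deg_add_single, hd, mul_one]
    · rw [comp_apply_of_ne _ _ _ hd, comp_apply_of_ne, mul_zero]
      rw [deg_add_single, mul_one]
      exact fun h' => hd (add_left_injective _ h')
  · rw [mul_zero, zero_mul]

theorem comp_mul_xOp_mul_pdOp (d : ℂ) (i j k l : Fin (r + 1)) :
    comp d * (xOp i j * pdOp k l)
      = xOp i j * pdOp k l * comp (d + ((j.val : ℂ) - i.val + k.val - l.val)) := by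
  rw [← mul_assoc, comp_mul_xOp, mul_assoc, comp_mul_pdOp, mul_assoc]
  congr 3
  ring

/-- The part of lowest degree of the action of a positive root vector. -/
def lowPart (a b : Fin (r + 1)) : Module.End ℂ (Series r) :=
  ∑ m, xOp a m * pdOp b m - ∑ m, xOp m b * pdOp m a

/-- Simple variables have degree zero, so `e_k` is a sum of an operator of degree `0`, whose form
does not matter, and `lowPart`, which lowers the degree by one. -/
theorem comp_mul_gl (L : Fin (r + 1) → ℂ) (d : ℂ) (k : Fin r) :
    ∃ Q : Module.End ℂ (Series r),
      comp d * gl L k.castSucc k.succ = Q * comp d + lowPart k.castSucc k.succ * comp (d + 1) := by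
  refine ⟨algebraMap ℂ _ (L k.castSucc - L k.succ) * pdOp k.succ k.castSucc
    - colEuler k.castSucc * pdOp k.succ k.castSucc + colEuler k.succ * pdOp k.succ k.castSucc, ?_⟩
  have h1 : comp d * pdOp k.succ k.castSucc = pdOp k.succ k.castSucc * comp (r := r) d := by
    rw [comp_mul_pdOp]
    congr 2
    simp
  have h2 : ∀ i, comp d * colEuler i = colEuler i * comp (r := r) d := by
    intro i
    rw [colEuler, Finset.mul_sum, Finset.sum_mul]
    refine Finset.sum_congr rfl fun m _ => ?_
    rw [comp_mul_xOp_mul_pdOp]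
    congr 2
    ring
  have h3 : comp d * lowPart k.castSucc k.succ
      = lowPart k.castSucc k.succ * comp (r := r) (d + 1) := by
    rw [lowPart, mul_sub, sub_mul, Finset.mul_sum, Finset.sum_mul, Finset.mul_sum, Finset.sum_mul]
    congr 1
    · refine Finset.sum_congr rfl fun m _ => ?_
      rw [comp_mul_xOp_mul_pdOp]
      congr 3
      simp
      ring
    · refine Finset.sum_congr rfl fun m _ => ?_
      rw [comp_mul_xOp_mul_pdOp]
      congr 3
      simp
  have h4 : gl L k.castSucc k.succ = algebraMap ℂ _ (L k.castSucc - L k.succ) *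
      pdOp k.succ k.castSucc - colEuler k.castSucc * pdOp k.succ k.castSucc
        + colEuler k.succ * pdOp k.succ k.castSucc + lowPart k.castSucc k.succ := by
    rw [gl_simple L (by simp), lowPart, colEuler, colEuler]
    abel
  rw [h4, mul_add, h3]
  congr 1
  rw [mul_add, mul_sub, add_mul, sub_mul, ← mul_assoc, ← mul_assoc, ← mul_assoc, h2, h2,
    ← Algebra.commutes, mul_assoc, mul_assoc, mul_assoc, h1, ← mul_assoc, ← mul_assoc, ← mul_assoc]

theorem lie_mul_mul_of_weyl {A : Type*} [Ring A] {x d x' d' : A} {p q : Prop} [Decidable p]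
    [Decidable q] (h1 : ⁅d, x'⁆ = if p then 1 else 0) (h2 : ⁅d', x⁆ = if q then 1 else 0)
    (h3 : ⁅d, d'⁆ = 0) (h4 : ⁅x, x'⁆ = 0) :
    ⁅x * d, x' * d'⁆ = (if p then x * d' else 0) - if q then x' * d else 0 := by
  rw [ring_mul_lie, ring_lie_mul, ring_lie_mul, h3, h4, h1, ← lie_skew x d', h2]
  split_ifs <;> noncomm_ring

theorem lie_mul_mul (i j k l i' j' k' l' : Fin (r + 1)) :
    ⁅xOp i j * pdOp k l, xOp i' j' * pdOp k' l'⁆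
      = (if k = i' ∧ l = j' ∧ l < k then xOp i j * pdOp k' l' else 0)
        - if k' = i ∧ l' = j ∧ l' < k' then xOp i' j' * pdOp k l else 0 :=
  lie_mul_mul_of_weyl (lie_pdOp_xOp _ _ _ _) (lie_pdOp_xOp _ _ _ _) (lie_pdOp_pdOp _ _ _ _)
    (lie_xOp_xOp _ _ _ _)

/-- With `x_{i,j}` standing for the class of `E_{i,j}` modulo the upper triangular matrices,
`lowPart a b` is the adjoint action of `E_{a,b}` on this quotient, extended by derivations. Hence it
satisfies the relation of the matrix units. -/
theorem lie_lowPart {a b c : Fin (r + 1)} (hab : a < b) (hbc : b < c) :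
    ⁅lowPart a b, lowPart b c⁆ = lowPart (r := r) a c := by
  have n1 : b ≠ a := hab.ne'
  have n2 : c ≠ a := (hab.trans hbc).ne'
  have n3 : c ≠ b := hbc.ne'
  have e1 : ∀ x y : Fin (r + 1), ⁅xOp a x * pdOp b x, xOp b y * pdOp c y⁆
      = if x = y then xOp a x * pdOp c x else (0 : Module.End ℂ (Series r)) := by
    intro x y
    rw [lie_mul_mul]
    by_cases h : x = y
    · subst h
      by_cases h' : x < b
      · simp [n2, h']
      · simp [n2, h', xOp_of_le (hab.le.trans (not_lt.mp h'))]
    · simp [n2, h]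
  have e2 : ∀ x y : Fin (r + 1), ⁅xOp x b * pdOp x a, xOp y c * pdOp y b⁆
      = - if x = y then xOp x c * pdOp x a else (0 : Module.End ℂ (Series r)) := by
    intro x y
    rw [lie_mul_mul]
    by_cases h : x = y
    · subst h
      by_cases h' : b < x
      · simp [n2.symm, h']
      · simp [n2.symm, h', xOp_of_le ((not_lt.mp h').trans hbc.le)]
    · simp [n2.symm, h, Ne.symm h]
  have e3 : ∀ x y : Fin (r + 1), ⁅xOp a x * pdOp b x, xOp y c * pdOp y b⁆
      = (0 : Module.End ℂ (Series r)) := by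
    intro x y
    rw [lie_mul_mul, if_neg, if_neg, sub_self]
    · rintro ⟨rfl, rfl, h⟩
      exact absurd h hab.not_gt
    · rintro ⟨rfl, rfl, h⟩
      exact absurd h hbc.not_gt
  have e4 : ∀ x y : Fin (r + 1), ⁅xOp x b * pdOp x a, xOp b y * pdOp c y⁆
      = (0 : Module.End ℂ (Series r)) := by
    intro x y
    have h1 : (if x = b ∧ a = y ∧ a < x then xOp x b * pdOp c y else 0 : Module.End ℂ (Series r))
        = 0 := by
      split_ifs with h
      · rw [h.1, xOp_of_le le_rfl, zero_mul]
      · rfl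
    have h2 : (if c = x ∧ y = b ∧ y < c then xOp b y * pdOp x a else 0 : Module.End ℂ (Series r))
        = 0 := by
      split_ifs with h
      · rw [h.2.1, xOp_of_le le_rfl, zero_mul]
      · rfl
    rw [lie_mul_mul, h1, h2, sub_self]
  have hs : ∀ F G : Fin (r + 1) → Module.End ℂ (Series r),
      ⁅∑ x, F x, ∑ y, G y⁆ = ∑ x, ∑ y, ⁅F x, G y⁆ := fun F G => by
    rw [sum_lie]
    exact Finset.sum_congr rfl fun x _ => lie_sum _ _ _
  simp only [lowPart, sub_lie, lie_sub]
  simp only [hs, e1, e2, e3, e4, Finset.sum_const_zero, Finset.sum_ite_eq,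
    Finset.mem_univ, if_true, Finset.sum_neg_distrib]
  abel

theorem lowPart_eq_zero {f : Series r} (hf : ∀ k : Fin r, lowPart k.castSucc k.succ f = 0)
    {a b : Fin (r + 1)} (h : a < b) : lowPart a b f = 0 := by
  obtain ⟨d, hd⟩ : ∃ d, b.val = a.val + 1 + d := ⟨b.val - a.val - 1, by omega⟩
  clear h
  induction d generalizing b with
  | zero =>
    have := hf ⟨a.val, by omega⟩
    have e : (Fin.succ ⟨a.val, by omega⟩ : Fin (r + 1)) = b := by ext; simp [hd]
    rwa [e] at this
  | succ d ih =>
    have h1 := ih (b := ⟨a.val + 1 + d, by omega⟩) rfl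
    have h2 := hf ⟨a.val + 1 + d, by omega⟩
    have e : (Fin.succ ⟨a.val + 1 + d, by omega⟩ : Fin (r + 1)) = b := by ext; simp [hd]; omega
    rw [e] at h2
    rw [← lie_lowPart (b := ⟨a.val + 1 + d, by omega⟩) (by rw [Fin.lt_def]; simp only; omega)
      (by rw [Fin.lt_def]; simp only; omega), Ring.lie_def, LinearMap.sub_apply,
      Module.End.mul_apply, Module.End.mul_apply, h1, map_zero, sub_zero]
    change lowPart _ _ (lowPart (Fin.castSucc ⟨a.val + 1 + d, by omega⟩) b f) = _
    rw [h2, map_zero]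

theorem xOp_injective {i j : Fin (r + 1)} (h : j < i) : Function.Injective (xOp i j : Module.End ℂ (Series r)) := by
  rw [xOp_of_lt h]
  refine Function.LeftInverse.injective (g := xPow (nr h) (-1)) fun f => ?_
  rw [← Module.End.mul_apply, xPow_mul_xPow, neg_add_cancel, xPow_zero, Module.End.one_apply]

/-- Descending induction on the height `b - a`, and for a fixed bound on the height ascending
induction on `a`. -/
theorem pdOp_eq_zero_of_lowPart {f : Series r}
    (hf : ∀ k : Fin r, lowPart k.castSucc k.succ f = 0) {a b : Fin (r + 1)}
    (h : a.val + 2 ≤ b.val) : pdOp b a f = 0 := by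
  suffices H : ∀ d n : ℕ, ∀ a b : Fin (r + 1), a.val + 2 ≤ b.val → r < b.val - a.val + d →
      a.val = n → pdOp b a f = 0 from H (r + 1) _ a b h (by omega) rfl
  intro d
  induction d with
  | zero => intro n a b h1 h2; omega
  | succ d ihd =>
    intro n
    induction n using Nat.strong_induction_on with
    | _ n ihn =>
    intro a b h1 h2 h3
    have hb : (⟨b.val - 1, by omega⟩ : Fin (r + 1)) < b := by rw [Fin.lt_def]; simp only; omega
    -- In `lowPart a (b-1)` the summand `m = b` is `x_{b,b-1} ∂_{b,a}`. The others contain `∂_{m,a}`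
    -- of greater height or `∂_{b-1,m}` with `m < a`, and vanish by induction. Multiplication by
    -- `x_{b,b-1}` is injective.
    have h4 := lowPart_eq_zero hf (a := a) (b := ⟨b.val - 1, by omega⟩)
      (by rw [Fin.lt_def]; simp only; omega)
    rw [lowPart, LinearMap.sub_apply, LinearMap.sum_apply, LinearMap.sum_apply,
      Finset.sum_eq_zero, zero_sub, Finset.sum_eq_single b, neg_eq_zero] at h4
    · exact xOp_injective hb (by rw [map_zero]; exact h4)
    · intro m _ hm
      rw [Module.End.mul_apply]
      by_cases hmb : m.val ≤ b.val - 1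
      · rw [xOp_of_le hmb, LinearMap.zero_apply]
      · have : m.val ≠ b.val := fun h => hm (Fin.ext h)
        rw [ihd _ a m (by omega) (by omega) rfl, map_zero]
    · simp
    · intro m _
      rw [Module.End.mul_apply]
      by_cases hma : a ≤ m
      · rw [xOp_of_le hma, LinearMap.zero_apply]
      · rw [ihn m.val (by omega) m _ _ _ rfl, map_zero]
        · simp only; omega
        · simp only; omega

/-- The exponents of the non-simple variables vanish. -/
def IsPure (β : NegRoot r → ℂ) : Prop := ∀ v : NegRoot r, (∀ k, v ≠ simpleRoot k) → β v = 0

theorem ne_simpleRoot_iff (v : NegRoot r) :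
    (∀ k, v ≠ simpleRoot k) ↔ v.1.2.val + 2 ≤ v.1.1.val := by
  have hv : v.1.2.val < v.1.1.val := v.2
  constructor
  · intro h
    by_contra hc
    refine h ⟨v.1.2.val, by omega⟩ ?_
    ext
    · simp [simpleRoot]; omega
    · simp [simpleRoot]
  · rintro h k rfl
    simp [simpleRoot] at h

theorem IsFormal.deg_eq {f : Series r} (hf : IsFormal f) {β : NegRoot r → ℂ} (h : f β ≠ 0) :
    ∃ N : ℕ, deg β = N := by
  have : ∀ v : NegRoot r, ∃ N : ℕ, ((v.1.1.val : ℂ) - v.1.2.val - 1) * β v = N := by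
    intro v
    by_cases hv : ∀ k, v ≠ simpleRoot k
    · obtain ⟨m, hm⟩ := hf β h v hv
      have h2 := (ne_simpleRoot_iff v).mp hv
      refine ⟨(v.1.1.val - v.1.2.val - 1) * m, ?_⟩
      rw [hm]
      push_cast [Nat.cast_sub (by omega : v.1.2.val ≤ v.1.1.val),
        Nat.cast_sub (by omega : 1 ≤ v.1.1.val - v.1.2.val)]
      ring
    · push Not at hv
      obtain ⟨k, rfl⟩ := hv
      exact ⟨0, by simp [simpleRoot]⟩
  choose N hN using this
  exact ⟨∑ v, N v, by rw [deg, Finset.sum_congr rfl fun v _ => hN v]; push_cast; rfl⟩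

/-- A singular series is determined by its pure coefficients. -/
theorem eq_zero_of_pure (L : Fin (r + 1) → ℂ) {f : Series r} (hf : IsFormal f)
    (hu : ∀ k : Fin r, gl L k.castSucc k.succ f = 0) (hp : ∀ β, IsPure β → f β = 0) : f = 0 := by
  classical
  by_contra hne
  obtain ⟨β, hβ⟩ := Function.ne_iff.mp hne
  have hex : ∃ N : ℕ, ∃ β, f β ≠ 0 ∧ deg β = N := by
    obtain ⟨N, hN⟩ := hf.deg_eq hβ
    exact ⟨N, β, hβ, hN⟩
  obtain ⟨β, hβ, hd⟩ := Nat.find_spec hex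
  set N := Nat.find hex with hN
  -- `N` is the least degree occurring in `f`; degrees are natural numbers since non-simple
  -- exponents are.
  have h1 : comp ((N : ℂ) - 1) f = 0 := by
    funext γ
    by_cases hγ : deg γ = (N : ℂ) - 1
    · rw [comp_apply _ _ _ hγ]
      by_contra hfγ
      obtain ⟨M, hM⟩ := hf.deg_eq hfγ
      have h2 : M + 1 = N := by
        have : (M : ℂ) + 1 = N := by rw [← hM, hγ]; ring
        exact_mod_cast this
      exact Nat.find_min hex (m := M) (by omega) ⟨γ, hfγ, hM⟩
    · exact comp_apply_of_ne _ _ _ hγ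
  have h2 : ∀ k : Fin r, lowPart k.castSucc k.succ (comp N f) = 0 := by
    intro k
    obtain ⟨Q, hQ⟩ := comp_mul_gl L ((N : ℂ) - 1) k
    have h3 := LinearMap.congr_fun hQ f
    rw [LinearMap.add_apply, Module.End.mul_apply, Module.End.mul_apply, Module.End.mul_apply,
      hu, h1, map_zero, map_zero, zero_add, sub_add_cancel] at h3
    exact h3.symm
  -- The component of lowest degree is killed by all non-simple derivatives, so its monomials
  -- involve simple variables only.
  have h3 : IsPure β := by
    intro v hv
    have h4 := pdOp_eq_zero_of_lowPart h2 ((ne_simpleRoot_iff v).mp hv)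
    rw [pdOp_of_lt v.2] at h4
    have h5 := congrFun h4 (β - Pi.single v 1)
    rw [pd_apply, sub_add_cancel, comp_apply _ _ _ hd, Pi.zero_apply] at h5
    simpa using (mul_eq_zero.mp h5).resolve_right hβ
  exact hβ (hp β h3)

/-- The exponent of `x_{i,j}`, zero unless `j < i`. -/
def expo (β : NegRoot r → ℂ) (i j : Fin (r + 1)) : ℂ := if h : j < i then β (nr h) else 0

theorem xOp_mul_pdOp_apply (i j : Fin (r + 1)) (f : Series r) (β : NegRoot r → ℂ) :
    (xOp i j * pdOp i j) f β = expo β i j * f β := by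
  rw [expo]
  split_ifs with h
  · rw [xOp_of_lt h, pdOp_of_lt h, Module.End.mul_apply, xPow_apply, pd_apply, sub_add_cancel]
    simp
  · rw [xOp_of_le (not_lt.mp h)]
    simp

theorem gl_diag_apply (L : Fin (r + 1) → ℂ) (a : Fin (r + 1)) (f : Series r) (β : NegRoot r → ℂ) :
    gl L a a f β = (L a - ∑ k, expo β k a + ∑ k, expo β a k) * f β := by
  rw [gl_diag, LinearMap.add_apply, LinearMap.sub_apply, Pi.add_apply, Pi.sub_apply,
    Module.algebraMap_end_apply, Pi.smul_apply, LinearMap.sum_apply, LinearMap.sum_apply,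
    Finset.sum_apply, Finset.sum_apply]
  simp only [xOp_mul_pdOp_apply, ← Finset.sum_mul, smul_eq_mul]
  ring

theorem expo_of_pure {β : NegRoot r → ℂ} (hβ : IsPure β) {i j : Fin (r + 1)}
    (h : i.val ≠ j.val + 1) : expo β i j = 0 := by
  rw [expo]
  split_ifs with hij
  · exact hβ _ ((ne_simpleRoot_iff _).mpr (by simp only; omega))
  · rfl

/-- The simple roots are linearly independent: position `k` of the weight involves only the
exponents of the `k`-th and the preceding simple variable, which gives a recursion. -/
theorem IsPure.ext_of_weight {β γ : NegRoot r → ℂ} (hβ : IsPure β) (hγ : IsPure γ)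
    (h : ∀ a, - ∑ k, expo β k a + ∑ k, expo β a k = - ∑ k, expo γ k a + ∑ k, expo γ a k) :
    β = γ := by
  have hs : ∀ (n : ℕ) (k : Fin r), k.val = n →
      expo β k.succ k.castSucc = expo γ k.succ k.castSucc := by
    intro n
    induction n with
    | zero =>
      intro k hk
      have h1 := h k.castSucc
      have h2 : ∀ δ : NegRoot r → ℂ, IsPure δ → ∑ m, expo δ m k.castSucc
          = expo δ k.succ k.castSucc := fun δ hδ =>
        Finset.sum_eq_single _ (fun m _ hm => expo_of_pure hδ fun h' => hm (Fin.ext (by simpa using h')))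
          (by simp)
      have h3 : ∀ δ : NegRoot r → ℂ, IsPure δ → ∑ m, expo δ k.castSucc m = 0 := fun δ hδ =>
        Finset.sum_eq_zero fun m _ => expo_of_pure hδ (by simp; omega)
      rw [h2 β hβ, h2 γ hγ, h3 β hβ, h3 γ hγ] at h1
      simpa using h1
    | succ n ih =>
      intro k hk
      have h1 := h k.castSucc
      have h2 : ∀ δ : NegRoot r → ℂ, IsPure δ → ∑ m, expo δ m k.castSucc
          = expo δ k.succ k.castSucc := fun δ hδ =>
        Finset.sum_eq_single _ (fun m _ hm => expo_of_pure hδ fun h' => hm (Fin.ext (by simpa using h')))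
          (by simp)
      have h3 : ∀ δ : NegRoot r → ℂ, IsPure δ → ∑ m, expo δ k.castSucc m
          = expo δ (Fin.succ ⟨n, by omega⟩) (Fin.castSucc ⟨n, by omega⟩) := fun δ hδ => by
        rw [show (Fin.succ ⟨n, by omega⟩ : Fin (r + 1)) = k.castSucc by ext; simp [hk]]
        refine Finset.sum_eq_single _ (fun m _ hm => expo_of_pure hδ fun h' => hm (Fin.ext ?_))
          (by simp)
        simp at h' ⊢
        omega
      rw [h2 β hβ, h2 γ hγ, h3 β hβ, h3 γ hγ, ih ⟨n, by omega⟩ rfl] at h1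
      simpa using h1
  funext v
  by_cases hv : ∀ k, v ≠ simpleRoot k
  · rw [hβ v hv, hγ v hv]
  · push Not at hv
    obtain ⟨k, rfl⟩ := hv
    have := hs _ k rfl
    rwa [expo, expo, dif_pos Fin.castSucc_lt_succ, dif_pos Fin.castSucc_lt_succ] at this

/-- The weight allows only one pure monomial. Subtracting the multiple of `g` that cancels its
coefficient leaves a singular series without pure terms, which is zero by `eq_zero_of_pure`. -/
theorem IsSingSeries.eq_smul {L m : Fin (r + 1) → ℂ} {f g : Series r} (hf : IsSingSeries L m f)
    (hg : IsSingSeries L m g) {β : NegRoot r → ℂ} (hβ : IsPure β) (h : g β ≠ 0) :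
    f = (f β / g β) • g := by
  set c := f β / g β with hc
  have hw : ∀ (u : Series r) (γ : NegRoot r → ℂ), (∀ a, gl L a a u = (m a + a.val) • u) → u γ ≠ 0 →
      ∀ a, - ∑ k, expo γ k a + ∑ k, expo γ a k = m a + a.val - L a := by
    intro u γ hu huγ a
    have h1 := congrFun (hu a) γ
    rw [gl_diag_apply, Pi.smul_apply, smul_eq_mul] at h1
    rw [← mul_right_cancel₀ huγ h1]
    ring
  have h0 : f + (-c) • g = 0 := by
    refine eq_zero_of_pure L (hf.formal.add (hg.formal.smul _)) (fun k => ?_) fun γ hγ => ?_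
    · rw [map_add, map_smul, hf.upper, hg.upper, smul_zero, add_zero]
    · by_contra hne
      have h1 : ∀ a, gl L a a (f + (-c) • g) = (m a + a.val) • (f + (-c) • g) := fun a => by
        rw [map_add, map_smul, hf.weight, hg.weight]
        module
      have h2 : γ = β := hγ.ext_of_weight hβ fun a => by
        rw [hw _ γ h1 hne a, hw g β hg.weight h a]
      apply hne
      rw [h2, Pi.add_apply, Pi.smul_apply, hc, smul_eq_mul]
      field_simp
      ring
  rw [neg_smul, ← sub_eq_add_neg, sub_eq_zero] at h0
  exact h0

/-- The pure coefficient of `η_k^μ f` is that of `f`. -/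
theorem etaPow_pure {f : Series r} (hf : IsFormal f) {β : NegRoot r → ℂ} (hβ : IsPure β) (k : Fin r)
    (mu : ℂ) : IsPure (β + Pi.single (simpleRoot k) mu) ∧
      etaPow k mu f (β + Pi.single (simpleRoot k) mu) = f β := by
  have hp : IsPure (β + Pi.single (simpleRoot k) mu) := fun v hv => by
    rw [Pi.add_apply, hβ v hv, Pi.single_eq_of_ne (hv k), add_zero]
  refine ⟨hp, ?_⟩
  rw [etaPow, finsum_eq_single _ 0]
  · simp [fallFact, xPow_apply]
  · intro p hpne
    by_contra h
    obtain ⟨m, hm⟩ := dOp_pow_rowExp hf k p _ (right_ne_zero_of_mul h)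
    rw [rowExp_sub_simple, rowExp, Finset.sum_eq_zero] at hm
    · have : (0 : ℕ) = p + m := by exact_mod_cast hm
      omega
    · exact fun j _ => hp _ fun l => nr_ne_simple k l j.2

end Degree

/-! ### Central elements -/

section Center

variable {A ι : Type*} [Ring A] [Fintype ι] [DecidableEq ι] (g : ι → ι → A)

/-- The entries of the powers of the matrix `g` over a noncommutative ring. -/
def matPow : ℕ → ι → ι → A
  | 0, i, j => if i = j then 1 else 0
  | t + 1, i, j => ∑ l, g i l * matPow t l j

/-- The entries of every power of `g` transform under `g` like the matrix units themselves; in the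
product rule the two terms from the inner index cancel. -/
theorem lie_matPow (hg : ∀ i j k l, ⁅g i j, g k l⁆
      = (if j = k then g i l else 0) - (if l = i then g k j else 0)) (t : ℕ) (a b c d : ι) :
    ⁅g a b, matPow g t c d⁆
      = (if b = c then matPow g t a d else 0) - (if d = a then matPow g t c b else 0) := by
  induction t generalizing a b c d with
  | zero =>
    have h : ⁅g a b, matPow g 0 c d⁆ = 0 := by
      rw [matPow, Ring.lie_def]
      split_ifs <;> simp
    rw [h]
    simp only [matPow]
    by_cases h1 : b = c <;> by_cases h2 : a = d <;>
      simp [h1, h2, eq_comm (a := d), eq_comm (a := c)]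
  | succ t ih =>
    have h : ∀ l, ⁅g a b, g c l * matPow g t l d⁆
        = ((if b = c then g a l * matPow g t l d else 0)
            - (if d = a then g c l * matPow g t l b else 0))
          + ((if l = b then g c l * matPow g t a d else 0)
            - if l = a then g c b * matPow g t l d else 0) := by
      intro l
      rw [ring_lie_mul, hg, ih, sub_mul, mul_sub, ite_mul, ite_mul, mul_ite, mul_ite, zero_mul,
        mul_zero]
      simp only [eq_comm (a := b) (b := l)]
      abel
    rw [matPow, lie_sum, Finset.sum_congr rfl fun l _ => h l]
    simp only [Finset.sum_add_distrib, Finset.sum_sub_distrib, Finset.sum_ite_eq', Finset.mem_univ,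
      if_true, sub_self, add_zero]
    congr 1 <;> split_ifs <;> simp [matPow]

/-- The traces of the powers are central. -/
theorem lie_trace_matPow (hg : ∀ i j k l, ⁅g i j, g k l⁆
      = (if j = k then g i l else 0) - (if l = i then g k j else 0)) (t : ℕ) (a b : ι) :
    ⁅g a b, ∑ i, matPow g t i i⁆ = 0 := by
  simp [lie_sum, lie_matPow g hg, Finset.sum_sub_distrib]

end Center

/-! ### The central characters -/

section Character

variable {r : ℕ}

/-- The eigenvalues of the diagonal entries of the matrix powers on a singular vector. -/
def diagVal (m : Fin (r + 1) → ℂ) : ℕ → Fin (r + 1) → ℂ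
  | 0, _ => 1
  | t + 1, i => (m i + r) * diagVal m t i - ∑ l with i < l, diagVal m t l

theorem matPow_upper_apply {L : Fin (r + 1) → ℂ} {f : Series r}
    (hf : ∀ a b, a < b → gl L a b f = 0) (t : ℕ) (i j : Fin (r + 1)) (h : i < j) :
    matPow (gl L) t i j f = 0 := by
  induction t generalizing i j with
  | zero => simp [matPow, h.ne]
  | succ t ih =>
    rw [matPow, LinearMap.sum_apply]
    refine Finset.sum_eq_zero fun l _ => ?_
    rw [Module.End.mul_apply]
    by_cases hl : l < j
    · rw [ih l j hl, map_zero]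
    -- For `l ≥ j > i` the factor `g_{il}` kills `f`, so the product equals its commutator, which is
    -- the entry `(i, j)` of the lower power.
    · have h1 := LinearMap.congr_fun (lie_matPow (gl L) (lie_gl L) t i l l j) f
      rw [if_pos rfl, if_neg h.ne', sub_zero, ih i j h, Ring.lie_def, LinearMap.sub_apply,
        Module.End.mul_apply, Module.End.mul_apply, hf i l (h.trans_le (not_lt.mp hl)), map_zero,
        sub_zero] at h1
      exact h1

theorem matPow_diag_apply {L m : Fin (r + 1) → ℂ} {f : Series r}
    (hf : ∀ a b, a < b → gl L a b f = 0) (hw : ∀ a, gl L a a f = (m a + a.val) • f) (t : ℕ)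
    (i : Fin (r + 1)) : matPow (gl L) t i i f = diagVal m t i • f := by
  induction t generalizing i with
  | zero => simp [matPow, diagVal]
  | succ t ih =>
    have h : ∀ l, (gl L i l * matPow (gl L) t l i) f
        = (if l = i then ((m i + i.val) * diagVal m t i) • f else 0)
          + if i < l then (diagVal m t i - diagVal m t l) • f else 0 := by
      intro l
      rw [Module.End.mul_apply]
      rcases lt_trichotomy l i with hl | rfl | hl
      · rw [matPow_upper_apply hf t l i hl, map_zero, if_neg hl.ne, if_neg hl.not_gt, add_zero]
      · rw [ih, map_smul, hw, if_pos rfl, if_neg (lt_irrefl _), add_zero, smul_smul, mul_comm]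
      · have h1 := LinearMap.congr_fun (lie_matPow (gl L) (lie_gl L) t i l l i) f
        rw [if_pos rfl, if_pos rfl, Ring.lie_def, LinearMap.sub_apply, LinearMap.sub_apply,
          Module.End.mul_apply, Module.End.mul_apply, hf i l hl, map_zero, sub_zero, ih, ih] at h1
        rw [h1, if_neg hl.ne', if_pos hl, zero_add, sub_smul]
    -- Each of the `r - i` indices `l > i` contributes one more `diagVal m t i`, which turns `m_i +
    -- i` into `m_i + r`.
    have hc : ((Finset.univ.filter fun l => i < l).card : ℂ) = r - i.val := by
      have h1 : (Finset.univ.filter fun l => i < l) = Finset.Ioi i := by ext; simp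
      rw [h1, Fin.card_Ioi, show r + 1 - 1 - i.val = r - i.val by omega,
        Nat.cast_sub (by omega)]
    rw [matPow, LinearMap.sum_apply, Finset.sum_congr rfl fun l _ => h l, Finset.sum_add_distrib,
      Finset.sum_ite_eq', if_pos (Finset.mem_univ _), ← Finset.sum_filter, ← Finset.sum_smul,
      Finset.sum_sub_distrib, Finset.sum_const, nsmul_eq_mul, hc, ← add_smul, diagVal]
    congr 1
    ring

/-- Singular vectors of the Verma module have the central character of the highest weight. -/
theorem sum_diagVal_eq {lam : Fin r → ℂ} {m m' : Fin (r + 1) → ℂ} {u : Verma lam} (hu : u ≠ 0)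
    (hm' : ∀ a, glWt lam a = m' a + a.val)
    (hf : ∀ k : Fin r, gl (glWt lam) k.castSucc k.succ (realize lam u) = 0)
    (hw : ∀ a, gl (glWt lam) a a (realize lam u) = (m a + a.val) • realize lam u) (t : ℕ) :
    ∑ i, diagVal m t i = ∑ i, diagVal m' t i := by
  set L := glWt lam with hL
  obtain ⟨a, rfl⟩ := Submodule.Quotient.mk_surjective _ u
  have hmk : (Submodule.Quotient.mk a : Verma lam) = a • hwVec lam := by
    rw [hwVec, ← Submodule.Quotient.mk_smul, smul_eq_mul, mul_one]
  set f := realize lam (Submodule.Quotient.mk a) with hfdef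
  have hf0 : f ≠ 0 := fun h => hu (realize_injective lam (h.trans (map_zero _).symm))
  let z : Module.End ℂ (Series r) := ∑ i, matPow (gl L) t i i
  have hcomm : ∀ x : USl r, act L x * z = z * act L x := by
    intro x
    have : x ∈ (Subalgebra.centralizer ℂ {z}).comap (act L) := by
      refine subalgebra_eq_top _ (fun y => ?_) x
      rw [Subalgebra.mem_comap, Subalgebra.mem_centralizer_iff]
      rintro _ rfl
      rw [act, UniversalEnvelopingAlgebra.lift_ι_apply, glHom_apply, glLin_apply]
      rw [Finset.mul_sum, Finset.sum_mul]
      refine Finset.sum_congr rfl fun i _ => ?_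
      rw [Finset.mul_sum, Finset.sum_mul]
      refine Finset.sum_congr rfl fun j _ => ?_
      have h := lie_trace_matPow (gl L) (lie_gl L) t i j
      rw [Ring.lie_def, sub_eq_zero] at h
      rw [mul_smul_comm, smul_mul_assoc, h]
    rw [Subalgebra.mem_comap, Subalgebra.mem_centralizer_iff] at this
    exact (this z rfl).symm
  have h1 : z f = (∑ i, diagVal m t i) • f := by
    rw [LinearMap.sum_apply, Finset.sum_smul]
    exact Finset.sum_congr rfl fun i _ =>
      matPow_diag_apply (fun a b => gl_upper_apply_eq_zero L hf) hw t i
  have h2 : z (vac r) = (∑ i, diagVal m' t i) • vac r := by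
    rw [LinearMap.sum_apply, Finset.sum_smul]
    exact Finset.sum_congr rfl fun i _ =>
      matPow_diag_apply (fun a b => gl_upper_vac L) (fun a => by rw [gl_diag_vac, hm']) t i
  -- `u` is obtained from `v_λ` by an element of `U(sl(n))`, which commutes with `z`, so `z` has the
  -- same eigenvalue on both.
  have h3 : z f = (∑ i, diagVal m' t i) • f := by
    rw [hfdef, hmk, realize_smul, realize_hwVec, ← Module.End.mul_apply, ← hcomm,
      Module.End.mul_apply, h2, map_smul]
  exact smul_left_injective ℂ hf0 (h1.symm.trans h3)

-- The recursion of `diagVal` says `(1 - (m_i + r) X) Y_i = 1 - X ∑_{l>i} Y_l` for the generating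
-- series `Y_i`. Adding the indices one at a time from the last, each step multiplies by one
-- quotient `(1 - (m_i+r+1)X) / (1 - (m_i+r)X)`.
open PowerSeries in
theorem prod_one_sub (m : Fin (r + 1) → ℂ) :
    (1 - X * PowerSeries.mk fun t => ∑ i, diagVal m t i) * ∏ i, (1 - C (m i + r) * X)
      = ∏ i, (1 - C (m i + r + 1) * X) := by
  let Y : Fin (r + 1) → PowerSeries ℂ := fun i => PowerSeries.mk fun t => diagVal m t i
  have hY : ∀ i, (1 - C (m i + r) * X) * Y i = 1 - X * ∑ l with i < l, Y l := by
    intro i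
    ext t
    rcases t with _ | t
    · simp [sub_mul, mul_assoc, Y, diagVal, coeff_zero_eq_constantCoeff]
    · rw [sub_mul, mul_assoc, one_mul, map_sub, map_sub, coeff_C_mul, coeff_succ_X_mul,
        coeff_succ_X_mul, map_sum]
      simp [Y, diagVal, coeff_one]
  have key : ∀ n, n ≤ r + 1 →
      (1 - X * ∑ l with r < l.val + n, Y l) * ∏ l with r < l.val + n, (1 - C (m l + r) * X)
        = ∏ l with r < l.val + n, (1 - C (m l + r + 1) * X) := by
    intro n
    induction n with
    | zero =>
      intro _
      rw [Finset.filter_false_of_mem (fun l _ => by omega)]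
      simp
    | succ n ih =>
      intro hn
      have hc : (Finset.univ.filter fun l : Fin (r + 1) => r < l.val + (n + 1))
          = insert ⟨r - n, by omega⟩ (Finset.univ.filter fun l : Fin (r + 1) => r < l.val + n) := by
        ext l
        simp only [Finset.mem_filter, Finset.mem_univ, true_and, Finset.mem_insert, Fin.ext_iff]
        omega
      have hni : (⟨r - n, by omega⟩ : Fin (r + 1)) ∉
          Finset.univ.filter fun l : Fin (r + 1) => r < l.val + n := by
        simp only [Finset.mem_filter, Finset.mem_univ, true_and]
        omega
      have hfil : (Finset.univ.filter fun l : Fin (r + 1) => (⟨r - n, by omega⟩ : Fin (r + 1)) < l)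
          = Finset.univ.filter fun l : Fin (r + 1) => r < l.val + n := by
        ext l
        simp only [Finset.mem_filter, Finset.mem_univ, true_and, Fin.lt_def]
        omega
      have h1 := hY ⟨r - n, by omega⟩
      rw [hfil] at h1
      rw [hc, Finset.sum_insert hni, Finset.prod_insert hni, Finset.prod_insert hni,
        ← ih (by omega)]
      set S := ∑ l with r < l.val + n, Y l
      set c := m ⟨r - n, by omega⟩ + (r : ℂ)
      have h2 : (C (c + 1) : PowerSeries ℂ) = C c + 1 := by rw [map_add, map_one]
      rw [h2]
      linear_combination (-X * ∏ l with r < l.val + n, (1 - C (m l + r) * X)) * h1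
  have h := key (r + 1) le_rfl
  have hu : (Finset.univ.filter fun l : Fin (r + 1) => r < l.val + (r + 1)) = Finset.univ :=
    Finset.filter_true_of_mem fun l _ => by omega
  rw [hu] at h
  rw [← h]
  congr 3
  ext t
  simp [Y]

open Polynomial in
/-- A multiset of numbers is determined by its size and the polynomial `∏ (1 - a X)`. -/
theorem multiset_eq_of_prod_one_sub {M M' : Multiset ℂ} (hc : M.card = M'.card)
    (h : (M.map fun a => (1 - C a * X : ℂ[X])).prod = (M'.map fun a => (1 - C a * X : ℂ[X])).prod) :
    M = M' := by
  -- Reversing coefficients gives the monic polynomial with roots in `M`. The reversal must use the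
  -- size of `M`, because a root `0` lowers the degree of `∏ (1 - a X)`.
  have hp : ∀ M : Multiset ℂ, (M.map fun a => (1 - C a * X : ℂ[X])).prod
      = (M.map fun a => (X - C a : ℂ[X])).prod.reflect M.card := by
    intro M
    induction M using Multiset.induction with
    | empty => simp
    | cons a M ih =>
      have hr : (X - C a : ℂ[X]).reflect 1 = 1 - C a * X := by
        rw [reflect_sub, reflect_one_X, reflect_C, pow_one]
      rw [Multiset.map_cons, Multiset.prod_cons, Multiset.map_cons, Multiset.prod_cons,
        Multiset.card_cons, add_comm, reflect_mul _ _ (natDegree_X_sub_C a).le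
          (natDegree_multiset_prod_X_sub_C_eq_card M).le, hr, ih]
  have h1 : (M.map fun a => (X - C a : ℂ[X])).prod = (M'.map fun a => (X - C a : ℂ[X])).prod := by
    rw [hp, hp, hc] at h
    have h2 := congrArg (reflect M'.card) h
    rwa [reflect_reflect, reflect_reflect] at h2
  rw [← roots_multiset_prod_X_sub_C M, h1, roots_multiset_prod_X_sub_C]

/-- The difference of the multiplicity functions is invariant under translation by `1` and has
finite support, so it is zero. -/
theorem multiset_eq_of_add_map_succ {M M' : Multiset ℂ}
    (h : M + M'.map (· + 1) = M' + M.map (· + 1)) : M = M' := by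
  classical
  have hinj : Function.Injective fun x : ℂ => x + 1 := add_left_injective 1
  have hcount : ∀ (N : Multiset ℂ) (x : ℂ), (N.map (· + 1)).count x = N.count (x - 1) := by
    intro N x
    have := Multiset.count_map_eq_count' _ N hinj (x - 1)
    simpa using this
  have hstep : ∀ x, (M.count x : ℤ) - M'.count x = M.count (x - 1) - M'.count (x - 1) := by
    intro x
    have h1 := congrArg (Multiset.count x) h
    rw [Multiset.count_add, Multiset.count_add, hcount, hcount] at h1
    omega
  have hn : ∀ (x : ℂ) (n : ℕ), (M.count x : ℤ) - M'.count x = M.count (x - n) - M'.count (x - n) := by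
    intro x n
    induction n with
    | zero => simp
    | succ n ih => rw [ih, hstep (x - n)]; push_cast; rw [sub_sub]
  ext x
  obtain ⟨n, hnM⟩ : ∃ n : ℕ, x - n ∉ (M + M').toFinset := by
    by_contra hc
    push Not at hc
    have hi : Function.Injective fun n : ℕ => x - (n : ℂ) := fun a b hab => by
      have : (a : ℂ) = b := by simpa using hab
      exact_mod_cast this
    exact Set.infinite_of_injective_forall_mem hi hc (Finset.finite_toSet _)
  rw [Multiset.mem_toFinset, Multiset.mem_add, not_or] at hnM
  have h1 := hn x n
  rw [Multiset.count_eq_zero_of_notMem hnM.1, Multiset.count_eq_zero_of_notMem hnM.2] at h1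
  omega

/-- This is the part of Harish-Chandra's theorem needed here. Eliminating the common trace series
from `prod_one_sub` for `m` and `m'` leaves an identity of products of linear polynomials, hence of
multisets. -/
theorem multiset_eq_of_sum_diagVal {m m' : Fin (r + 1) → ℂ}
    (h : ∀ t, ∑ i, diagVal m t i = ∑ i, diagVal m' t i) :
    Finset.univ.val.map m = Finset.univ.val.map m' := by
  have h1 := prod_one_sub m
  have h2 := prod_one_sub m'
  simp only [h] at h1
  have h3 : (∏ i, (1 - PowerSeries.C (m i + r) * PowerSeries.X))
        * ∏ i, (1 - PowerSeries.C (m' i + r + 1) * PowerSeries.X)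
      = (∏ i, (1 - PowerSeries.C (m' i + r) * PowerSeries.X))
        * ∏ i, (1 - PowerSeries.C (m i + r + 1) * PowerSeries.X) := by
    rw [← h1, ← h2]
    ring
  have h4 : ∀ c : Fin (r + 1) → ℂ, (∏ i, (1 - PowerSeries.C (c i) * PowerSeries.X))
      = (((Finset.univ.val.map c).map fun a =>
        (1 - Polynomial.C a * Polynomial.X : Polynomial ℂ)).prod : PowerSeries ℂ) := by
    intro c
    rw [Multiset.map_map]
    change _ = ((∏ i, (1 - Polynomial.C (c i) * Polynomial.X : Polynomial ℂ) : Polynomial ℂ)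
      : PowerSeries ℂ)
    rw [← Polynomial.coeToPowerSeries.ringHom_apply, map_prod]
    refine Finset.prod_congr rfl fun i _ => ?_
    simp
  rw [h4 fun i => m i + r, h4 fun i => m' i + r + 1, h4 fun i => m' i + r,
    h4 fun i => m i + r + 1, ← Polynomial.coe_mul, ← Polynomial.coe_mul, Polynomial.coe_inj,
    ← Multiset.prod_add, ← Multiset.prod_add, ← Multiset.map_add, ← Multiset.map_add] at h3
  have h5 := multiset_eq_of_prod_one_sub (by simp) h3
  have h6 : ∀ c : Fin (r + 1) → ℂ, Finset.univ.val.map (fun i => c i + r + 1)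
      = (Finset.univ.val.map fun i => c i + r).map (· + 1) := fun c => by
    rw [Multiset.map_map]; rfl
  rw [h6, h6] at h5
  have h7 := multiset_eq_of_add_map_succ h5
  have h8 : ∀ c : Fin (r + 1) → ℂ, Finset.univ.val.map (fun i => c i + (r : ℂ))
      = (Finset.univ.val.map c).map (· + (r : ℂ)) := fun c => by
    rw [Multiset.map_map]; rfl
  rw [h8, h8] at h7
  exact Multiset.map_injective (add_left_injective _) h7

end Character

/-! ### The weights of the series -/

section Combinatorics

/-- The cycle which moves the entry at position `i - 1` to position `p`; the identity if `i = 0` or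
`i > p`. -/
def stepPerm : ℕ → ℕ → Equiv.Perm ℕ
  | 0, _ => 1
  | p + 1, i => if 1 ≤ i ∧ i ≤ p + 1 then stepPerm p i * Equiv.swap p (p + 1) else 1

theorem stepPerm_zero (p : ℕ) : stepPerm p 0 = 1 := by
  cases p <;> simp [stepPerm]

theorem stepPerm_of_lt {p i : ℕ} (h : p < i) : stepPerm p i = 1 := by
  cases p with
  | zero => rfl
  | succ p => rw [stepPerm, if_neg (by omega)]

theorem stepPerm_succ {p i : ℕ} (h1 : 1 ≤ i) (h2 : i ≤ p + 1) :
    stepPerm (p + 1) i = stepPerm p i * Equiv.swap p (p + 1) := by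
  rw [stepPerm, if_pos ⟨h1, h2⟩]

theorem stepPerm_apply {p i : ℕ} (h1 : 1 ≤ i) (h2 : i ≤ p + 1) (j : ℕ) :
    stepPerm p i j = if j + 1 < i then j else if j < p then j + 1 else if j = p then i - 1 else j := by
  induction p generalizing j with
  | zero =>
    rw [stepPerm, Equiv.Perm.one_apply]
    split_ifs <;> omega
  | succ p ih =>
    rcases eq_or_lt_of_le h2 with rfl | h3
    · rw [stepPerm_of_lt (by omega), Equiv.Perm.one_apply]
      split_ifs <;> omega
    · rw [stepPerm_succ h1 (by omega), Equiv.Perm.mul_apply, Equiv.swap_apply_def, ih (by omega)]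
      split_ifs <;> omega

theorem stepPerm_fix (p i : ℕ) {j : ℕ} (h : p < j) : stepPerm p i j = j := by
  rcases Nat.eq_zero_or_pos i with rfl | hi
  · rw [stepPerm_zero, Equiv.Perm.one_apply]
  · by_cases hp : i ≤ p
    · rw [stepPerm_apply hi (by omega)]
      split_ifs <;> omega
    · rw [stepPerm_of_lt (by omega), Equiv.Perm.one_apply]

theorem stepPerm_top {p i : ℕ} (h : i ≤ p) : stepPerm p i p = if i = 0 then p else i - 1 := by
  rcases Nat.eq_zero_or_pos i with rfl | hi
  · rw [stepPerm_zero, if_pos rfl, Equiv.Perm.one_apply]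
  · rw [stepPerm_apply hi (by omega)]
    split_ifs <;> omega

/-- The composition of the cycles with numbers `p, …, 1`. -/
def finalPerm (c : ℕ → ℕ) : ℕ → Equiv.Perm ℕ
  | 0 => 1
  | p + 1 => stepPerm (p + 1) (c p) * finalPerm c p

theorem finalPerm_fix (c : ℕ → ℕ) (p : ℕ) {j : ℕ} (h : p < j) : finalPerm c p j = j := by
  induction p with
  | zero => rfl
  | succ p ih => rw [finalPerm, Equiv.Perm.mul_apply, ih (by omega), stepPerm_fix _ _ h]

theorem finalPerm_congr {c c' : ℕ → ℕ} {p : ℕ} (h : ∀ q < p, c q = c' q) :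
    finalPerm c p = finalPerm c' p := by
  induction p with
  | zero => rfl
  | succ p ih => rw [finalPerm, finalPerm, ih fun q hq => h q (by omega), h p (by omega)]

/-- The cycles `stepPerm (p + 1) i` represent the cosets of the stabilizer of `p + 1`: choose `i`
according to `σ (p + 1)`, divide by the cycle and apply induction. -/
theorem exists_finalPerm (p : ℕ) (σ : Equiv.Perm ℕ) (h : ∀ j, p < j → σ j = j) :
    ∃ c : ℕ → ℕ, (∀ q, c q ≤ q + 1) ∧ finalPerm c p = σ := by
  induction p generalizing σ with
  | zero =>
    refine ⟨0, fun q => Nat.zero_le _, Equiv.ext fun j => ?_⟩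
    rw [finalPerm, Equiv.Perm.one_apply]
    rcases Nat.eq_zero_or_pos j with rfl | hj
    · by_contra h0
      exact h0 (σ.injective (h _ (Nat.pos_of_ne_zero (Ne.symm h0)))).symm
    · exact (h j hj).symm
  | succ p ih =>
    have ha : σ (p + 1) ≤ p + 1 := by
      by_contra hc
      have := σ.injective (h _ (not_le.mp hc))
      omega
    -- For `i ≥ 1` the cycle sends `p + 1` to `i - 1 ≤ p`; the value `p + 1` itself is obtained with
    -- `i = 0`.
    obtain ⟨i, hi, hs⟩ : ∃ i ≤ p + 1, stepPerm (p + 1) i (p + 1) = σ (p + 1) := by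
      by_cases h0 : σ (p + 1) = p + 1
      · exact ⟨0, Nat.zero_le _, by rw [stepPerm_top (Nat.zero_le _), if_pos rfl, h0]⟩
      · exact ⟨σ (p + 1) + 1, by omega, by
          rw [stepPerm_top (by omega), if_neg (by omega), Nat.add_sub_cancel]⟩
    obtain ⟨c, hc, hcp⟩ := ih ((stepPerm (p + 1) i)⁻¹ * σ) fun j hj => by
      rw [Equiv.Perm.mul_apply, Equiv.Perm.inv_eq_iff_eq]
      rcases eq_or_lt_of_le (Nat.succ_le_of_lt hj) with rfl | hj
      · exact hs.symm
      · rw [h j hj, stepPerm_fix _ _ hj]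
    refine ⟨Function.update c p i, fun q => ?_, ?_⟩
    · by_cases hq : q = p
      · subst hq; simpa using hi
      · simpa [hq] using hc q
    · rw [finalPerm, finalPerm_congr (c' := c) fun q hq => by simp [hq.ne], hcp,
        Function.update_self, mul_inv_cancel_left]

theorem finalPerm_injective {c c' : ℕ → ℕ} (hc : ∀ q, c q ≤ q + 1) (hc' : ∀ q, c' q ≤ q + 1)
    {p : ℕ} (h : finalPerm c p = finalPerm c' p) : ∀ q < p, c q = c' q := by
  induction p with
  | zero => intro q hq; omega
  | succ p ih =>
    have h1 := Equiv.congr_fun h (p + 1)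
    rw [finalPerm, finalPerm, Equiv.Perm.mul_apply, Equiv.Perm.mul_apply,
      finalPerm_fix _ _ (Nat.lt_succ_self p), finalPerm_fix _ _ (Nat.lt_succ_self p),
      stepPerm_top (hc p), stepPerm_top (hc' p)] at h1
    have h2 : c p = c' p := by
      have := hc p
      have := hc' p
      split_ifs at h1 <;> omega
    rw [finalPerm, finalPerm, h2, mul_right_inj] at h
    intro q hq
    rcases eq_or_lt_of_le (Nat.le_of_lt_succ hq) with rfl | hq
    · exact h2
    · exact ih h q hq

end Combinatorics

section Theta

variable {r : ℕ}

theorem filter_finRange_succ {i p : ℕ} (hp : p < r) (hi : i ≤ p + 1) :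
    ((List.finRange r).filter fun k => i ≤ k.val + 1 ∧ k.val + 1 ≤ p + 1)
      = ((List.finRange r).filter fun k => i ≤ k.val + 1 ∧ k.val + 1 ≤ p) ++ [⟨p, hp⟩] := by
  have hs := List.pairwise_lt_finRange r
  refine List.Perm.eq_of_pairwise (le := (· < ·)) (fun a b _ _ h1 h2 => absurd h1 h2.asymm)
    (hs.filter _) ?_ ?_
  · rw [List.pairwise_append]
    refine ⟨hs.filter _, List.pairwise_singleton _ _, fun a ha b hb => ?_⟩
    rw [List.mem_singleton] at hb
    rw [List.mem_filter, decide_eq_true_iff] at ha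
    rw [hb, Fin.lt_def]
    simp only
    omega
  · rw [List.perm_ext_iff_of_nodup ((List.nodup_finRange r).filter _)]
    · intro a
      simp only [List.mem_filter, List.mem_finRange, true_and, decide_eq_true_iff, List.mem_append,
        List.mem_singleton, Fin.ext_iff]
      omega
    · rw [List.nodup_append]
      refine ⟨(List.nodup_finRange r).filter _, List.nodup_singleton _, fun a ha b hb => ?_⟩
      rw [List.mem_singleton] at hb
      rw [List.mem_filter, decide_eq_true_iff] at ha
      rw [hb]
      rintro rfl
      simp only at ha
      omega

theorem block_of_lt {p i : ℕ} (h : p < i) (nu : ℕ → ℂ) (f : Series r) : block p nu i f = f := by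
  rw [block, if_neg (by omega), List.filter_eq_nil_iff.mpr, List.foldl_nil]
  intro a _
  rw [decide_eq_true_iff]
  omega

theorem block_succ {p i : ℕ} (hp : p < r) (h1 : 1 ≤ i) (h2 : i ≤ p + 1) (nu : ℕ → ℂ)
    (f : Series r) : block (p + 1) nu i f
      = etaPow ⟨p, hp⟩ (∑ q ∈ Finset.Icc i (p + 1), (nu q + 1)) (block p nu i f) := by
  rw [block, block, if_neg (by omega), if_neg (by omega), filter_finRange_succ hp h2,
    List.foldl_append, List.foldl_cons, List.foldl_nil]

/-- A series has a nonzero coefficient at a monomial in the simple variables. -/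
def HasPure (f : Series r) : Prop := ∃ β, IsPure β ∧ f β ≠ 0

theorem HasPure.etaPow {f : Series r} (h : HasPure f) (hf : IsFormal f) (k : Fin r) (mu : ℂ) :
    HasPure (etaPow k mu f) := by
  obtain ⟨β, hβ, h0⟩ := h
  obtain ⟨h1, h2⟩ := etaPow_pure hf hβ k mu
  exact ⟨_, h1, by rwa [h2]⟩

/-- A telescoping sum; `nu` is numbered from `1` and `M` from `0`. -/
theorem sum_exponents {M nu : ℕ → ℂ} {i p : ℕ} (hi : 1 ≤ i) (hip : i ≤ p)
    (hnu : ∀ q < p, nu (q + 1) + 1 = M q - M (q + 1)) :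
    ∑ q ∈ Finset.Icc i p, (nu q + 1) = M (i - 1) - M p := by
  induction p, hip using Nat.le_induction with
  | base =>
    obtain ⟨i, rfl⟩ := Nat.exists_eq_add_of_le' hi
    rw [Finset.Icc_self, Finset.sum_singleton, hnu i (by omega), Nat.add_sub_cancel]
  | succ p hip ih =>
    rw [Finset.sum_Icc_succ_top (by omega), ih fun q hq => hnu q (by omega), hnu p (by omega)]
    ring

/-- The factors of the block carry the entry `M (i - 1)` upwards through adjacent exchanges. When it
meets `M k`, the exponent required by `IsSingSeries.etaPow` is `M (i - 1) - M k`, which is the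
exponent used in the block. -/
theorem IsSingSeries.block {L : Fin (r + 1) → ℂ} {M nu : ℕ → ℂ} {f : Series r} {p : ℕ}
    (hf : IsSingSeries L (fun a => M a.val) f) (hP : HasPure f) (hp : p ≤ r)
    (hnu : ∀ q < p, nu (q + 1) + 1 = M q - M (q + 1)) (i : ℕ) :
    IsSingSeries L (fun a => M (stepPerm p i a.val)) (block p nu i f)
      ∧ HasPure (SlVerma.block p nu i f) := by
  rcases Nat.eq_zero_or_pos i with rfl | hi
  · simpa [stepPerm_zero, SlVerma.block] using ⟨hf, hP⟩
  induction p with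
  | zero =>
    rw [block_of_lt hi]
    exact ⟨hf, hP⟩
  | succ p ih =>
    by_cases hip : i ≤ p + 1
    · obtain ⟨h1, h2⟩ := ih (by omega) fun q hq => hnu q (by omega)
      rw [block_succ (by omega) hi hip]
      refine ⟨?_, h2.etaPow h1.formal _ _⟩
      convert h1.etaPow ⟨p, by omega⟩ ?_ using 1
      · funext a
        rw [stepPerm_succ hi hip, Function.comp_apply, Equiv.Perm.mul_apply]
        congr 2
        simp only [Equiv.swap_apply_def, Fin.ext_iff, Fin.val_castSucc, Fin.val_succ]
        split_ifs <;> simp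
      · rw [sum_exponents hi hip hnu]
        simp only [Fin.val_castSucc, Fin.val_succ]
        rw [stepPerm_fix _ _ (Nat.lt_succ_self p), stepPerm_apply hi hip]
        congr 2
        split_ifs <;> omega
    · rw [block_of_lt (by omega), stepPerm_of_lt (by omega)]
      exact ⟨hf, hP⟩

/-- `stepSeq` recomputes the differences of neighbouring entries after one entry has been moved to
the top position. Where that entry is taken out, two differences merge into one. -/
theorem stepSeq_spec {M nu : ℕ → ℂ} {p i : ℕ} (hi : i ≤ p + 1)
    (hnu : ∀ q < p + 1, nu (q + 1) + 1 = M q - M (q + 1)) (q : ℕ) (hq : q < p) :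
    stepSeq nu i (q + 1) + 1
      = M (stepPerm (p + 1) i q) - M (stepPerm (p + 1) i (q + 1)) := by
  rcases Nat.eq_zero_or_pos i with rfl | h1
  · rw [stepPerm_zero, stepSeq, if_pos (Or.inl rfl)]
    exact hnu q (by omega)
  rw [stepPerm_apply h1 (by omega), stepPerm_apply h1 (by omega), stepSeq]
  by_cases h2 : q + 1 + 1 < i
  · rw [if_pos (Or.inr h2), if_pos (by omega), if_pos h2]
    exact hnu q (by omega)
  rw [if_neg (by omega), if_neg h2, if_pos (show q + 1 < p + 1 by omega)]
  by_cases h3 : q + 1 + 1 = i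
  · rw [if_pos h3, if_pos (by omega)]
    linear_combination hnu q (by omega) + hnu (q + 1) (by omega)
  · rw [if_neg h3, if_neg (by omega), if_pos (by omega)]
    exact hnu (q + 1) (by omega)

theorem Idx.get_le (i : Idx r) (p : ℕ) : i.get p ≤ p + 1 := by
  rw [Idx.get]
  split_ifs with h
  · exact Nat.lt_succ_iff.mp (i ⟨p, h⟩).isLt
  · exact Nat.zero_le _

theorem IsSingSeries.thetaAux {L : Fin (r + 1) → ℂ} (i : Idx r) {M nu : ℕ → ℂ} {f : Series r}
    {p : ℕ} (hf : IsSingSeries L (fun a => M a.val) f) (hP : HasPure f) (hp : p ≤ r)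
    (hnu : ∀ q < p, nu (q + 1) + 1 = M q - M (q + 1)) :
    IsSingSeries L (fun a => M (finalPerm i.get p a.val)) (thetaAux i p nu f)
      ∧ HasPure (SlVerma.thetaAux i p nu f) := by
  induction p generalizing M nu f with
  | zero => exact ⟨hf, hP⟩
  | succ p ih =>
    obtain ⟨h1, h2⟩ := hf.block hP hp hnu (i.get p)
    exact ih (M := fun j => M (stepPerm (p + 1) (i.get p) j)) h1 h2 (by omega)
      (stepSeq_spec (i.get_le p) hnu)

/-- The highest weight shifted by half the sum of the positive roots, as a weight of `gl(n)`. -/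
def rhoWt (lam : Fin r → ℂ) (j : ℕ) : ℂ :=
  if h : j < r + 1 then glWt lam ⟨j, h⟩ - j else 0

theorem rhoWt_val (lam : Fin r → ℂ) (a : Fin (r + 1)) :
    rhoWt lam a.val + a.val = glWt lam a := by
  rw [rhoWt, dif_pos a.isLt, sub_add_cancel]

theorem lamSeq_spec (lam : Fin r → ℂ) (q : ℕ) (hq : q < r) :
    lamSeq lam (q + 1) + 1 = rhoWt lam q - rhoWt lam (q + 1) := by
  have h := glWt_sub lam ⟨q, hq⟩
  rw [lamSeq, dif_pos ⟨by omega, by omega⟩, rhoWt, rhoWt, dif_pos (by omega), dif_pos (by omega)]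
  simp only [Nat.add_sub_cancel]
  rw [← h]
  push_cast
  simp only [Fin.castSucc_mk, Fin.succ_mk]
  ring

theorem isSingSeries_vac (lam : Fin r → ℂ) :
    IsSingSeries (glWt lam) (fun a => rhoWt lam a.val) (vac r) where
  formal := isFormal_toSeries 1
  upper k := gl_upper_vac _ Fin.castSucc_lt_succ
  weight a := by rw [gl_diag_vac, rhoWt_val]

theorem hasPure_vac : HasPure (vac r) := by
  refine ⟨0, fun v _ => rfl, ?_⟩
  have h := toSeries_castExp (1 : Poly r) 0
  have h0 : castExp (0 : NegRoot r →₀ ℕ) = 0 := by funext v; simp [castExp]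
  rw [h0] at h
  rw [vac, h]
  simp

theorem isSingSeries_theta (lam : Fin r → ℂ) (i : Idx r) :
    IsSingSeries (glWt lam) (fun a => rhoWt lam (finalPerm i.get r a.val)) (theta lam i)
      ∧ HasPure (theta lam i) :=
  (isSingSeries_vac lam).thetaAux i hasPure_vac le_rfl (lamSeq_spec lam)

theorem exists_perm_of_map_univ_eq {ι α : Type*} [Fintype ι] {m m' : ι → α}
    (h : Finset.univ.val.map m = Finset.univ.val.map m') : ∃ σ : Equiv.Perm ι, m = m' ∘ σ := by
  classical
  have e : ∀ x, Nonempty ({a // m a = x} ≃ {a // m' a = x}) := fun x => by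
    have h1 := congrArg (Multiset.count x) h
    rw [Multiset.count_map, Multiset.count_map, ← Finset.filter_val, ← Finset.filter_val,
      Finset.card_val, Finset.card_val] at h1
    rw [← Fintype.card_eq, Fintype.card_subtype, Fintype.card_subtype]
    simpa only [eq_comm] using h1
  exact ⟨Equiv.ofFiberEquiv fun x => (e x).some, funext fun a =>
    (Equiv.ofFiberEquiv_map _ a).symm⟩

/-- Every weight linked to the highest weight is the weight of one of the series. -/
theorem exists_idx (lam : Fin r → ℂ) {m : Fin (r + 1) → ℂ}
    (h : Finset.univ.val.map m = Finset.univ.val.map fun a : Fin (r + 1) => rhoWt lam a.val) :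
    ∃ i : Idx r, ∀ a, m a = rhoWt lam (finalPerm i.get r a.val) := by
  obtain ⟨σ, rfl⟩ := exists_perm_of_map_univ_eq h
  let τ : Equiv.Perm ℕ := σ.extendDomain Fin.equivSubtype
  have hτ : ∀ a : Fin (r + 1), τ a.val = (σ a).val := fun a =>
    Equiv.Perm.extendDomain_apply_image σ Fin.equivSubtype a
  obtain ⟨c, hc, hp⟩ := exists_finalPerm r τ fun j hj =>
    Equiv.Perm.extendDomain_apply_not_subtype σ Fin.equivSubtype (by omega)
  refine ⟨fun p => ⟨c p.val, Nat.lt_succ_of_le (hc p.val)⟩, fun a => ?_⟩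
  rw [finalPerm_congr (c' := c), hp, hτ, Function.comp_apply]
  intro q hq
  simp only [Idx.get, dif_pos hq]

theorem idx_injective {lam : Fin r → ℂ}
    (hlam : Function.Injective fun a : Fin (r + 1) => rhoWt lam a.val)
    {i i' : Idx r} (h : ∀ a : Fin (r + 1), rhoWt lam (finalPerm i.get r a.val)
      = rhoWt lam (finalPerm i'.get r a.val)) : i = i' := by
  have hle : ∀ (c : ℕ → ℕ) (j : ℕ), j < r + 1 → finalPerm c r j < r + 1 := by
    intro c j hj
    by_contra hc
    have := (finalPerm c r).injective (finalPerm_fix c r (show r < finalPerm c r j by omega))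
    omega
  have hp : finalPerm i.get r = finalPerm i'.get r := by
    ext j
    by_cases hj : j < r + 1
    · exact congrArg Fin.val (@hlam ⟨_, hle i.get j hj⟩ ⟨_, hle i'.get j hj⟩ (h ⟨j, hj⟩))
    · rw [finalPerm_fix _ _ (by omega), finalPerm_fix _ _ (by omega)]
  funext p
  have := finalPerm_injective i.get_le i'.get_le hp p.val p.isLt
  simp only [Idx.get, dif_pos p.isLt] at this
  exact Fin.ext this

end Theta

/-! ### Polynomial series -/

section Polynomial

variable {r : ℕ}

theorem fallFact_natCast (n p : ℕ) : fallFact n p / (p.factorial : ℂ) = n.choose p := by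
  induction p with
  | zero => simp [fallFact]
  | succ p ih =>
    have hp : (p + 1 : ℂ) ≠ 0 := by exact_mod_cast p.succ_ne_zero
    refine mul_right_cancel₀ hp ?_
    rw [fallFact_succ, ih]
    have h := congrArg (Nat.cast (R := ℂ)) (Nat.choose_succ_right_eq n p)
    push_cast at h
    rw [h]
    rcases le_or_gt p n with hpn | hpn
    · rw [Nat.cast_sub hpn]
    · rw [Nat.choose_eq_zero_of_lt hpn, Nat.cast_zero, zero_mul, zero_mul]

theorem commute_dOp_xPow (k : Fin r) (c : ℂ) : Commute (dOp k) (xPow (simpleRoot k) c) := by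
  rw [commute_iff_lie_eq, dOp_eq, lie_sum_row_simple, if_neg (castSucc_ne_succ_self k)]

theorem xPow_one_pow (v : NegRoot r) (n : ℕ) : xPow v 1 ^ n = xPow v (n : ℂ) := by
  induction n with
  | zero => rw [pow_zero, Nat.cast_zero, xPow_zero]
  | succ n ih => rw [pow_succ, ih, xPow_mul_xPow, Nat.cast_succ]

/-- The powers with natural exponents are the powers of the action of `E_{k+1,k}`. -/
theorem etaPow_natCast (L : Fin (r + 1) → ℂ) {f : Series r} (k : Fin r) (n : ℕ) :
    etaPow k n f = (gl L k.succ k.castSucc ^ n) f := by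
  funext β
  rw [gl_simple_lower, add_comm, (commute_dOp_xPow k 1).add_pow, LinearMap.sum_apply,
    Finset.sum_apply, etaPow]
  rw [finsum_eq_sum_of_support_subset (s := Finset.range (n + 1))]
  · refine Finset.sum_congr rfl fun p hp => ?_
    rw [fallFact_natCast, ((commute_dOp_xPow k 1).pow_pow p (n - p)).eq, xPow_one_pow,
      Nat.cast_sub (Nat.lt_succ_iff.mp (Finset.mem_range.mp hp)), Module.End.mul_apply,
      Module.End.natCast_apply, map_nsmul, Pi.smul_apply, nsmul_eq_mul, Module.End.mul_apply]
  · intro p hp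
    rw [Function.mem_support, fallFact_natCast] at hp
    rw [Finset.coe_range, Set.mem_Iio]
    by_contra h
    exact hp (by rw [Nat.choose_eq_zero_of_lt (by omega), Nat.cast_zero, zero_mul])

/-- The series is a polynomial. -/
def IsPoly (f : Series r) : Prop := ∃ g : Poly r, toSeries g = f

theorem IsPoly.exists_realize {f : Series r} (hf : IsPoly f) (lam : Fin r → ℂ) :
    ∃ u : Verma lam, realize lam u = f := by
  obtain ⟨g, rfl⟩ := hf
  exact ⟨_, realize_tauInv lam g⟩

theorem isPoly_realize (lam : Fin r → ℂ) (u : Verma lam) : IsPoly (realize lam u) := by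
  obtain ⟨g, rfl⟩ := tauInv_surjective lam u
  exact ⟨g, (realize_tauInv lam g).symm⟩

/-- For natural exponents `η_k` is the action of `E_{k+1,k}`, which preserves the image of a Verma
module, that is, the polynomials. This operator is the same for every highest weight, so weight `0`
serves. -/
theorem IsPoly.etaPow {f : Series r} (hf : IsPoly f) (k : Fin r) (n : ℕ) :
    IsPoly (etaPow k n f) := by
  rw [etaPow_natCast (glWt 0)]
  induction n with
  | zero => simpa using hf
  | succ n ih =>
    obtain ⟨u, hu⟩ := ih.exists_realize 0
    rw [pow_succ', Module.End.mul_apply, ← hu, ← act_E _ (castSucc_ne_succ_self k).symm,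
      ← realize_smul]
    exact isPoly_realize 0 _

theorem IsPoly.block {f : Series r} (hf : IsPoly f) {nu : ℕ → ℂ} {p : ℕ} (hp : p ≤ r)
    (hnu : ∀ q < p, ∃ n : ℕ, nu (q + 1) = n) (i : ℕ) : IsPoly (block p nu i f) := by
  rcases Nat.eq_zero_or_pos i with rfl | hi
  · simpa [SlVerma.block] using hf
  induction p with
  | zero => rwa [block_of_lt hi]
  | succ p ih =>
    by_cases hip : i ≤ p + 1
    · rw [block_succ (by omega) hi hip]
      have h : ∃ n : ℕ, ∑ q ∈ Finset.Icc i (p + 1), (nu q + 1) = n := by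
        have h1 : ∀ q, ∃ n : ℕ, q ∈ Finset.Icc i (p + 1) → nu q + 1 = n := fun q => by
          by_cases hq : q ∈ Finset.Icc i (p + 1)
          · rw [Finset.mem_Icc] at hq
            obtain ⟨n, hn⟩ := hnu (q - 1) (by omega)
            rw [Nat.sub_add_cancel (by omega)] at hn
            exact ⟨n + 1, fun _ => by rw [hn, Nat.cast_succ]⟩
          · exact ⟨0, fun h => absurd h hq⟩
        choose n hn using h1
        exact ⟨∑ q ∈ Finset.Icc i (p + 1), n q, by
          rw [Nat.cast_sum, Finset.sum_congr rfl hn]⟩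
      obtain ⟨n, hn⟩ := h
      rw [hn]
      exact (ih (by omega) fun q hq => hnu q (by omega)).etaPow _ n
    · rwa [block_of_lt (by omega)]

theorem stepSeq_natCast {nu : ℕ → ℂ} {p : ℕ} (hnu : ∀ q < p + 1, ∃ n : ℕ, nu (q + 1) = n) (i : ℕ)
    (q : ℕ) (hq : q < p) : ∃ n : ℕ, stepSeq nu i (q + 1) = n := by
  obtain ⟨a, ha⟩ := hnu q (by omega)
  obtain ⟨b, hb⟩ := hnu (q + 1) (by omega)
  rw [stepSeq]
  split_ifs
  · exact ⟨a, ha⟩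
  · exact ⟨b + a + 1, by rw [ha, hb]; push_cast; rfl⟩
  · exact ⟨b, hb⟩

theorem IsPoly.thetaAux (i : Idx r) {f : Series r} (hf : IsPoly f) {nu : ℕ → ℂ} {p : ℕ}
    (hp : p ≤ r) (hnu : ∀ q < p, ∃ n : ℕ, nu (q + 1) = n) : IsPoly (thetaAux i p nu f) := by
  induction p generalizing nu f with
  | zero => exact hf
  | succ p ih => exact ih (hf.block hp hnu _) (by omega) (stepSeq_natCast hnu _)

theorem lamSeq_succ (lam : Fin r → ℂ) (k : Fin r) : lamSeq lam (k.val + 1) = lam k := by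
  rw [lamSeq, dif_pos ⟨by omega, by omega⟩]
  rfl

theorem isPoly_theta {lam : Fin r → ℂ} (hlam : ∀ k, ∃ m : ℕ, lam k = m) (i : Idx r) :
    IsPoly (theta lam i) :=
  IsPoly.thetaAux i ⟨1, rfl⟩ le_rfl fun q hq => by
    obtain ⟨n, hn⟩ := hlam ⟨q, hq⟩
    exact ⟨n, by rw [← hn, ← lamSeq_succ lam ⟨q, hq⟩]⟩

end Polynomial

/-! ### Singular vectors -/

section Main

variable {r : ℕ} {lam : Fin r → ℂ}

/-- The Euler operator of each variable occurs once for its row and once, with the opposite sign,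
for its column. -/
theorem sum_gl_diag (L : Fin (r + 1) → ℂ) : ∑ a, gl L a a = algebraMap ℂ _ (∑ a, L a) := by
  simp only [gl_diag, Finset.sum_add_distrib, Finset.sum_sub_distrib, map_sum]
  rw [Finset.sum_comm (f := fun a k => xOp k a * pdOp k a), sub_add_cancel]

/-- An `sl(n)`-weight fixes only the differences of the eigenvalues of the `E_{a,a}`. Their sum acts
as a scalar by `sum_gl_diag`, which determines each eigenvalue. -/
theorem isSingular_iff (u : Verma lam) :
    IsSingular lam u ↔ u ≠ 0 ∧ ∃ m, IsSingSeries (glWt lam) m (realize lam u) := by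
  refine and_congr_right fun _ => ⟨fun ⟨⟨mu, hmu⟩, hE⟩ => ?_, fun ⟨m, hm⟩ => ⟨?_, fun k => ?_⟩⟩
  · set f := realize lam u with hf
    have h1 : ∀ k : Fin r, gl (glWt lam) k.castSucc k.castSucc f
        - gl (glWt lam) k.succ k.succ f = mu k • f := fun k => by
      rw [← LinearMap.sub_apply, ← act_H, hf, ← realize_smul, hmu, map_smul]
    have h2 : ∀ a, ∃ c : ℂ, gl (glWt lam) a a f = gl (glWt lam) 0 0 f + c • f := by
      intro a
      induction a using Fin.induction with
      | zero => exact ⟨0, by rw [zero_smul, add_zero]⟩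
      | succ k ih =>
        obtain ⟨c, hc⟩ := ih
        refine ⟨c - mu k, ?_⟩
        rw [sub_smul, ← h1 k, hc]
        abel
    choose c hc using h2
    have h3 : gl (glWt lam) 0 0 f = ((∑ a, glWt lam a - ∑ a, c a) / (r + 1)) • f := by
      have h4 := LinearMap.congr_fun (sum_gl_diag (glWt lam)) f
      rw [LinearMap.sum_apply, Finset.sum_congr rfl fun a _ => hc a, Finset.sum_add_distrib,
        ← Finset.sum_smul, Module.algebraMap_end_apply, Finset.sum_const, Finset.card_univ,
        Fintype.card_fin, ← Nat.cast_smul_eq_nsmul ℂ, ← eq_sub_iff_add_eq, ← sub_smul] at h4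
      have h5 : ((r + 1 : ℕ) : ℂ) ≠ 0 := Nat.cast_ne_zero.mpr r.succ_ne_zero
      rw [div_eq_inv_mul, ← smul_smul, ← h4, smul_smul]
      push_cast at h5 ⊢
      rw [inv_mul_cancel₀ h5, one_smul]
    refine ⟨fun a => (∑ a, glWt lam a - ∑ a, c a) / (r + 1) + c a - a.val, ?_, fun k => ?_,
      fun a => ?_⟩
    · obtain ⟨g, hg⟩ := isPoly_realize lam u
      rw [hf, ← hg]
      exact isFormal_toSeries g
    · rw [← act_E _ (castSucc_ne_succ_self k), hf, ← realize_smul, hE, map_zero]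
    · rw [hc, h3, sub_add_cancel, add_smul]
  · refine ⟨fun k => (m k.castSucc + k.castSucc.val) - (m k.succ + k.succ.val), fun k => ?_⟩
    apply realize_injective lam
    rw [realize_smul, act_H, map_smul, LinearMap.sub_apply, hm.weight, hm.weight, sub_smul]
  · apply realize_injective lam
    rw [realize_smul, act_E, hm.upper, map_zero]

theorem IsSingSeries.smul {L m : Fin (r + 1) → ℂ} {f : Series r} (hf : IsSingSeries L m f) (c : ℂ) :
    IsSingSeries L m (c • f) where
  formal := hf.formal.smul c
  upper k := by rw [map_smul, hf.upper, smul_zero]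
  weight a := by rw [map_smul, hf.weight, smul_comm]

theorem HasPure.ne_zero {f : Series r} (h : HasPure f) : f ≠ 0 := by
  rintro rfl
  obtain ⟨β, -, h⟩ := h
  exact h rfl

/-- Linkage provides a `θ_i` of the same weight as `u`, and uniqueness makes the image of `u` a
multiple of it. Polynomiality of `θ_i` is then a consequence, since `u` comes from a polynomial. -/
theorem isSingular_iff_theta (u : Verma lam) : IsSingular lam u ↔
    ∃ (i : Idx r) (g : Poly r) (c : ℂ), toSeries g = theta lam i ∧ c ≠ 0 ∧ u = c • tauInv lam g := by
  rw [isSingular_iff]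
  constructor
  · rintro ⟨hu, m, hm⟩
    obtain ⟨i, hi⟩ := exists_idx lam (multiset_eq_of_sum_diagVal
      (sum_diagVal_eq hu (fun a => (rhoWt_val lam a).symm) hm.upper hm.weight))
    obtain ⟨h1, β, hβ, h2⟩ := isSingSeries_theta lam i
    rw [← funext hi] at h1
    have h3 := hm.eq_smul h1 hβ h2
    set c := realize lam u β / theta lam i β
    have hc : c ≠ 0 := by
      intro hc
      rw [hc, zero_smul] at h3
      exact hu (realize_injective lam (h3.trans (map_zero _).symm))
    obtain ⟨g, rfl⟩ := tauInv_surjective lam u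
    refine ⟨i, c⁻¹ • g, c, ?_, hc, ?_⟩
    · rw [toSeries_smul, ← realize_tauInv lam, h3, smul_smul, inv_mul_cancel₀ hc, one_smul]
    · rw [map_smul, smul_smul, mul_inv_cancel₀ hc, one_smul]
  · rintro ⟨i, g, c, hg, hc, rfl⟩
    obtain ⟨h1, h2⟩ := isSingSeries_theta lam i
    have h3 : realize lam (c • tauInv lam g) = c • theta lam i := by
      rw [map_smul, realize_tauInv, hg]
    refine ⟨fun h0 => ?_, _, by rw [h3]; exact h1.smul c⟩
    rw [h0, map_zero] at h3
    exact (smul_ne_zero hc h2.ne_zero) h3.symm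

theorem card_idx (r : ℕ) : Fintype.card (Idx r) = (r + 1).factorial := by
  rw [Fintype.card_pi]
  simp only [Fintype.card_fin]
  rw [Fin.prod_univ_eq_prod_range (fun p => p + 2) r]
  induction r with
  | zero => rfl
  | succ r ih => rw [Finset.prod_range_succ, ih, Nat.factorial_succ (r + 1), mul_comm]

/-- The lines of the polynomial series are the singular lines. -/
theorem singularLines_eq_image {g : Idx r → Poly r}
    (hg : ∀ i, IsPoly (theta lam i) → toSeries (g i) = theta lam i) :
    singularLines lam
      = (fun i => Submodule.span ℂ {tauInv lam (g i)}) '' {i | IsPoly (theta lam i)} := by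
  ext N
  simp only [singularLines, Set.mem_ofPred_eq, Set.mem_image]
  constructor
  · rintro ⟨u, hu, rfl⟩
    obtain ⟨i, g', c, h1, hc, rfl⟩ := (isSingular_iff_theta u).mp hu
    have hi : IsPoly (theta lam i) := ⟨g', h1⟩
    refine ⟨i, hi, ?_⟩
    rw [toSeries_injective ((hg i hi).trans h1.symm),
      Submodule.span_singleton_smul_eq (IsUnit.mk0 c hc)]
  · rintro ⟨i, hi, rfl⟩
    exact ⟨_, (isSingular_iff_theta _).mpr ⟨i, g i, 1, hg i hi, one_ne_zero, (one_smul _ _).symm⟩,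
      rfl⟩

theorem exists_polys (lam : Fin r → ℂ) :
    ∃ g : Idx r → Poly r, ∀ i, IsPoly (theta lam i) → toSeries (g i) = theta lam i := by
  have : ∀ i, ∃ g : Poly r, IsPoly (theta lam i) → toSeries g = theta lam i := fun i => by
    by_cases h : IsPoly (theta lam i)
    · exact ⟨h.choose, fun _ => h.choose_spec⟩
    · exact ⟨0, fun h' => absurd h' h⟩
  exact ⟨fun i => (this i).choose, fun i => (this i).choose_spec⟩

/-! ### Dominant integral weights. -/

theorem rhoWt_sub_natCast (hlam : ∀ k, ∃ m : ℕ, lam k = m) (a d : ℕ) (h : a + d + 1 ≤ r) :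
    ∃ n : ℕ, rhoWt lam a - rhoWt lam (a + d + 1) = n + 1 := by
  have h1 : ∀ q < r, ∃ n : ℕ, rhoWt lam q - rhoWt lam (q + 1) = n + 1 := fun q hq => by
    obtain ⟨n, hn⟩ := hlam ⟨q, hq⟩
    exact ⟨n, by rw [← lamSeq_spec lam q hq, ← hn, ← lamSeq_succ lam ⟨q, hq⟩]⟩
  induction d with
  | zero => exact h1 a (by omega)
  | succ d ih =>
    obtain ⟨n, hn⟩ := ih (by omega)
    obtain ⟨n', hn'⟩ := h1 (a + d + 1) (by omega)
    refine ⟨n + n' + 1, ?_⟩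
    rw [← add_assoc]
    push_cast
    linear_combination hn + hn'

theorem rhoWt_injective (hlam : ∀ k, ∃ m : ℕ, lam k = m) :
    Function.Injective fun a : Fin (r + 1) => rhoWt lam a.val := by
  have h : ∀ a b : Fin (r + 1), a < b → rhoWt lam a.val ≠ rhoWt lam b.val := by
    intro a b hab heq
    obtain ⟨n, hn⟩ := rhoWt_sub_natCast hlam a.val (b.val - a.val - 1) (by omega)
    rw [show a.val + (b.val - a.val - 1) + 1 = b.val by omega, heq, sub_self] at hn
    exact Nat.cast_add_one_ne_zero n hn.symm
  intro a b hab
  rcases lt_trichotomy a b with hlt | heq | hlt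
  · exact absurd hab (h a b hlt)
  · exact heq
  · exact absurd hab.symm (h b a hlt)

/-- Proportional vectors have equal weights, and for a regular shifted weight distinct index vectors
give distinct weights. -/
theorem span_injective (hlam : ∀ k, ∃ m : ℕ, lam k = m) {g : Idx r → Poly r}
    (hg : ∀ i, toSeries (g i) = theta lam i) :
    Function.Injective fun i => Submodule.span ℂ {tauInv lam (g i)} := by
  intro i i' h
  obtain ⟨c, hc⟩ := Submodule.span_singleton_eq_span_singleton.mp h
  have h1 : (c : ℂ) • theta lam i = theta lam i' := by
    have h2 := congrArg (realize lam) hc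
    rw [Units.smul_def, map_smul, realize_tauInv, realize_tauInv, hg, hg] at h2
    exact h2
  obtain ⟨h2, -⟩ := isSingSeries_theta lam i
  obtain ⟨h3, h4⟩ := isSingSeries_theta lam i'
  refine idx_injective (rhoWt_injective hlam) fun a => ?_
  have h5 := (h2.smul (c : ℂ)).weight a
  rw [h1, h3.weight] at h5
  exact (add_right_cancel (smul_left_injective ℂ h4.ne_zero h5)).symm

theorem thetaAux_of_zero {i : Idx r} {p : ℕ} (h : ∀ q < p, i.get q = 0) (nu : ℕ → ℂ)
    (f : Series r) : thetaAux i p nu f = f := by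
  induction p generalizing nu f with
  | zero => rfl
  | succ p ih =>
    rw [thetaAux, ih fun q hq => h q (by omega), h p (by omega), block, if_pos rfl]

/-- A block whose lower and upper ends coincide consists of one factor, and `i_p = 0` leaves both
the series and the weight unchanged. -/
theorem thetaAux_single {i : Idx r} (k : Fin r) (h : ∀ q, i.get q = if q = k.val then k.val + 1 else 0)
    {p : ℕ} (hp : k.val < p) (nu : ℕ → ℂ) (f : Series r) :
    thetaAux i p nu f = etaPow k (nu (k.val + 1) + 1) f := by
  induction p with
  | zero => omega
  | succ p ih =>
    rw [thetaAux, h]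
    split_ifs with hpk
    · subst hpk
      rw [thetaAux_of_zero fun q hq => by rw [h, if_neg hq.ne], block_succ k.isLt (by omega) le_rfl,
        block_of_lt (by omega), Finset.Icc_self, Finset.sum_singleton]
    · have hs : stepSeq nu 0 = nu := funext fun j => if_pos (Or.inl rfl)
      rw [block, if_pos rfl, hs, ih (by omega)]

theorem etaPow_vac (k : Fin r) (mu : ℂ) :
    etaPow k mu (vac r) = xPow (simpleRoot k) mu (vac r) := by
  have hd : ∀ p, p ≠ 0 → (dOp k ^ p) (vac r) = 0 := fun p hp => by
    obtain ⟨p, rfl⟩ := Nat.exists_eq_succ_of_ne_zero hp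
    have h0 : dOp k (vac r) = 0 := by
      rw [dOp_eq, LinearMap.sum_apply]
      exact Finset.sum_eq_zero fun c _ => by rw [Module.End.mul_apply, pdOp_vac, map_zero]
    rw [pow_succ, Module.End.mul_apply, h0, map_zero]
  funext β
  rw [etaPow, finsum_eq_single _ 0 fun p hp => by rw [hd p hp, map_zero, Pi.zero_apply, mul_zero]]
  simp [fallFact]

theorem vac_zero : vac r 0 = 1 := by
  have h := toSeries_castExp (1 : Poly r) 0
  rw [show castExp (0 : NegRoot r →₀ ℕ) = 0 by funext v; simp [castExp]] at h
  rw [vac, h, MvPolynomial.coeff_zero_one]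

/-- If all lines occur, the weight is dominant. -/
theorem dominant_of_injective {g : Idx r → Poly r} (hg : ∀ i, toSeries (g i) = theta lam i)
    (hinj : Function.Injective fun i => Submodule.span ℂ {tauInv lam (g i)}) (k : Fin r) :
    ∃ m : ℕ, lam k = m := by
  -- This index vector belongs to the simple reflection `s_k`; its series is the single monomial
  -- `x_{k+1,k}^{λ_k + 1}`.
  let i : Idx r := Function.update 0 k (Fin.last _)
  have hi : ∀ q, i.get q = if q = k.val then k.val + 1 else 0 := by
    intro q
    rw [Idx.get]
    by_cases hq : q < r
    · rw [dif_pos hq]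
      by_cases hqk : q = k.val
      · subst hqk
        rw [if_pos rfl]
        simp [i]
      · rw [if_neg hqk]
        simp only [i]
        rw [Function.update_of_ne (fun h => hqk (congrArg Fin.val h))]
        rfl
    · rw [dif_neg hq, if_neg (by omega)]
  have h1 : theta lam i = xPow (simpleRoot k) (lam k + 1) (vac r) := by
    rw [theta, thetaAux_single k hi k.isLt, lamSeq_succ, etaPow_vac]
  have h2 : theta lam (0 : Idx r) = vac r := by
    refine thetaAux_of_zero (fun q hq => ?_) _ _
    rw [Idx.get, dif_pos hq]
    rfl
  have h3 : toSeries (g i) (Pi.single (simpleRoot k) (lam k + 1)) ≠ 0 := by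
    rw [hg, h1, xPow_apply, sub_self, vac_zero]
    exact one_ne_zero
  obtain ⟨m, hm⟩ : ∃ m, Pi.single (simpleRoot k) (lam k + 1) = castExp m := by
    by_contra hc
    push Not at hc
    exact h3 (toSeries_eq_zero _ hc)
  have h4 : lam k + 1 = m (simpleRoot k) := by
    have := congrFun hm (simpleRoot k)
    rwa [Pi.single_eq_same] at this
  rcases hmk : m (simpleRoot k) with _ | n
  -- If `λ_k = -1`, the reflection fixes the shifted weight and `θ_i = 1 = θ_0`, so two indices
  -- would give the same line.
  · rw [hmk, Nat.cast_zero] at h4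
    have h5 : g i = g 0 := toSeries_injective (by
      rw [hg, hg, h1, h2, h4, xPow_zero, Module.End.one_apply])
    have h6 : i = 0 := hinj (by simp only [h5])
    have h7 := hi k.val
    rw [if_pos rfl, h6, Idx.get, dif_pos k.isLt] at h7
    exact absurd h7 (by simp)
  · rw [hmk, Nat.cast_succ] at h4
    exact ⟨n, add_right_cancel h4⟩

end Main

end SlVerma

end

open SlVerma
theorem corollary3p4 (r : ℕ) (lam : Fin r → ℂ) :
    Function.Bijective (tauInv lam) ∧
    (singularLines lam).encard ≤ ((r + 1).factorial : ℕ∞) ∧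
    (∀ u : Verma lam, IsSingular lam u ↔
      ∃ (i : Idx r) (g : Poly r) (c : ℂ),
        toSeries g = theta lam i ∧ c ≠ 0 ∧ u = c • tauInv lam g) ∧
    ((singularLines lam).encard = ((r + 1).factorial : ℕ∞) ↔ ∀ k, ∃ m : ℕ, lam k = m) ∧
    ((∀ k, ∃ m : ℕ, lam k = m) →
      ∃ g : Idx r → Poly r, (∀ i, toSeries (g i) = theta lam i) ∧
        Function.Injective (fun i => Submodule.span ℂ {tauInv lam (g i)}) ∧
        singularLines lam = Set.range fun i => Submodule.span ℂ {tauInv lam (g i)}) := by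
  obtain ⟨g, hg⟩ := exists_polys lam
  have hlines := singularLines_eq_image hg
  have hcard : (Set.univ : Set (Idx r)).encard = ((r + 1).factorial : ℕ∞) := by
    rw [Set.encard_univ, ENat.card_eq_coe_fintype_card, card_idx]
  have hle : {i | IsPoly (theta lam i)}.encard ≤ ((r + 1).factorial : ℕ∞) :=
    hcard ▸ Set.encard_le_encard (Set.subset_univ _)
  have hdom : (∀ k, ∃ m : ℕ, lam k = m) → (∀ i, toSeries (g i) = theta lam i) ∧
      Function.Injective (fun i => Submodule.span ℂ {tauInv lam (g i)}) ∧
      singularLines lam = Set.range fun i => Submodule.span ℂ {tauInv lam (g i)} := fun hlam => by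
    have hall := fun i => hg i (isPoly_theta hlam i)
    refine ⟨hall, span_injective hlam hall, ?_⟩
    rw [hlines, ← Set.image_univ]
    congr 1
    exact Set.eq_univ_of_forall fun i => isPoly_theta hlam i
  refine ⟨tauInv_bijective lam, ?_, isSingular_iff_theta, ⟨fun h => ?_, fun hlam => ?_⟩,
    fun hlam => ⟨g, hdom hlam⟩⟩
  · rw [hlines]
    exact (Set.encard_image_le _ _).trans hle
  · rw [hlines] at h
    have h1 := Set.encard_image_le (fun i => Submodule.span ℂ {tauInv lam (g i)})
      {i | IsPoly (theta lam i)}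
    -- There are only `n!` index vectors. If their image has `n!` lines, every `θ_i` must be a
    -- polynomial, and no two may span the same line.
    have h2 : {i | IsPoly (theta lam i)} = Set.univ :=
      (Set.toFinite _).eq_of_subset_of_encard_le (Set.subset_univ _) (by rw [hcard, ← h]; exact h1)
    rw [h2] at h
    have hinj := Set.finite_univ.injOn_of_encard_image_eq (h.trans hcard.symm)
    exact dominant_of_injective (fun i => hg i (h2 ▸ Set.mem_univ i : i ∈ {i | IsPoly (theta lam i)}))
      (Set.injOn_univ.mp hinj)
  · obtain ⟨-, hinj, hrange⟩ := hdom hlam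
    rw [hrange, ← Set.image_univ, hinj.injOn.encard_image, hcard]
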